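/- All groups are finite. Let $G$ be a finite group and $p$ a prime. A chief factor $L/K$ of $G$ is given by normal subgroups $K<L$ of $G$ with no normal subgroup of $G$ strictly between them; it lies below a normal subgroup $H$ if $L\le H$. A subgroup $H$ of $G$ satisfies the $\Pi$-property in $G$ if, for every chief factor $L/K$ of $G$, every prime divisor of $|G/K:N_{G/K}(HK/K\cap L/K)|$ divides $|HK/K\cap L/K|$; it satisfies the $IC$-$\Pi$-property in $G$ if $H\cap[H,G]$ satisfies the $\Pi$-property in $G$. Let $Z_{p\mathfrak U}(G)$ be the product of all normal subgroups $H$ of $G$ such that every chief factor of $G$ below $H$ whose order is divisible by $p$ is cyclic. For a finite group $A$, let $F^*_p(A)$, the generalized $p$-Fitting subgroup, be the set of all $x\in A$ that induce by conjugation an inner automorphism on every chief factor of $A$ whose order is divisible by $p$. **Theorem.** Let $N$ be a normal subgroup of $G$ such that $p$ divides $|N|$, and let $X$ be a normal subgroup of $G$ with $F^*_p(N)\le X\le N$. Suppose that there are a Sylow $p$-subgroup $P$ of $X$ and a power $d$ of $p$ with $1<d<|P|$ such that 1. every subgroup of $P$ of order $d$ satisfies the $IC$-$\Pi$-property in $G$;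 and 2. if $p=d=2$ and $P$ is non-abelian, then every cyclic subgroup of $P$ of order $4$ satisfies the $IC$-$\Pi$-property in $G$. Then $N\le Z_{p\mathfrak U}(G)$. -/

import Mathlib

namespace ICPi

variable {G : Type*} [Group G]

/-- `L / K` is a chief factor of `G`: `K < L` are normal subgroups of `G` and no normal subgroup
of `G` lies strictly between them. -/
structure IsChiefFactor (K L : Subgroup G) : Prop where
  normal_bot : K.Normal
  normal_top : L.Normal
  lt : K < L
  eq_or_eq : ∀ M : Subgroup G, M.Normal → K ≤ M → M ≤ L → M = K ∨ M = L

/-- The image `HK / K` of `H` in `G / K`; for `K ≤ L` the subgroup `quot K L` is `L / K`. -/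
def quot (K H : Subgroup G) [K.Normal] : Subgroup (G ⧸ K) :=
  H.map (QuotientGroup.mk' K)

/-- `H` satisfies the `Π`-property in `G`: for every chief factor `L / K` of `G`, every prime
dividing `|G/K : N_{G/K}(HK/K ∩ L/K)|` divides `|HK/K ∩ L/K|`. -/
def PiProperty (H : Subgroup G) : Prop :=
  ∀ (K L : Subgroup G) [K.Normal], IsChiefFactor K L →
    ∀ q : ℕ, q.Prime →
      q ∣ (Subgroup.normalizer ((quot K H ⊓ quot K L : Subgroup (G ⧸ K)) : Set (G ⧸ K))).index →
      q ∣ Nat.card (quot K H ⊓ quot K L : Subgroup (G ⧸ K))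

/-- `H` satisfies the `IC`-`Π`-property in `G`: `H ∩ [H, G]` satisfies the `Π`-property. -/
def ICPiProperty (H : Subgroup G) : Prop :=
  PiProperty (H ⊓ ⁅H, (⊤ : Subgroup G)⁆)

/-- All chief factors `L / K` of `G` below `H` (that is, `L ≤ H`) of order divisible by `p` are
cyclic. -/
def PChiefFactorsCyclicBelow (p : ℕ) (H : Subgroup G) : Prop :=
  ∀ (K L : Subgroup G) [K.Normal], IsChiefFactor K L → L ≤ H →
    p ∣ Nat.card (quot K L) → IsCyclic (quot K L)

/-- The `p𝔘`-hypercenter `Z_{p𝔘}(G)`: the product of all normal subgroups `H` of `G` such that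
all chief factors of `G` below `H` of order divisible by `p` are cyclic. -/
def pUHypercenter (p : ℕ) (G : Type*) [Group G] : Subgroup G :=
  sSup {H : Subgroup G | H.Normal ∧ PChiefFactorsCyclicBelow p H}

/-- Conjugation by `x` induces on the section `L / K` an inner automorphism of `L / K`. -/
def InducesInner (K L : Subgroup G) [K.Normal] (x : G) : Prop :=
  ∃ l ∈ quot K L, ∀ h ∈ quot K L, (x : G ⧸ K) * h * (x : G ⧸ K)⁻¹ = l * h * l⁻¹

/-- The generalized `p`-Fitting subgroup `F*_p(G)`: the set of all elements of `G` that induce an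
inner automorphism on every chief factor of `G` of order divisible by `p`. -/
def generalizedPFitting (p : ℕ) (G : Type*) [Group G] : Subgroup G where
  carrier := {x | ∀ (K L : Subgroup G) [K.Normal], IsChiefFactor K L →
    p ∣ Nat.card (quot K L) → InducesInner K L x}
  one_mem' := by
    intro K L _ _ _
    exact ⟨1, one_mem _, fun h _ => by simp⟩
  mul_mem' := by
    intro a b ha hb K L _ hc hp
    obtain ⟨l, hl, hla⟩ := ha K L hc hp
    obtain ⟨m, hm, hmb⟩ := hb K L hc hp
    refine ⟨l * m, mul_mem hl hm, fun h hh => ?_⟩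
    have h1 := hla (m * h * m⁻¹) (mul_mem (mul_mem hm hh) (inv_mem hm))
    rw [← hmb h hh] at h1
    rw [QuotientGroup.mk_mul]
    calc _ = (a : G ⧸ K) * (b * h * (b : G ⧸ K)⁻¹) * (a : G ⧸ K)⁻¹ := by group
      _ = _ := h1
      _ = _ := by rw [hmb h hh]; group
  inv_mem' := by
    intro a ha K L _ hc hp
    obtain ⟨l, hl, hla⟩ := ha K L hc hp
    refine ⟨l⁻¹, inv_mem hl, fun h hh => ?_⟩
    have h1 := hla (l⁻¹ * h * l) (mul_mem (mul_mem (inv_mem hl) hh) hl)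
    have h2 : (a : G ⧸ K) * (l⁻¹ * h * l) * (a : G ⧸ K)⁻¹ = h := by rw [h1]; group
    rw [QuotientGroup.mk_inv]
    calc _ = (a : G ⧸ K)⁻¹ * ((a : G ⧸ K) * (l⁻¹ * h * l) * (a : G ⧸ K)⁻¹) * a := by
          rw [h2]; group
      _ = _ := by group

end ICPi

/-! Traces on chief factors. If a `p`-subgroup `H` has the `Π`-property, the normaliser of its trace
on a chief factor `L / K` has `p`-power index. Hence a trace invariant under a Sylow `p`-subgroup of
`G` is normal, so it is trivial or all of `L / K`, and the trace on a factor that is not a `p`-group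
is always trivial. The `IC`-`Π`-property gives the same for `H` wherever `[H, G]` covers `L / K`;
this is automatic when `L / K` is noncyclic, `K ≤ H`, and `H ∩ L` is not contained in `K`.

Cyclicity as a centraliser condition. Let `R = primeResidual p G`, generated by the `p'`-elements of
`G'G^(p-1)`. Coprime action and a common-eigenvector argument show that a normal `p`-section has
only cyclic chief factors exactly when `R` centralises the whole section.

Normal `p`-subgroups (`OrderHypothesis.cyclicBetween`). Induct on `|P|`, with `N` a maximal
`G`-invariant subgroup of `P`. If `|N| < d`, an invariant subgroup of order `d` above `N` gives a
contradiction. Once `N` is known to have cyclic factors and `|N| ≥ d`, `cyclicBetween_of_maximal`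
treats `P / N`: the subgroup `[P, R]` has exponent `p` (or `4`), so its elements lie in subgroups
with the `IC`-`Π`-property. If `|N| = d`, take a minimal normal `L ≤ N`. If `L = N` is noncyclic,
there is a class-two contradiction (`false_of_card_eq_minimal`). Otherwise pass to `G / L`; a
noncyclic `L` lies in the Frattini subgroup of `P`, so trivial action of `p'`-elements on `P / L`
lifts to `P`.

Arbitrary `X` (`OrderHypothesis.cyclicBetween_of_sylow`). Factor out normal `p'`-subgroups of `G`
inside `X` and let `V` be the largest normal `p`-subgroup of `G` in `X`. If `V` did not contain its
centraliser in `X`, there would be a perfect normal subgroup `M` not contained in `V` whose elements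
of order `p` (or `4`) in `P` are central in `M`, and a Frobenius-type criterion makes `M` a
`p'`-group. Also `|V| > d`, since otherwise a complemented noncyclic chief factor `V / W` supplies
subgroups of order `d` with forbidden traces. So the normal case applies to `V`; then `R ∩ X ≤ V`,
and the factors above `V` are cyclic too.

From `X` to `N` (`cyclicBetween_of_generalizedPFitting_le`). The subgroup `O_{p',p}(N)` lies in
`F*_p(N) ≤ X`. If it did not contain its centraliser modulo `O_{p'}(N)`, a minimal perfect subgroup
of that centraliser would lie in `F*_p(N) ≤ X`; by a transfer argument its normal closure in `G`
would be a `p'`-group, a contradiction. So the passage from `V` to `X` applies again. -/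

namespace ICPi

open Subgroup
open scoped commutatorElement

/-! ### Chief factors and the `Π`-property in terms of subgroups of `G` -/

section Basics

variable {G : Type*} [Group G]

/-- The section `L / K` is generated by the image of one element of `L`. -/
def CyclicSection (K L : Subgroup G) : Prop := ∃ x ∈ L, L ≤ zpowers x ⊔ K

/-- All chief factors of `G` between `K` and `L` of order divisible by `p` are cyclic. -/
def CyclicBetween (p : ℕ) (K L : Subgroup G) : Prop :=
  ∀ A B : Subgroup G, K ≤ A → IsChiefFactor A B → B ≤ L → p ∣ A.relIndex B → CyclicSection A B

/-- The `Π`-property, phrased with subgroups of `G` only. -/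
def PiSub (H : Subgroup G) : Prop :=
  ∀ K L : Subgroup G, IsChiefFactor K L → ∀ q : ℕ, q.Prime →
    q ∣ (normalizer (((H ⊔ K) ⊓ L : Subgroup G) : Set G)).index →
    q ∣ K.relIndex ((H ⊔ K) ⊓ L)

/-- Dedekind's modular law; normality of one factor turns the join into a set of products. -/
theorem sup_inf_of_le {A K C : Subgroup G} (hK : K.Normal) (h : A ≤ C) :
    (A ⊔ K) ⊓ C = A ⊔ (K ⊓ C) := by
  apply le_antisymm
  · rintro x ⟨hx, hxC⟩
    obtain ⟨a, ha, k, hk, rfl⟩ := mem_sup_of_normal_right.mp hx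
    refine mul_mem_sup ha ⟨hk, ?_⟩
    simpa using mul_mem (inv_mem (h ha)) hxC
  · exact sup_le (le_inf le_sup_left h) (inf_le_inf_right _ le_sup_right)

theorem sup_inf_of_le' {A K C : Subgroup G} (hK : A.Normal) (h : A ≤ C) :
    (A ⊔ K) ⊓ C = A ⊔ (K ⊓ C) := by
  apply le_antisymm
  · rintro x ⟨hx, hxC⟩
    obtain ⟨a, ha, k, hk, rfl⟩ := mem_sup_of_normal_left.mp hx
    refine mul_mem_sup ha ⟨hk, ?_⟩
    simpa using mul_mem (inv_mem (h ha)) hxC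
  · exact sup_le (le_inf le_sup_left h) (inf_le_inf_right _ le_sup_right)

theorem card_quot (K L : Subgroup G) [K.Normal] : Nat.card (quot K L) = K.relIndex L := by
  have := relIndex_ker (K := L) (QuotientGroup.mk' K)
  rw [QuotientGroup.ker_mk'] at this
  exact this.symm

theorem comap_quot (K L : Subgroup G) [K.Normal] :
    (quot K L).comap (QuotientGroup.mk' K) = L ⊔ K := by
  rw [quot, comap_map_eq, QuotientGroup.ker_mk']

theorem isCyclic_quot_iff {K L : Subgroup G} [K.Normal] :
    IsCyclic (quot K L) ↔ CyclicSection K L := by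
  constructor
  · intro h
    obtain ⟨⟨g, hg⟩, hgen⟩ := h.exists_generator
    obtain ⟨x, hx, rfl⟩ := hg
    refine ⟨x, hx, fun y hy => ?_⟩
    obtain ⟨n, hn⟩ := hgen ⟨QuotientGroup.mk' K y, mem_map_of_mem _ hy⟩
    have h1 : QuotientGroup.mk' K (x ^ n) = QuotientGroup.mk' K y := by
      simpa using congrArg Subtype.val hn
    have h2 : (x ^ n)⁻¹ * y ∈ K := QuotientGroup.eq.mp h1
    have : y = x ^ n * ((x ^ n)⁻¹ * y) := by group
    rw [this]
    exact mul_mem_sup (zpow_mem (mem_zpowers x) n) h2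
  · rintro ⟨x, hx, h⟩
    refine ⟨⟨⟨QuotientGroup.mk' K x, mem_map_of_mem _ hx⟩, ?_⟩⟩
    rintro ⟨_, y, hy, rfl⟩
    obtain ⟨z, hz, k, hk, rfl⟩ := mem_sup_of_normal_right.mp (h hy)
    obtain ⟨n, rfl⟩ := mem_zpowers_iff.mp hz
    refine ⟨n, Subtype.ext ?_⟩
    simpa using hk

theorem pChiefFactorsCyclicBelow_iff {p : ℕ} {H : Subgroup G} :
    PChiefFactorsCyclicBelow p H ↔ CyclicBetween p ⊥ H := by
  constructor
  · intro h A B _ hc hB hp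
    have := hc.normal_bot
    exact isCyclic_quot_iff.mp (h A B hc hB (by rwa [card_quot]))
  · intro h A B _ hc hB hp
    exact isCyclic_quot_iff.mpr (h A B bot_le hc hB (by rwa [← card_quot]))

theorem quot_inf_quot {K L : Subgroup G} [K.Normal] (H : Subgroup G) (h : K ≤ L) :
    quot K H ⊓ quot K L = ((H ⊔ K) ⊓ L).map (QuotientGroup.mk' K) := by
  have h1 : ((quot K H ⊓ quot K L).comap (QuotientGroup.mk' K)) = (H ⊔ K) ⊓ L := by
    rw [comap_inf, comap_quot, comap_quot, sup_eq_left.mpr h]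
  rw [← h1, map_comap_eq_self_of_surjective (QuotientGroup.mk'_surjective K)]

theorem normalizer_index_comap {G' : Type*} [Group G'] {f : G →* G'}
    (hf : Function.Surjective f) (W : Subgroup G') :
    (normalizer ((W.comap f : Subgroup G) : Set G)).index = (normalizer (W : Set G')).index := by
  rw [← comap_normalizer_eq_of_surjective W hf, index_comap_of_surjective _ hf]

/-- The full preimage of `HK/K ∩ L/K` in `G` is `HK ∩ L`, and taking preimages preserves normaliser
indices. -/
theorem piProperty_iff {H : Subgroup G} : PiProperty H ↔ PiSub H := by
  have key : ∀ (K L : Subgroup G) [K.Normal], IsChiefFactor K L →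
      (normalizer ((quot K H ⊓ quot K L : Subgroup (G ⧸ K)) : Set (G ⧸ K))).index =
        (normalizer (((H ⊔ K) ⊓ L : Subgroup G) : Set G)).index ∧
      Nat.card (quot K H ⊓ quot K L : Subgroup (G ⧸ K)) = K.relIndex ((H ⊔ K) ⊓ L) := by
    intro K L _ hc
    constructor
    · rw [← normalizer_index_comap (QuotientGroup.mk'_surjective K), comap_inf, comap_quot,
        comap_quot, sup_eq_left.mpr hc.lt.le]
    · rw [quot_inf_quot H hc.lt.le]
      exact card_quot _ _
  constructor
  · intro h K L hc q hq hd
    have := hc.normal_bot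
    have := h K L hc q hq
    rw [(key K L hc).1, (key K L hc).2] at this
    exact this hd
  · intro h K L _ hc q hq hd
    rw [(key K L hc).1] at hd
    rw [(key K L hc).2]
    exact h K L hc q hq hd

theorem IsChiefFactor.comap {G' : Type*} [Group G'] {f : G →* G'} (hf : Function.Surjective f)
    {K L : Subgroup G'} (h : IsChiefFactor K L) : IsChiefFactor (K.comap f) (L.comap f) where
  normal_bot := h.normal_bot.comap f
  normal_top := h.normal_top.comap f
  lt := (comap_lt_comap_of_surjective hf).mpr h.lt
  eq_or_eq M hM h1 h2 := by
    have hker : f.ker ≤ M := (MonoidHom.ker_le_comap f K).trans h1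
    have hM' : (M.map f).comap f = M := comap_map_eq_self hker
    rcases h.eq_or_eq (M.map f) (hM.map f hf)
      (by rwa [← comap_le_comap_of_surjective hf, hM'])
      (map_le_iff_le_comap.mpr h2) with h3 | h3
    · left; rw [← h3, hM']
    · right; rw [← h3, hM']

theorem IsChiefFactor.map {G' : Type*} [Group G'] {f : G →* G'} (hf : Function.Surjective f)
    {K L : Subgroup G} (h : IsChiefFactor K L) (hker : f.ker ≤ K) :
    IsChiefFactor (K.map f) (L.map f) where
  normal_bot := h.normal_bot.map f hf
  normal_top := h.normal_top.map f hf
  lt := by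
    refine lt_of_le_of_ne (map_mono h.lt.le) fun he => h.lt.ne ?_
    rw [← comap_map_eq_self hker, he, comap_map_eq_self (hker.trans h.lt.le)]
  eq_or_eq M hM h1 h2 := by
    have h3 := h.eq_or_eq (M.comap f) (hM.comap f) (map_le_iff_le_comap.mp h1) (by
      rw [← comap_map_eq_self (hker.trans h.lt.le)]
      exact comap_mono h2)
    rcases h3 with h3 | h3
    · left; rw [← h3, map_comap_eq_self_of_surjective hf]
    · right; rw [← h3, map_comap_eq_self_of_surjective hf]

theorem PiSub.map {G' : Type*} [Group G'] {f : G →* G'} (hf : Function.Surjective f)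
    {H : Subgroup G} (h : PiSub H) : PiSub (H.map f) := by
  intro K L hc q hq hd
  have hK : f.ker ≤ K.comap f := MonoidHom.ker_le_comap f K
  have e : ((H.map f ⊔ K) ⊓ L).comap f = (H ⊔ K.comap f) ⊓ L.comap f := by
    rw [comap_inf, ← comap_sup_eq f _ _ hf, comap_map_eq, sup_assoc, sup_eq_right.mpr hK]
  have h1 := h _ _ (hc.comap hf) q hq
  rw [← e, normalizer_index_comap hf] at h1
  have h2 := h1 hd
  rwa [relIndex_comap, map_comap_eq_self_of_surjective hf] at h2

theorem IsChiefFactor.sup_chiefFactor {A B K : Subgroup G} (hc : IsChiefFactor A B)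
    (hK : K.Normal) (h : B ⊓ K ≤ A) : IsChiefFactor (A ⊔ K) (B ⊔ K) := by
  have := hc.normal_bot
  have := hc.normal_top
  have hAB := hc.lt.le
  have hinf : (A ⊔ K) ⊓ B = A := by
    rw [sup_inf_of_le hK hAB, inf_comm K B, sup_eq_left.mpr h]
  refine ⟨inferInstance, inferInstance, lt_of_le_of_ne (sup_le_sup_right hAB K) ?_, ?_⟩
  · intro he
    apply hc.lt.ne
    rw [← hinf, he]
    exact (inf_eq_right.mpr le_sup_left)
  · intro X hX h3 h4
    have hX' : X = (X ⊓ B) ⊔ K := by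
      have := sup_inf_of_le' (A := K) (K := B) (C := X) hK (le_sup_right.trans h3)
      rw [sup_comm, inf_eq_right.mpr h4] at this
      rw [sup_comm, inf_comm]; exact this
    rcases hc.eq_or_eq (X ⊓ B) inferInstance (le_inf (le_sup_left.trans h3) hAB)
      inf_le_right with h5 | h5
    · left; rw [hX', h5]
    · right; rw [hX', h5]

/-- A Jordan–Hölder argument: a chief factor `B / A` either survives modulo `K`, as `BK / AK`, or
satisfies `B = A(B ∩ K)` and is isomorphic to `(B ∩ K) / (A ∩ K)`. A generator is carried back in
both cases. -/
theorem cyclicBetween_trans {p : ℕ} {M K L : Subgroup G} (hK : K.Normal)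
    (hMK : M ≤ K) (h1 : CyclicBetween p M K) (h2 : CyclicBetween p K L) (hKL : K ≤ L) :
    CyclicBetween p M L := by
  intro A B hMA hc hBL hp
  have := hc.normal_bot
  have := hc.normal_top
  have hAB := hc.lt.le
  rcases hc.eq_or_eq (A ⊔ (B ⊓ K)) inferInstance le_sup_left (sup_le hAB inf_le_left) with h | h
  · have hBK : B ⊓ K ≤ A := by rw [← h]; exact le_sup_right
    have hinf : (A ⊔ K) ⊓ B = A := by
      rw [sup_inf_of_le hK hAB, inf_comm K B]; exact h
    have hsup : B ⊔ (A ⊔ K) = B ⊔ K := by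
      rw [← sup_assoc, sup_eq_left.mpr hAB]
    have hchief := hc.sup_chiefFactor hK hBK
    have hidx : (A ⊔ K).relIndex (B ⊔ K) = A.relIndex B := by
      rw [← hsup, relIndex_sup_right, ← inf_relIndex_right, hinf]
    obtain ⟨y, hy, hyB⟩ := h2 _ _ le_sup_right hchief (sup_le hBL hKL) (by rwa [hidx])
    obtain ⟨b, hb, k, hk, rfl⟩ := mem_sup_of_normal_right.mp hy
    refine ⟨b, hb, ?_⟩
    have hle : B ≤ (zpowers b ⊔ A) ⊔ K := by
      refine (le_sup_left.trans hyB).trans ?_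
      rw [← sup_assoc]
      refine sup_le (sup_le (zpowers_le.mpr ?_) ?_) le_sup_right
      · exact mul_mem (mem_sup_left (mem_sup_left (mem_zpowers b))) (mem_sup_right hk)
      · exact le_sup_right.trans le_sup_left
    have hzA : zpowers b ⊔ A ≤ B := sup_le (zpowers_le.mpr hb) hAB
    have := sup_inf_of_le hK hzA
    rw [inf_eq_right.mpr hle] at this
    rw [this]
    exact sup_le le_rfl ((inf_comm K B ▸ hBK).trans le_sup_right)
  · have hchief : IsChiefFactor (A ⊓ K) (B ⊓ K) := by
      refine ⟨inferInstance, inferInstance, lt_of_le_of_ne (inf_le_inf_right K hAB) ?_, ?_⟩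
      · intro he
        apply hc.lt.ne
        rw [← h, ← he]
        exact (sup_eq_left.mpr inf_le_left).symm
      · intro X hX h3 h4
        have hAX : (X ⊔ A) ⊓ (B ⊓ K) = X := by
          rw [sup_inf_of_le hc.normal_bot h4]
          refine sup_eq_left.mpr (le_trans ?_ h3)
          exact le_inf inf_le_left (inf_le_right.trans inf_le_right)
        rcases hc.eq_or_eq (X ⊔ A) inferInstance le_sup_right
          (sup_le (h4.trans inf_le_left) hAB) with h5 | h5
        · left
          rw [← hAX, h5]
          rw [← inf_assoc, inf_eq_left.mpr hAB]
        · right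
          rw [← hAX, h5, ← inf_assoc, inf_idem]
    have hidx : (A ⊓ K).relIndex (B ⊓ K) = A.relIndex B := by
      have h6 : A ⊓ K = A ⊓ (B ⊓ K) := by rw [← inf_assoc, inf_eq_left.mpr hAB]
      rw [h6, inf_relIndex_right]
      conv_rhs => rw [← h, relIndex_sup_left]
    obtain ⟨x, hx, hxB⟩ := h1 _ _ (le_inf hMA hMK) hchief inf_le_right (by rwa [hidx])
    refine ⟨x, hx.1, ?_⟩
    conv_lhs => rw [← h]
    exact sup_le le_sup_right (hxB.trans (sup_le_sup_left inf_le_left _))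

theorem cyclicBetween_of_map {G' : Type*} [Group G'] {f : G →* G'} (hf : Function.Surjective f)
    {p : ℕ} {L : Subgroup G} (h : CyclicBetween p ⊥ (L.map f)) : CyclicBetween p f.ker L := by
  intro A B hA hc hB hp
  obtain ⟨y, hy, hyB⟩ := h _ _ bot_le (hc.map hf hA) (map_mono hB) (by
    rw [relIndex_map_map, sup_eq_left.mpr hA]
    rwa [sup_eq_left.mpr (hA.trans hc.lt.le)])
  obtain ⟨x, hx, rfl⟩ := hy
  refine ⟨x, hx, ?_⟩
  have h1 := comap_mono (f := f) hyB
  rwa [← MonoidHom.map_zpowers, ← Subgroup.map_sup, comap_map_eq_self (hA.trans hc.lt.le),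
    comap_map_eq_self (hA.trans le_sup_right)] at h1

theorem cyclicBetween_mono {p : ℕ} {K K' L L' : Subgroup G} (h : CyclicBetween p K L)
    (hK : K ≤ K') (hL : L' ≤ L) : CyclicBetween p K' L' :=
  fun A B h1 h2 h3 h4 => h A B (hK.trans h1) h2 (h3.trans hL) h4

theorem cyclicBetween_of_not_dvd {p : ℕ} {K L : Subgroup G}
    (h : ¬ p ∣ K.relIndex L) : CyclicBetween p K L := by
  intro A B h1 h2 h3 h4
  refine absurd (h4.trans ((relIndex_dvd_of_le_left B h1).trans ?_)) h
  exact Dvd.intro _ (relIndex_mul_relIndex _ _ _ (h1.trans h2.lt.le) h3)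

end Basics

end ICPi

/-! ### Sections that are `p`-groups, and coprime action -/

namespace ICPi

open Subgroup
open scoped commutatorElement

section PSections

variable {G : Type*} [Group G]

/-- Every element of `L` has a `p`-power in `K`: the section `L / K` is a `p`-group. -/
def PSection (p : ℕ) (K L : Subgroup G) : Prop := ∀ x ∈ L, ∃ n : ℕ, x ^ p ^ n ∈ K

theorem mem_of_pow_mem_of_coprime {K : Subgroup G} {x : G} {a b : ℕ} (ha : x ^ a ∈ K)
    (hb : x ^ b ∈ K) (h : a.Coprime b) : x ∈ K := by
  have h1 := Nat.gcd_eq_gcd_ab a b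
  rw [Nat.Coprime.gcd_eq_one h] at h1
  have h2 : x = (x ^ a) ^ (a.gcdA b) * (x ^ b) ^ (a.gcdB b) := by
    rw [← zpow_natCast, ← zpow_natCast, ← zpow_mul, ← zpow_mul, ← zpow_add, ← h1]
    simp
  rw [h2]
  exact mul_mem (zpow_mem ha _) (zpow_mem hb _)

theorem pSection_of_isPGroup {p : ℕ} {K L : Subgroup G} (h : IsPGroup p L) : PSection p K L := by
  intro x hx
  obtain ⟨n, hn⟩ := h ⟨x, hx⟩
  refine ⟨n, ?_⟩
  have : x ^ p ^ n = 1 := by simpa using congrArg Subtype.val hn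
  rw [this]; exact one_mem K

theorem PSection.isPGroup_quot {p : ℕ} {K L : Subgroup G} [K.Normal] (h : PSection p K L) :
    IsPGroup p (quot K L) := by
  rintro ⟨_, x, hx, rfl⟩
  obtain ⟨n, hn⟩ := h x hx
  refine ⟨n, Subtype.ext ?_⟩
  have : (QuotientGroup.mk' K) (x ^ p ^ n) = 1 := (QuotientGroup.eq_one_iff _).mpr hn
  simpa using this

theorem PSection.exists_relIndex [Finite G] {p : ℕ} [Fact p.Prime] {K L : Subgroup G}
    (hK : K.Normal) (h : PSection p K L) : ∃ n, K.relIndex L = p ^ n := by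
  rw [← card_quot]
  exact IsPGroup.iff_card.mp h.isPGroup_quot

theorem PSection.mono {p : ℕ} {K L K' L' : Subgroup G} (h : PSection p K L) (hK : K ≤ K')
    (hL : L' ≤ L) : PSection p K' L' := fun x hx =>
  let ⟨n, hn⟩ := h x (hL hx)
  ⟨n, hK hn⟩

theorem PSection.dvd_relIndex [Finite G] {p : ℕ} [Fact p.Prime] {K L : Subgroup G}
    (hK : K.Normal) (h : PSection p K L) (hlt : K < L) : p ∣ K.relIndex L := by
  obtain ⟨n, hn⟩ := h.exists_relIndex hK
  rw [hn]
  refine dvd_pow_self p ?_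
  rintro rfl
  exact hlt.not_ge (relIndex_eq_one.mp (by simpa using hn))

theorem exists_chiefFactor_le [Finite G] {K P : Subgroup G} (hK : K.Normal) (hP : P.Normal)
    (h : K < P) : ∃ N, K ≤ N ∧ IsChiefFactor N P := by
  obtain ⟨N, hN⟩ := (Set.toFinite {N : Subgroup G | N.Normal ∧ K ≤ N ∧ N < P}).exists_maximal
    ⟨K, hK, le_rfl, h⟩
  refine ⟨N, hN.1.2.1, hN.1.1, hP, hN.1.2.2, fun M hM h1 h2 => ?_⟩
  by_cases hMP : M = P
  · exact Or.inr hMP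
  · exact Or.inl (le_antisymm
      (hN.2 ⟨hM, hN.1.2.1.trans h1, lt_of_le_of_ne h2 hMP⟩ h1) h1)

theorem exists_le_chiefFactor [Finite G] {K P : Subgroup G} (hK : K.Normal) (hP : P.Normal)
    (h : K < P) : ∃ N, N ≤ P ∧ IsChiefFactor K N := by
  obtain ⟨N, hN⟩ := (Set.toFinite {N : Subgroup G | N.Normal ∧ N ≤ P ∧ K < N}).exists_minimal
    ⟨P, hP, le_rfl, h⟩
  refine ⟨N, hN.1.2.1, hK, hN.1.1, hN.1.2.2, fun M hM h1 h2 => ?_⟩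
  by_cases hMP : K = M
  · exact Or.inl hMP.symm
  · exact Or.inr (le_antisymm h2
      (hN.2 ⟨hM, h2.trans hN.1.2.1, lt_of_le_of_ne h1 hMP⟩ h2))

/-- Otherwise `L / K` would be perfect, which a nontrivial finite `p`-group is not. -/
theorem IsChiefFactor.commutator_le [Finite G] {p : ℕ} [Fact p.Prime] {K L : Subgroup G}
    (hc : IsChiefFactor K L) (hp : PSection p K L) : ⁅L, L⁆ ≤ K := by
  have := hc.normal_bot
  have := hc.normal_top
  rcases hc.eq_or_eq (⁅L, L⁆ ⊔ K) inferInstance le_sup_right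
    (sup_le (commutator_le_self L) hc.lt.le) with h | h
  · rw [← h]; exact le_sup_left
  · exfalso
    have h1 : ⁅quot K L, quot K L⁆ = quot K L := by
      rw [quot, ← map_commutator]
      conv_rhs => rw [← h, Subgroup.map_sup]
      have : K.map (QuotientGroup.mk' K) = ⊥ := by
        rw [Subgroup.map_eq_bot_iff, QuotientGroup.ker_mk']
      rw [this, sup_bot_eq]
    have h2 : Group.IsPerfect (quot K L) := isPerfect_iff.mpr h1
    have h3 : Nontrivial (quot K L) := by
      rw [← Finite.one_lt_card_iff_nontrivial, card_quot]
      have := relIndex_eq_one.not.mpr hc.lt.not_ge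
      have h0 : K.relIndex L ≠ 0 := by
        rw [← card_quot]; exact Nat.card_pos.ne'
      lia
    exact Group.IsPerfect.not_isNilpotent _ hp.isPGroup_quot.isNilpotent

theorem comm_mod {K L : Subgroup G} [K.Normal] (h : ⁅L, L⁆ ≤ K) {x y : G} (hx : x ∈ L)
    (hy : y ∈ L) : Commute (x : G ⧸ K) (y : G ⧸ K) := by
  have h1 : ⁅x, y⁆ ∈ K := h (commutator_mem_commutator hx hy)
  have h2 : ((⁅x, y⁆ : G) : G ⧸ K) = 1 := (QuotientGroup.eq_one_iff _).mpr h1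
  rw [commutatorElement_def] at h2
  exact commutatorElement_eq_one_iff_commute.mp h2

/-- In an abelian chief factor the solutions of `x ^ n = 1` form a `G`-invariant subgroup, so one
nontrivial solution forces all. -/
theorem IsChiefFactor.pow_mem_of_exists {n : ℕ} {K L : Subgroup G}
    (hc : IsChiefFactor K L) (hcomm : ⁅L, L⁆ ≤ K) (hx : ∃ x ∈ L, x ∉ K ∧ x ^ n ∈ K) :
    ∀ x ∈ L, x ^ n ∈ K := by
  have := hc.normal_bot
  have := hc.normal_top
  have hmk : ∀ x : G, x ^ n ∈ K ↔ (x : G ⧸ K) ^ n = 1 := fun x => by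
    rw [← QuotientGroup.mk_pow, QuotientGroup.eq_one_iff]
  let D : Subgroup G :=
    { carrier := {x | x ∈ L ∧ x ^ n ∈ K}
      one_mem' := ⟨one_mem _, by simp [one_mem]⟩
      mul_mem' := by
        rintro a b ⟨ha, ha'⟩ ⟨hb, hb'⟩
        refine ⟨mul_mem ha hb, ?_⟩
        rw [hmk] at ha' hb' ⊢
        rw [QuotientGroup.mk_mul, (comm_mod hcomm ha hb).mul_pow, ha', hb', one_mul]
      inv_mem' := by
        rintro a ⟨ha, ha'⟩
        exact ⟨inv_mem ha, by rw [inv_pow]; exact inv_mem ha'⟩ }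
  have hD : D.Normal := ⟨fun x hx g => ⟨hc.normal_top.conj_mem x hx.1 g, by
    rw [conj_pow]; exact hc.normal_bot.conj_mem _ hx.2 g⟩⟩
  rcases hc.eq_or_eq D hD (fun x hx => ⟨hc.lt.le hx, pow_mem hx n⟩) (fun x hx => hx.1) with h | h
  · obtain ⟨x, hxL, hxK, hxn⟩ := hx
    exact absurd (h ▸ (⟨hxL, hxn⟩ : x ∈ D)) hxK
  · intro x hxL
    exact (h ▸ hxL : x ∈ D).2

theorem IsChiefFactor.pow_prime_mem [Finite G] {p : ℕ} [Fact p.Prime] {K L : Subgroup G}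
    (hc : IsChiefFactor K L) (hp : PSection p K L) : ∀ x ∈ L, x ^ p ∈ K := by
  apply hc.pow_mem_of_exists (hc.commutator_le hp)
  obtain ⟨x, hx, hxK⟩ := SetLike.exists_of_lt hc.lt
  classical
  have hn := Nat.find_spec (hp x hx)
  have hmin := fun m => Nat.find_min (hp x hx) (m := m)
  set n := Nat.find (hp x hx) with hndef
  have hn0 : n ≠ 0 := by
    intro h0
    rw [h0] at hn
    exact hxK (by simpa using hn)
  -- The last element outside `K` in the chain `x, x ^ p, x ^ p ^ 2, …`.
  refine ⟨x ^ p ^ (n - 1), pow_mem hx _, hmin (n - 1) (by lia), ?_⟩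
  rw [← pow_mul, ← pow_succ, Nat.sub_add_cancel (Nat.one_le_iff_ne_zero.mpr hn0)]
  exact hn

theorem CyclicSection.commutator_le {K L : Subgroup G} (hK : K.Normal) (h : CyclicSection K L) :
    ⁅L, L⁆ ≤ K := by
  have hcyc := isCyclic_quot_iff.mpr h
  rw [Subgroup.commutator_le]
  intro x hx y hy
  have hcm : Commute (⟨_, mem_map_of_mem (QuotientGroup.mk' K) hx⟩ : quot K L)
      ⟨_, mem_map_of_mem (QuotientGroup.mk' K) hy⟩ := mul_comm' _ _
  have h2 := commutatorElement_eq_one_iff_commute.mpr (congrArg Subtype.val hcm : _ = _)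
  exact (QuotientGroup.eq_one_iff (N := K) ⁅x, y⁆).mp h2

theorem exists_mem_pow_mem_of_dvd_relIndex [Finite G] {p : ℕ} [hp : Fact p.Prime]
    {K L : Subgroup G} (hK : K.Normal) (h : p ∣ K.relIndex L) : ∃ x ∈ L, x ∉ K ∧ x ^ p ∈ K := by
  rw [← card_quot] at h
  obtain ⟨⟨_, x, hx, rfl⟩, hy⟩ := exists_prime_orderOf_dvd_card' p h
  refine ⟨x, hx, fun hxK => ?_, ?_⟩
  · have h1 : QuotientGroup.mk' K x = 1 := (QuotientGroup.eq_one_iff x).mpr hxK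
    rw [← orderOf_coe] at hy
    simp only [h1, orderOf_one] at hy
    exact hp.out.one_lt.ne hy
  · have h1 := congrArg Subtype.val (pow_orderOf_eq_one
      (⟨_, mem_map_of_mem (QuotientGroup.mk' K) hx⟩ : quot K L))
    rw [hy] at h1
    exact (QuotientGroup.eq_one_iff (N := K) (x ^ p)).mp (by simpa using h1)

theorem IsChiefFactor.pSection_of_cyclic [Finite G] {p : ℕ} [hp : Fact p.Prime]
    {K L : Subgroup G} (hc : IsChiefFactor K L) (h : CyclicSection K L)
    (hd : p ∣ K.relIndex L) : PSection p K L := fun x hx => ⟨1, by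
  have hK := hc.normal_bot
  simpa using hc.pow_mem_of_exists (n := p) (h.commutator_le hK)
    (exists_mem_pow_mem_of_dvd_relIndex hK hd) x hx⟩

theorem IsChiefFactor.relIndex_of_cyclic [Finite G] {p : ℕ} [hp : Fact p.Prime]
    {K L : Subgroup G} (hc : IsChiefFactor K L) (h : CyclicSection K L)
    (hd : p ∣ K.relIndex L) : K.relIndex L = p := by
  have := hc.normal_bot
  have hps := hc.pSection_of_cyclic h hd
  have hpow := hc.pow_prime_mem hps
  have hcyc := isCyclic_quot_iff.mpr h
  obtain ⟨g, hg⟩ := hcyc.exists_generator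
  have h1 : Nat.card (quot K L) ∣ p := by
    rw [← orderOf_eq_card_of_forall_mem_zpowers hg]
    apply orderOf_dvd_of_pow_eq_one
    obtain ⟨_, x, hx, rfl⟩ := g
    refine Subtype.ext ?_
    have : (QuotientGroup.mk' K) (x ^ p) = 1 := (QuotientGroup.eq_one_iff _).mpr (hpow x hx)
    simpa using this
  rw [card_quot] at h1
  exact Nat.dvd_antisymm h1 hd

theorem cyclicSection_of_relIndex_prime {p : ℕ} [Fact p.Prime] {K L : Subgroup G}
    (hK : K.Normal) (h : K.relIndex L = p) : CyclicSection K L :=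
  isCyclic_quot_iff.mp (isCyclic_of_prime_card (p := p) (by rw [card_quot, h]))

/-- If `a` has order `n` prime to `p` modulo `K` and centralises `[x, a]` modulo `K`, and `[x, a]`
has a `p`-power in `K`, then `[x, a] ∈ K`. -/
theorem commutator_mem_of_coprime {p n m : ℕ} {K : Subgroup G} (hK : K.Normal) {x a : G}
    (ha : a ^ n ∈ K) (hn : n.Coprime p) (hc : ⁅⁅x, a⁆, a⁆ ∈ K) (hx : ⁅x, a⁆ ^ p ^ m ∈ K) :
    ⁅x, a⁆ ∈ K := by
  refine mem_of_pow_mem_of_coprime (a := n) ?_ hx (hn.pow_right m)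
  rw [← QuotientGroup.eq_one_iff] at ha hc ⊢
  have hcomm : Commute ((⁅x, a⁆ : G) : G ⧸ K) (a : G ⧸ K) :=
    commutatorElement_eq_one_iff_commute.mp hc
  -- Modulo `K` the conjugate of `a` by `x` is `[x, a] a` with commuting factors; comparing `n`-th
  -- powers gives `[x, a] ^ n ∈ K`.
  have h1 : ((x * a * x⁻¹ : G) : G ⧸ K) = ((⁅x, a⁆ : G) : G ⧸ K) * (a : G ⧸ K) := by
    rw [← QuotientGroup.mk_mul, commutatorElement_def]
    congr 1; group
  have h2 := congrArg (· ^ n) h1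
  simp only [hcomm.mul_pow] at h2
  rw [← QuotientGroup.mk_pow, conj_pow, ← QuotientGroup.mk_pow, ← QuotientGroup.mk_pow, ha, mul_one,
    QuotientGroup.mk_mul, QuotientGroup.mk_mul, ha, mul_one, ← QuotientGroup.mk_mul,
    mul_inv_cancel] at h2
  exact h2.symm

end PSections

end ICPi

/-! ### Cyclic chief factors as those centralised by `primeResidual` -/

namespace ICPi

open Subgroup
open scoped commutatorElement

section AbelianResidual

variable {G : Type*} [Group G]

/-- The subgroup generated by all commutators and all `(p - 1)`-th powers. -/
def expResidual (p : ℕ) (G : Type*) [Group G] : Subgroup G :=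
  commutator G ⊔ closure (Set.range fun g : G => g ^ (p - 1))

/-- The subgroup generated by the `p'`-elements of `expResidual p G`. -/
def primeResidual (p : ℕ) (G : Type*) [Group G] : Subgroup G :=
  closure {a | a ∈ expResidual p G ∧ (orderOf a).Coprime p}

instance expResidual_normal (p : ℕ) : (expResidual p G).Normal :=
  Normal.of_commutator_le G le_sup_left

instance primeResidual_normal (p : ℕ) : (primeResidual p G).Normal := by
  refine ⟨fun x hx g => ?_⟩
  have h1 : (primeResidual p G).map (MulAut.conj g).toMonoidHom ≤ primeResidual p G := by
    rw [primeResidual, MonoidHom.map_closure]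
    refine closure_mono ?_
    rintro _ ⟨a, ⟨ha, ha'⟩, rfl⟩
    refine ⟨(expResidual_normal p).conj_mem a ha g, ?_⟩
    rw [orderOf_injective (MulAut.conj g).toMonoidHom (MulAut.conj g).injective]
    exact ha'
  exact h1 ⟨x, hx, rfl⟩

theorem expResidual_le_ker {p : ℕ} {M : Type*} [Group M] (f : G →* M)
    (hc : ∀ g h, f g * f h = f h * f g) (hp : ∀ g, f g ^ (p - 1) = 1) :
    expResidual p G ≤ f.ker := by
  rw [expResidual, sup_le_iff, closure_le, commutator_def, Subgroup.commutator_le]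
  constructor
  · intro g _ h _
    rw [MonoidHom.mem_ker, map_commutatorElement, commutatorElement_eq_one_iff_mul_comm]
    exact hc g h
  · rintro _ ⟨g, rfl⟩
    exact MonoidHom.mem_ker.mpr (by rw [map_pow]; exact hp g)

/-- The action of `G` by conjugation on the section `L / K`. -/
noncomputable def sectionAction (K L : Subgroup G) [K.Normal] [L.Normal] : G →* MulAut (quot K L) :=
  haveI : (quot K L).Normal := Normal.map inferInstance _ (QuotientGroup.mk'_surjective K)
  MulAut.conjNormal.comp (QuotientGroup.mk' K)

theorem sectionAction_coe {K L : Subgroup G} [K.Normal] [L.Normal] (g : G) (x : quot K L) :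
    (sectionAction K L g x : G ⧸ K) = (g : G ⧸ K) * x * (g : G ⧸ K)⁻¹ := by
  have : (quot K L).Normal := Normal.map inferInstance _ (QuotientGroup.mk'_surjective K)
  exact MulAut.conjNormal_apply _ _

theorem sectionAction_eq_one {K L : Subgroup G} [K.Normal] [L.Normal] {g : G} :
    sectionAction K L g = 1 ↔ ∀ x ∈ L, ⁅x, g⁆ ∈ K := by
  have key : ∀ x : G, ((g : G ⧸ K) * x * (g : G ⧸ K)⁻¹ = x) ↔ ⁅x, g⁆ ∈ K := by
    intro x
    have h1 : ⁅x, g⁆ ∈ K ↔ ((⁅x, g⁆ : G) : G ⧸ K) = 1 := (QuotientGroup.eq_one_iff _).symm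
    have h2 : ((⁅x, g⁆ : G) : G ⧸ K) = ⁅(x : G ⧸ K), (g : G ⧸ K)⁆ := rfl
    rw [h1, h2, commutatorElement_eq_one_iff_mul_comm, mul_inv_eq_iff_eq_mul, eq_comm]
  constructor
  · intro h x hx
    rw [← key]
    have := sectionAction_coe g (⟨_, mem_map_of_mem (QuotientGroup.mk' K) hx⟩ : quot K L)
    rw [h] at this
    exact this.symm
  · intro h
    ext ⟨_, x, hx, rfl⟩
    rw [sectionAction_coe]
    exact (key x).mpr (h x hx)

theorem mulAut_comm_of_isCyclic {C : Type*} [Group C] [IsCyclic C] (f g : MulAut C) :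
    f * g = g * f :=
  (IsCyclic.mulAutMulEquiv C).injective (by rw [map_mul, map_mul, mul_comm])

/-- The automorphism group of a cyclic group is abelian, so `G'` acts trivially. -/
theorem commutator_mem_of_cyclicSection {K L : Subgroup G} (hK : K.Normal) (hL : L.Normal)
    (h : CyclicSection K L) {a : G} (ha : a ∈ commutator G) {x : G} (hx : x ∈ L) : ⁅x, a⁆ ∈ K := by
  have := isCyclic_quot_iff.mpr h
  refine sectionAction_eq_one.mp ?_ x hx
  have h1 : commutator G ≤ (sectionAction K L).ker := by
    rw [commutator_def, Subgroup.commutator_le]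
    intro g _ h _
    rw [MonoidHom.mem_ker, map_commutatorElement, commutatorElement_eq_one_iff_mul_comm]
    exact mulAut_comm_of_isCyclic _ _
  exact h1 ha

/-- Such a factor has order `p`, and its automorphism group is abelian of order `p - 1`. -/
theorem IsChiefFactor.expResidual_acts [Finite G] {p : ℕ} [hp : Fact p.Prime] {K L : Subgroup G}
    (hc : IsChiefFactor K L) (h : CyclicSection K L) (hd : p ∣ K.relIndex L) {a : G}
    (ha : a ∈ expResidual p G) {x : G} (hx : x ∈ L) : ⁅x, a⁆ ∈ K := by
  have := hc.normal_bot
  have := hc.normal_top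
  have hcyc := isCyclic_quot_iff.mpr h
  refine sectionAction_eq_one.mp ?_ x hx
  refine expResidual_le_ker (sectionAction K L) (fun g h => mulAut_comm_of_isCyclic _ _)
    (fun g => ?_) ha
  have h2 : Nat.card (MulAut (quot K L)) = p - 1 := by
    rw [IsCyclic.card_mulAut, card_quot, hc.relIndex_of_cyclic h hd, Nat.totient_prime hp.out]
  rw [← h2]
  exact pow_card_eq_one'

/-- `p'`-elements of `expResidual p G` centralise `p`-sections all of whose chief factors are
cyclic. -/
theorem commutator_mem_of_cyclicBetween [Finite G] {p : ℕ} [hp : Fact p.Prime] {K : Subgroup G}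
    (hK : K.Normal) {a : G} (ha : a ∈ expResidual p G) (hap : (orderOf a).Coprime p) :
    ∀ P : Subgroup G, P.Normal → K ≤ P → PSection p K P → CyclicBetween p K P →
      ∀ x ∈ P, ⁅x, a⁆ ∈ K := by
  intro P
  induction P using WellFoundedLT.induction with
  | ind P ih =>
    intro hP hKP hps hcyc x hx
    rcases eq_or_lt_of_le hKP with rfl | hlt
    · exact commutator_le_left K ⊤ (commutator_mem_commutator hx (mem_top a))
    obtain ⟨N, hKN, hc⟩ := exists_chiefFactor_le hK hP hlt
    have h1 := ih N hc.lt hc.normal_bot hKN (hps.mono le_rfl hc.lt.le)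
      (cyclicBetween_mono hcyc le_rfl hc.lt.le)
    have hd : p ∣ N.relIndex P := (hps.mono hKN le_rfl).dvd_relIndex hc.normal_bot hc.lt
    have h2 : ⁅x, a⁆ ∈ N :=
      hc.expResidual_acts (hcyc N P hKN hc le_rfl hd) hd ha hx
    obtain ⟨m, hm⟩ := hps _ (hc.lt.le h2)
    -- The element `a` centralises `P / N` and, by induction, `N / K`; since its order is prime to
    -- `p`, it centralises `P / K`.
    exact commutator_mem_of_coprime hK (n := orderOf a)
      (by rw [pow_orderOf_eq_one]; exact one_mem K) hap (h1 _ h2) hm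

theorem commutator_primeResidual_le {p : ℕ} {K P : Subgroup G}
    (hK : K.Normal)
    (h : ∀ a ∈ expResidual p G, (orderOf a).Coprime p → ∀ x ∈ P, ⁅x, a⁆ ∈ K) :
    ⁅P, primeResidual p G⁆ ≤ K := by
  have h1 : primeResidual p G ≤
      (centralizer ((P.map (QuotientGroup.mk' K) : Subgroup (G ⧸ K)) : Set (G ⧸ K))).comap
        (QuotientGroup.mk' K) := by
    rw [primeResidual, closure_le]
    rintro a ⟨ha, hap⟩
    rw [SetLike.mem_coe, mem_comap, mem_centralizer_iff]
    rintro _ ⟨x, hx, rfl⟩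
    have := h a ha hap x hx
    rw [← QuotientGroup.eq_one_iff] at this
    exact commutatorElement_eq_one_iff_mul_comm.mp this
  rw [Subgroup.commutator_le]
  intro x hx a ha
  have h2 := mem_centralizer_iff.mp (h1 ha) _ (mem_map_of_mem _ hx)
  rw [← QuotientGroup.eq_one_iff]
  exact commutatorElement_eq_one_iff_mul_comm.mpr h2

theorem CyclicBetween.commutator_primeResidual_le [Finite G] {p : ℕ} [hp : Fact p.Prime]
    {K P : Subgroup G} (hK : K.Normal) (hP : P.Normal) (hKP : K ≤ P) (hps : PSection p K P)
    (h : CyclicBetween p K P) : ⁅P, primeResidual p G⁆ ≤ K :=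
  ICPi.commutator_primeResidual_le hK fun _ ha hap =>
    commutator_mem_of_cyclicBetween hK ha hap P hP hKP hps h

/-- The minimal polynomial of `S` divides `X ^ p - X`, which splits over the prime field. -/
theorem exists_eigenvector_of_pow_eq {p : ℕ} [hp : Fact p.Prime] {M : Type*} [AddCommGroup M]
    [Module (ZMod p) M] [Finite M] [Nontrivial M] (S : Module.End (ZMod p) M) (hS : S ^ p = S) :
    ∃ v : M, v ≠ 0 ∧ ∃ i : ℕ, S v = i • v := by
  have hpoly : Polynomial.aeval S (Polynomial.X ^ p - Polynomial.X : Polynomial (ZMod p)) = 0 := by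
    simp [hS]
  have hne : (Polynomial.X ^ p - Polynomial.X : Polynomial (ZMod p)) ≠ 0 :=
    FiniteField.X_pow_card_sub_X_ne_zero _ hp.out.one_lt
  have hsplit : (Polynomial.X ^ p - Polynomial.X : Polynomial (ZMod p)).Splits := by
    have := FiniteField.splits_X_pow_card_sub_X p (K := ZMod p)
    simpa [ZMod.card] using this
  have hdeg : (minpoly (ZMod p) S).degree ≠ 0 :=
    (minpoly.degree_pos (Algebra.IsIntegral.isIntegral S)).ne'
  obtain ⟨μ, hμ⟩ := (hsplit.of_dvd hne (minpoly.dvd (ZMod p) S hpoly)).exists_eval_eq_zero hdeg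
  obtain ⟨v, hv⟩ := (Module.End.hasEigenvalue_of_isRoot hμ).exists_hasEigenvector
  refine ⟨v, hv.2, μ.val, ?_⟩
  rw [hv.apply_eq_smul]
  conv_lhs => rw [← ZMod.natCast_zmod_val μ]
  exact Nat.cast_smul_eq_nsmul (ZMod p) _ v

theorem exists_apply_eq_pow_of_commGroup {p : ℕ} [hp : Fact p.Prime] {V : Type*} [CommGroup V]
    [Module (ZMod p) (Additive V)] [Finite V] [Nontrivial V]
    (T : MulAut V) (hT : T ^ (p - 1) = 1) : ∃ v : V, v ≠ 1 ∧ ∃ i : ℕ, T v = v ^ i := by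
  let S : Module.End (ZMod p) (Additive V) :=
    AddMonoidHom.toZModLinearMap p (MonoidHom.toAdditive (T : V →* V))
  have hSn : ∀ (n : ℕ) (v : Additive V), (S ^ n) v = Additive.ofMul ((T ^ n) v.toMul) := by
    intro n
    induction n with
    | zero => intro v; rfl
    | succ n ih =>
      intro v
      rw [pow_succ, Module.End.mul_apply, ih, pow_succ]
      rfl
  obtain ⟨v, hv, i, hi⟩ := exists_eigenvector_of_pow_eq S (LinearMap.ext fun v => by
    have h1 : T ^ p = T := by
      conv_lhs => rw [← Nat.sub_add_cancel hp.out.one_le, pow_succ, hT, one_mul]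
    rw [hSn, h1]
    rfl)
  exact ⟨v.toMul, hv, i, hi⟩

theorem exists_apply_eq_pow {p : ℕ} [hp : Fact p.Prime] {V : Type*} [inst : Group V] [Finite V]
    [Nontrivial V] (hcomm : ∀ x y : V, x * y = y * x) (hexp : ∀ x : V, x ^ p = 1)
    (T : MulAut V) (hT : T ^ (p - 1) = 1) : ∃ v : V, v ≠ 1 ∧ ∃ i : ℕ, T v = v ^ i :=
  letI inst' : CommGroup V := { inst with mul_comm := hcomm }
  @exists_apply_eq_pow_of_commGroup p _ V inst'
    (AddCommGroup.zmodModule fun x => hexp x.toMul) _ _ T hT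

/-- A `p`-chief factor centralised by `primeResidual p G` is cyclic. -/
theorem IsChiefFactor.cyclicSection_of_commutator_le [Finite G] {p : ℕ} [hp : Fact p.Prime]
    {K L : Subgroup G} (hc : IsChiefFactor K L) (hps : PSection p K L)
    (h : ⁅L, primeResidual p G⁆ ≤ K) : CyclicSection K L := by
  have := hc.normal_bot
  have := hc.normal_top
  have hLc := hc.commutator_le hps
  have hLp := hc.pow_prime_mem hps
  set f := sectionAction K L with hf
  -- Raising `r` to the `p`-part of its order yields a `p'`-element of the residual, which acts
  -- trivially; so `expResidual p G` acts on `L / K` as a `p`-group.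
  have hpgrp : IsPGroup p ((expResidual p G).map f) := by
    rintro ⟨_, r, hr, rfl⟩
    obtain ⟨n, m, hm, hnm⟩ :=
      Nat.exists_eq_pow_mul_and_not_dvd (isOfFinOrder_of_finite r).orderOf_pos.ne' p hp.out.ne_one
    refine ⟨n, Subtype.ext ?_⟩
    have h1 : r ^ p ^ n ∈ primeResidual p G := by
      refine subset_closure ⟨pow_mem hr _, ?_⟩
      have h2 : orderOf (r ^ p ^ n) ∣ m :=
        orderOf_dvd_of_pow_eq_one (by rw [← pow_mul, ← hnm, pow_orderOf_eq_one])
      exact Nat.Coprime.coprime_dvd_left h2 ((hp.out.coprime_iff_not_dvd.mpr hm).symm)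
    have h2 : f (r ^ p ^ n) = 1 :=
      sectionAction_eq_one.mpr fun x hx => h (commutator_mem_commutator hx h1)
    simpa using h2
  have hnt : ∃ x ∈ L, x ∉ K := SetLike.exists_of_lt hc.lt
  -- the fixed points of `expResidual p G`
  let F : Subgroup G :=
    { carrier := {x | x ∈ L ∧ ∀ r ∈ expResidual p G, (r : G ⧸ K) * x * (r : G ⧸ K)⁻¹ = x}
      one_mem' := ⟨one_mem _, fun r _ => by simp⟩
      mul_mem' := by
        rintro a b ⟨ha, ha'⟩ ⟨hb, hb'⟩
        refine ⟨mul_mem ha hb, fun r hr => ?_⟩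
        rw [QuotientGroup.mk_mul]
        conv_rhs => rw [← ha' r hr, ← hb' r hr]
        group
      inv_mem' := by
        rintro a ⟨ha, ha'⟩
        refine ⟨inv_mem ha, fun r hr => ?_⟩
        rw [QuotientGroup.mk_inv]
        conv_rhs => rw [← ha' r hr]
        group }
  have hFn : F.Normal := by
    refine ⟨fun x hx g => ⟨hc.normal_top.conj_mem x hx.1 g, fun r hr => ?_⟩⟩
    have h1 : ((g : G ⧸ K)⁻¹ * r * g) * x * ((g : G ⧸ K)⁻¹ * r * g)⁻¹ = (x : G ⧸ K) :=
      hx.2 (g⁻¹ * r * g) (by simpa using (expResidual_normal (G := G) p).conj_mem r hr g⁻¹)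
    change (r : G ⧸ K) * ((g : G ⧸ K) * x * (g : G ⧸ K)⁻¹) * (r : G ⧸ K)⁻¹ =
      (g : G ⧸ K) * x * (g : G ⧸ K)⁻¹
    calc _ = (g : G ⧸ K) * (((g : G ⧸ K)⁻¹ * r * g) * x * ((g : G ⧸ K)⁻¹ * r * g)⁻¹) *
          (g : G ⧸ K)⁻¹ := by group
      _ = _ := by rw [h1]
  have hKF : K ≤ F := fun x hx => ⟨hc.lt.le hx, fun r _ => by
    rw [(QuotientGroup.eq_one_iff x).mpr hx]; group⟩
  -- A `p`-group fixing the identity of a group of order divisible by `p` fixes another point. Thus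
  -- the invariant subgroup `F` is larger than `K`.
  have hFL : F = L := by
    refine (hc.eq_or_eq F hFn hKF fun x hx => hx.1).resolve_left fun hFK => ?_
    have hcard : p ∣ Nat.card (quot K L) := by
      rw [card_quot]; exact hps.dvd_relIndex hc.normal_bot hc.lt
    obtain ⟨b, hb, hb1⟩ := hpgrp.exists_fixed_point_of_prime_dvd_card_of_fixed_point
      (quot K L) hcard (a := 1) (fun r => map_one (r : MulAut (quot K L)))
    obtain ⟨_, x, hx, rfl⟩ := b
    have hxF : x ∈ F := by
      refine ⟨hx, fun r hr => ?_⟩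
      have h1 := hb ⟨f r, mem_map_of_mem f hr⟩
      have h2 := congrArg Subtype.val h1
      have h3 := sectionAction_coe (K := K) (L := L) r ⟨_, mem_map_of_mem (QuotientGroup.mk' K) hx⟩
      exact h3.symm.trans h2
    rw [hFK] at hxF
    apply hb1
    refine Subtype.ext ?_
    exact ((QuotientGroup.eq_one_iff x).mpr hxF).symm
  have hRker : ∀ r ∈ expResidual p G, f r = 1 := by
    intro r hr
    ext ⟨_, x, hx, rfl⟩
    rw [sectionAction_coe]
    exact (hFL ▸ hx : x ∈ F).2 r hr
  have hcommf : ∀ g h, f g * f h = f h * f g := by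
    intro g h
    rw [← commutatorElement_eq_one_iff_mul_comm, ← map_commutatorElement]
    exact hRker _ (mem_sup_left (commutator_mem_commutator (mem_top g) (mem_top h)))
  have hpowf : ∀ g, f g ^ (p - 1) = 1 := by
    intro g
    rw [← map_pow]
    exact hRker _ (mem_sup_right (subset_closure ⟨g, rfl⟩))
  have hVcomm : ∀ x y : quot K L, x * y = y * x := by
    rintro ⟨_, x, hx, rfl⟩ ⟨_, y, hy, rfl⟩
    exact Subtype.ext (comm_mod hLc hx hy)
  have hVexp : ∀ x : quot K L, x ^ p = 1 := by
    rintro ⟨_, x, hx, rfl⟩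
    refine Subtype.ext ?_
    have : (QuotientGroup.mk' K) (x ^ p) = 1 := (QuotientGroup.eq_one_iff _).mpr (hLp x hx)
    simpa using this
  have hVnt : Nontrivial (quot K L) := by
    obtain ⟨x, hx, hxK⟩ := hnt
    refine ⟨⟨_, mem_map_of_mem (QuotientGroup.mk' K) hx⟩, 1, fun h => hxK ?_⟩
    exact (QuotientGroup.eq_one_iff x).mp (congrArg Subtype.val h)
  -- The action is now commutative of exponent dividing `p - 1`. So `g` has an eigenvector, its
  -- eigenspace is `G`-invariant, and by irreducibility `g` acts as a power map.
  have hscalar : ∀ g : G, ∃ i : ℕ, ∀ v : quot K L, f g v = v ^ i := by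
    intro g
    obtain ⟨v, hv, i, hi⟩ := exists_apply_eq_pow hVcomm hVexp (f g) (hpowf g)
    refine ⟨i, ?_⟩
    let D : Subgroup (quot K L) :=
      { carrier := {w | f g w = w ^ i}
        one_mem' := by simp
        mul_mem' := fun {a b} ha hb => by
          have hab : Commute a b := hVcomm a b
          change f g (a * b) = (a * b) ^ i
          rw [map_mul, hab.mul_pow]
          exact congrArg₂ (· * ·) ha hb
        inv_mem' := fun {a} ha => by
          change f g a⁻¹ = a⁻¹ ^ i
          rw [map_inv, inv_pow]
          exact congrArg _ ha }
    let E : Subgroup G := (D.map (quot K L).subtype).comap (QuotientGroup.mk' K)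
    have hmemE : ∀ x : G, x ∈ E ↔ ∃ w : quot K L, f g w = w ^ i ∧ (w : G ⧸ K) = (x : G ⧸ K) := by
      intro x
      exact Iff.rfl
    have hEn : E.Normal := by
      refine ⟨fun x hx h => ?_⟩
      rw [hmemE] at hx ⊢
      obtain ⟨w, hw, hwx⟩ := hx
      refine ⟨f h w, ?_, ?_⟩
      · rw [← MulAut.mul_apply, hcommf, MulAut.mul_apply, hw, map_pow]
      · rw [sectionAction_coe, hwx]; rfl
    have hKE : K ≤ E := fun x hx => (hmemE x).mpr ⟨1, by simp, by
      rw [(QuotientGroup.eq_one_iff x).mpr hx]; rfl⟩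
    have hEL : E ≤ L := by
      intro x hx
      obtain ⟨⟨_, y, hy, rfl⟩, -, hwx⟩ := (hmemE x).mp hx
      have h1 : y⁻¹ * x ∈ K := QuotientGroup.eq.mp hwx
      have h2 := mul_mem hy (hc.lt.le h1)
      simpa using h2
    have hE : E = L := by
      refine (hc.eq_or_eq E hEn hKE hEL).resolve_left fun hEK => hv ?_
      obtain ⟨_, x, hx, rfl⟩ := v
      have hxE : x ∈ E := (hmemE x).mpr ⟨_, hi, rfl⟩
      rw [hEK] at hxE
      exact Subtype.ext ((QuotientGroup.eq_one_iff x).mpr hxE)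
    rintro ⟨_, x, hx, rfl⟩
    obtain ⟨w, hw, hwx⟩ := (hmemE x).mp (hE ▸ hx : x ∈ E)
    have : w = ⟨_, mem_map_of_mem (QuotientGroup.mk' K) hx⟩ := Subtype.ext hwx
    rw [← this]
    exact hw
  obtain ⟨x, hx, hxK⟩ := hnt
  -- As every `g` acts as a power map, every cyclic subgroup of `L / K` is invariant.
  have hZn : (zpowers x ⊔ K).Normal := by
    have hcomap : (zpowers x ⊔ K) = (zpowers (x : G ⧸ K)).comap (QuotientGroup.mk' K) := by
      have : zpowers (x : G ⧸ K) = (zpowers x).map (QuotientGroup.mk' K) :=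
        (MonoidHom.map_zpowers (QuotientGroup.mk' K) x).symm
      rw [this, comap_map_eq, QuotientGroup.ker_mk']
    rw [hcomap]
    refine ⟨fun y hy g => ?_⟩
    rw [mem_comap, mem_zpowers_iff] at hy ⊢
    obtain ⟨k, hk⟩ := hy
    obtain ⟨i, hi⟩ := hscalar g
    refine ⟨i * k, ?_⟩
    have h1 := congrArg Subtype.val (hi ⟨_, mem_map_of_mem (QuotientGroup.mk' K) hx⟩)
    rw [sectionAction_coe] at h1
    have h2 : (QuotientGroup.mk' K) (g * y * g⁻¹) =
        ((g : G ⧸ K) * (x : G ⧸ K) * (g : G ⧸ K)⁻¹) ^ k := by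
      rw [conj_zpow, hk]; rfl
    rw [h2]
    have h3 : ((g : G ⧸ K) * (x : G ⧸ K) * (g : G ⧸ K)⁻¹) = (x : G ⧸ K) ^ i := h1
    rw [h3, zpow_mul, zpow_natCast]
  refine ⟨x, hx, ?_⟩
  rcases hc.eq_or_eq _ hZn le_sup_right (sup_le (zpowers_le.mpr hx) hc.lt.le) with h1 | h1
  · exact absurd (h1 ▸ mem_sup_left (mem_zpowers x)) hxK
  · exact h1.ge

/-- `p`-sections centralised by `primeResidual p G` only have cyclic chief factors. -/
theorem cyclicBetween_of_commutator_le [Finite G] {p : ℕ} [hp : Fact p.Prime] {K P : Subgroup G}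
    (hps : PSection p K P) (h : ⁅P, primeResidual p G⁆ ≤ K) : CyclicBetween p K P :=
  fun _ _ hKA hc hBP _ => hc.cyclicSection_of_commutator_le (hps.mono hKA hBP)
    ((commutator_mono hBP le_rfl).trans (h.trans hKA))

end AbelianResidual

end ICPi

/-! ### Traces on chief factors of subgroups with the `IC`-`Π`-property -/

namespace ICPi

open Subgroup
open scoped commutatorElement

section PiLemmas

variable {G : Type*} [Group G]

/-- The group `Q` is transitive on `G ⧸ N`: the orbit of the base point has size `|Q : Q ∩ N|`,
which `|G : N|` divides because the two indices are coprime. -/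
theorem exists_eq_mul_of_coprime_index [Finite G] {Q N : Subgroup G}
    (h : N.index.Coprime Q.index) (g : G) : ∃ q ∈ Q, ∃ n ∈ N, g = q * n := by
  have hdvd : N.index ∣ N.relIndex Q := by
    have h1 : N.index ∣ (N ⊓ Q).index := index_dvd_of_le inf_le_left
    rw [← relIndex_mul_index (inf_le_right : N ⊓ Q ≤ Q), inf_relIndex_right] at h1
    exact h.dvd_of_dvd_mul_right h1
  have hstab : MulAction.stabilizer Q ((1 : G) : G ⧸ N) = N.subgroupOf Q := by
    ext q
    rw [MulAction.mem_stabilizer_iff, mem_subgroupOf]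
    change ((q : G) * 1 : G) = ((1 : G) : G ⧸ N) ↔ _
    rw [mul_one, QuotientGroup.eq, mul_one, inv_mem_iff]
  have horb : MulAction.orbit Q ((1 : G) : G ⧸ N) = Set.univ := by
    apply Set.eq_of_subset_of_ncard_le (Set.subset_univ _)
    rw [← MulAction.index_stabilizer, hstab, Set.ncard_univ, ← index_eq_card]
    refine Nat.le_of_dvd (Nat.pos_of_ne_zero ?_) hdvd
    exact index_ne_zero_of_finite
  obtain ⟨q, hq⟩ : (g : G ⧸ N) ∈ MulAction.orbit Q ((1 : G) : G ⧸ N) := horb ▸ Set.mem_univ _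
  change ((q : G) * 1 : G) = (g : G ⧸ N) at hq
  rw [mul_one, QuotientGroup.eq] at hq
  exact ⟨q, q.2, _, hq, by group⟩

theorem pSection_sup {p : ℕ} {H K : Subgroup G} (hK : K.Normal) (hH : IsPGroup p H) :
    PSection p K (H ⊔ K) := by
  intro x hx
  obtain ⟨h, hh, k, hk, rfl⟩ := mem_sup_of_normal_right.mp hx
  obtain ⟨n, hn⟩ := pSection_of_isPGroup (K := ⊥) hH h hh
  refine ⟨n, ?_⟩
  rw [← QuotientGroup.eq_one_iff, QuotientGroup.mk_pow, QuotientGroup.mk_mul,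
    (QuotientGroup.eq_one_iff k).mpr hk, mul_one, ← QuotientGroup.mk_pow, mem_bot.mp hn]
  rfl

theorem PiSub.index_eq_pow [Finite G] {p : ℕ} [hp : Fact p.Prime] {H K L : Subgroup G}
    (h : PiSub H) (hH : IsPGroup p H) (hc : IsChiefFactor K L) :
    ∃ n, (normalizer (((H ⊔ K) ⊓ L : Subgroup G) : Set G)).index = p ^ n := by
  refine ⟨_, Nat.eq_prime_pow_of_unique_prime_dvd index_ne_zero_of_finite ?_⟩
  intro q hq hd
  have h1 := h K L hc q hq hd
  obtain ⟨n, hn⟩ := ((pSection_sup hc.normal_bot hH).mono le_rfl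
    (inf_le_left : (H ⊔ K) ⊓ L ≤ H ⊔ K)).exists_relIndex hc.normal_bot
  rw [hn] at h1
  exact (Nat.prime_dvd_prime_iff_eq hq hp.out).mp (hq.dvd_of_dvd_pow h1)

/-- The index of the normaliser is a power of `p`, and prime to `p` as soon as a Sylow `p`-subgroup
lies in it. -/
theorem PiSub.normal_of_sylow_le [Finite G] {p : ℕ} [hp : Fact p.Prime] {H K L : Subgroup G}
    (h : PiSub H) (hH : IsPGroup p H) (hc : IsChiefFactor K L) (S : Sylow p G)
    (hS : (S : Subgroup G) ≤ normalizer (((H ⊔ K) ⊓ L : Subgroup G) : Set G)) :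
    ((H ⊔ K) ⊓ L).Normal := by
  obtain ⟨n, hn⟩ := h.index_eq_pow hH hc
  rw [← normalizer_eq_top_iff, ← index_eq_one, hn]
  rcases Nat.eq_zero_or_pos n with rfl | hn0
  · simp
  · exact absurd ((dvd_pow_self p hn0.ne').trans (hn ▸ index_dvd_of_le hS)) S.not_dvd_index

/-- For a Sylow subgroup `Q ≥ H`, the coprime indices give `G = Q N_G(T)`, where `T` is the trace.
All conjugates of `T` then lie in `QK`, a `p`-group modulo `K`, so the normal closure of `T` cannot
be `L` and must be `K`. -/
theorem PiSub.eq_of_not_pSection [Finite G] {p : ℕ} [hp : Fact p.Prime] {H K L : Subgroup G}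
    (h : PiSub H) (hH : IsPGroup p H) (hc : IsChiefFactor K L) (hps : ¬ PSection p K L) :
    (H ⊔ K) ⊓ L = K := by
  have := hc.normal_bot
  have := hc.normal_top
  obtain ⟨n, hn⟩ := h.index_eq_pow hH hc
  obtain ⟨Q, hQ⟩ := hH.exists_le_sylow
  by_contra hne
  set T := (H ⊔ K) ⊓ L with hT
  have hKT : K ≤ T := le_inf le_sup_right hc.lt.le
  have hTQ : T ≤ (Q : Subgroup G) ⊔ K := inf_le_left.trans (sup_le_sup_right hQ K)
  have hconj : ∀ g : G, ∀ t ∈ T, g * t * g⁻¹ ∈ (Q : Subgroup G) ⊔ K := by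
    intro g t ht
    obtain ⟨q, hq, m, hm, rfl⟩ := exists_eq_mul_of_coprime_index (Q := Q)
      (N := normalizer (T : Set G)) (by
        rw [hn]
        exact Nat.Coprime.pow_left _ (hp.out.coprime_iff_not_dvd.mpr Q.not_dvd_index)) g
    have h1 : m * t * m⁻¹ ∈ T := (mem_normalizer_iff.mp hm t).mp ht
    have h2 : q * m * t * (q * m)⁻¹ = q * (m * t * m⁻¹) * q⁻¹ := by group
    rw [h2]
    exact mul_mem (mul_mem (mem_sup_left hq) (hTQ h1)) (inv_mem (mem_sup_left hq))
  have hncl : normalClosure (T : Set G) ≤ (Q : Subgroup G) ⊔ K := by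
    rw [normalClosure, closure_le]
    intro x hx
    obtain ⟨t, ht, hx⟩ := Group.mem_conjugatesOfSet_iff.mp hx
    obtain ⟨g, rfl⟩ := isConj_iff.mp hx
    exact hconj g t ht
  have hTN : T ≤ normalClosure (T : Set G) := le_normalClosure
  rcases hc.eq_or_eq (normalClosure (T : Set G)) inferInstance (hKT.trans hTN)
    (normalClosure_le_normal inf_le_right) with h1 | h1
  · exact hne (le_antisymm (h1 ▸ hTN) hKT)
  · exact hps ((pSection_sup hc.normal_bot Q.isPGroup').mono le_rfl (h1 ▸ hncl))

theorem commutator_top_normal (H : Subgroup G) : (⁅H, (⊤ : Subgroup G)⁆).Normal :=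
  normalizer_eq_top_iff.mp (top_le_iff.mp (normalizer_commutator_ge_right H ⊤))

theorem icPiProperty_iff {H : Subgroup G} :
    ICPiProperty H ↔ PiSub (H ⊓ ⁅H, (⊤ : Subgroup G)⁆) := piProperty_iff

/-- This transfers statements on `H ∩ [H, G]` to `H`: the two have the same trace on `L / K` when
`[H, G]` covers enough of it. -/
theorem inf_commutator_sup_inf {H K L : Subgroup G} (hc : IsChiefFactor K L)
    (hcov : L ≤ ⁅H, (⊤ : Subgroup G)⁆ ∨ K ≤ H ∧ L ≤ ⁅H, (⊤ : Subgroup G)⁆ ⊔ K) :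
    (H ⊓ ⁅H, (⊤ : Subgroup G)⁆ ⊔ K) ⊓ L = (H ⊓ L) ⊔ K := by
  have hK := hc.normal_bot
  rcases hcov with h | ⟨h1, h2⟩
  · rw [sup_comm, sup_inf_of_le' hK hc.lt.le, inf_assoc, inf_eq_right.mpr h, sup_comm]
  · rw [inf_comm H, sup_comm, ← sup_inf_of_le' hK h1, sup_comm, inf_right_comm,
      inf_eq_right.mpr h2, inf_comm, sup_eq_left.mpr (le_inf h1 hc.lt.le)]

theorem ICPiProperty.eq_or_eq [Finite G] {p : ℕ} [hp : Fact p.Prime] {H K L : Subgroup G}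
    (h : ICPiProperty H) (hH : IsPGroup p H) (hc : IsChiefFactor K L)
    (hcov : L ≤ ⁅H, (⊤ : Subgroup G)⁆ ∨ K ≤ H ∧ L ≤ ⁅H, (⊤ : Subgroup G)⁆ ⊔ K)
    (S : Sylow p G) (hS : (S : Subgroup G) ≤ normalizer (((H ⊓ L) ⊔ K : Subgroup G) : Set G)) :
    (H ⊓ L) ⊔ K = K ∨ (H ⊓ L) ⊔ K = L := by
  have h1 := inf_commutator_sup_inf hc hcov
  rw [← h1] at hS ⊢
  exact hc.eq_or_eq _ ((icPiProperty_iff.mp h).normal_of_sylow_le hH.to_inf_left hc S hS)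
    (le_inf le_sup_right hc.lt.le) inf_le_right

theorem ICPiProperty.inf_le [Finite G] {p : ℕ} [hp : Fact p.Prime] {H K L : Subgroup G}
    (h : ICPiProperty H) (hH : IsPGroup p H) (hc : IsChiefFactor K L)
    (hcov : L ≤ ⁅H, (⊤ : Subgroup G)⁆) (hps : ¬ PSection p K L) : H ⊓ L ≤ K := by
  have h1 := inf_commutator_sup_inf hc (Or.inl hcov)
  rw [(icPiProperty_iff.mp h).eq_of_not_pSection hH.to_inf_left hc hps] at h1
  rw [h1]
  exact le_sup_left

theorem IsChiefFactor.zpowers_sup_eq {K L : Subgroup G} (hc : IsChiefFactor K L) {x : G}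
    (hx : x ∈ L) (hxK : x ∉ K) (h : ∀ g : G, ⁅g, x⁆ ∈ K) : zpowers x ⊔ K = L := by
  have := hc.normal_bot
  have hZn : (zpowers x ⊔ K).Normal := by
    rw [← commutator_top_left_le_iff, Subgroup.commutator_le]
    intro g _ y hy
    obtain ⟨z, hz, k, hk, rfl⟩ := mem_sup_of_normal_right.mp hy
    obtain ⟨n, rfl⟩ := mem_zpowers_iff.mp hz
    refine mem_sup_right ?_
    have h1 := h g
    rw [← QuotientGroup.eq_one_iff] at h1 ⊢
    have h2 : Commute (g : G ⧸ K) (x : G ⧸ K) := commutatorElement_eq_one_iff_commute.mp h1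
    have h3 : ((x ^ n * k : G) : G ⧸ K) = (x : G ⧸ K) ^ n := by
      rw [QuotientGroup.mk_mul, (QuotientGroup.eq_one_iff k).mpr hk, mul_one]; rfl
    have h4 : Commute (g : G ⧸ K) ((x ^ n * k : G) : G ⧸ K) := by
      rw [h3]; exact h2.zpow_right n
    exact commutatorElement_eq_one_iff_commute.mpr h4
  rcases hc.eq_or_eq _ hZn le_sup_right (sup_le (zpowers_le.mpr hx) hc.lt.le) with h1 | h1
  · exact absurd (h1 ▸ mem_sup_left (mem_zpowers x)) hxK
  · exact h1

/-- If `[H, G] ≤ K`, an element of `H` outside `K` is central modulo `K` and generates the whole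
factor, which is then cyclic. -/
theorem IsChiefFactor.le_commutator_sup {K L H : Subgroup G} (hc : IsChiefFactor K L)
    (hcyc : ¬ CyclicSection K L) (hHL : H ≤ L) (hH : ¬ H ≤ K) :
    L ≤ ⁅H, (⊤ : Subgroup G)⁆ ⊔ K := by
  have := hc.normal_bot
  have := hc.normal_top
  have := commutator_top_normal H
  rcases hc.eq_or_eq (⁅H, (⊤ : Subgroup G)⁆ ⊔ K) inferInstance le_sup_right
    (sup_le ((commutator_mono hHL le_rfl).trans (commutator_le_left L ⊤)) hc.lt.le) with h | h
  · exfalso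
    obtain ⟨x, hx, hxK⟩ := SetLike.not_le_iff_exists.mp hH
    refine hcyc ⟨x, hHL hx, (hc.zpowers_sup_eq (hHL hx) hxK fun g => ?_).ge⟩
    rw [← h, ← inv_mem_iff, commutatorElement_inv]
    exact mem_sup_left (commutator_mem_commutator hx (mem_top g))
  · exact h.ge

/-- A `p`-subgroup with the `IC`-`Π`-property that contains `K` meets a noncyclic chief factor
`L / K` trivially or contains it, if the intersection is invariant under a Sylow subgroup. -/
theorem ICPiProperty.inf_le_or_le [Finite G] {p : ℕ} [hp : Fact p.Prime] {H K L : Subgroup G}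
    (h : ICPiProperty H) (hH : IsPGroup p H) (hc : IsChiefFactor K L) (hKH : K ≤ H)
    (hcyc : ¬ CyclicSection K L) (S : Sylow p G)
    (hS : (S : Subgroup G) ≤ normalizer ((H ⊓ L : Subgroup G) : Set G)) :
    H ⊓ L ≤ K ∨ L ≤ H := by
  by_cases hle : H ⊓ L ≤ K
  · exact Or.inl hle
  right
  have h1 : L ≤ ⁅H, (⊤ : Subgroup G)⁆ ⊔ K :=
    (hc.le_commutator_sup hcyc inf_le_right hle).trans
      (sup_le_sup_right (commutator_mono inf_le_left le_rfl) K)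
  have h2 : H ⊓ L ⊔ K = H ⊓ L := sup_eq_left.mpr (le_inf hKH hc.lt.le)
  rcases h.eq_or_eq hH hc (Or.inr ⟨hKH, h1⟩) S (by rwa [h2]) with h3 | h3
  · exact absurd (h3 ▸ le_sup_left) hle
  · rw [h2] at h3
    exact h3 ▸ inf_le_left

/-- Either alternative of `hker` ensures that `H ∩ [H, G]` maps onto the corresponding intersection
for the image of `H`. -/
theorem ICPiProperty.map {G' : Type*} [Group G'] {f : G →* G'} (hf : Function.Surjective f)
    {H : Subgroup G} (h : ICPiProperty H)
    (hker : f.ker ≤ H ∨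
      ∀ x ∈ H, ∀ y ∈ ⁅H, (⊤ : Subgroup G)⁆, f x = f y → x ∈ ⁅H, (⊤ : Subgroup G)⁆) :
    ICPiProperty (H.map f) := by
  rw [icPiProperty_iff] at h ⊢
  have h1 : H.map f ⊓ ⁅H.map f, (⊤ : Subgroup G')⁆ = (H ⊓ ⁅H, (⊤ : Subgroup G)⁆).map f := by
    have h2 : ⁅H.map f, (⊤ : Subgroup G')⁆ = (⁅H, (⊤ : Subgroup G)⁆).map f := by
      rw [map_commutator, map_top_of_surjective f hf]
    rw [h2]
    refine le_antisymm ?_ (map_inf_le _ _ f)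
    rintro _ ⟨⟨x, hx, rfl⟩, y, hy, hxy⟩
    rcases hker with hker | hker
    · refine ⟨y, ⟨?_, hy⟩, hxy⟩
      have h3 : x⁻¹ * y ∈ H := hker (by rw [MonoidHom.mem_ker, map_mul, map_inv, hxy]; simp)
      simpa using mul_mem hx h3
    · exact ⟨x, ⟨hx, hker x hx y hy hxy.symm⟩, rfl⟩
  rw [h1]
  exact h.map hf

theorem ICPiProperty.map_of_ker_le {G' : Type*} [Group G'] {f : G →* G'}
    (hf : Function.Surjective f) {H : Subgroup G} (h : ICPiProperty H) (hker : f.ker ≤ H) :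
    ICPiProperty (H.map f) := h.map hf (Or.inl hker)

/-- If `x ∈ H` and `y ∈ [H, G]` have the same image, then `x` is congruent modulo `[H, G]` to the
kernel element `y⁻¹x`. So `x` has both a `p`-power and a power prime to `p` in `[H, G]`. -/
theorem ICPiProperty.map_of_coprime [Finite G] {G' : Type*} [Group G'] {f : G →* G'} {p : ℕ}
    [hp : Fact p.Prime] (hf : Function.Surjective f) {H : Subgroup G} (h : ICPiProperty H)
    (hH : IsPGroup p H) (hker : ¬ p ∣ Nat.card f.ker) : ICPiProperty (H.map f) := by
  refine h.map hf (Or.inr fun x hx y hy hxy => ?_)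
  have hn := commutator_top_normal H
  obtain ⟨n, hn⟩ := pSection_of_isPGroup (K := ⊥) hH x hx
  refine mem_of_pow_mem_of_coprime (a := Nat.card f.ker) (b := p ^ n) ?_ ?_
    (Nat.Coprime.pow_right _ (hp.out.coprime_iff_not_dvd.mpr hker).symm)
  · have h1 : y⁻¹ * x ∈ f.ker := by
      rw [MonoidHom.mem_ker, map_mul, map_inv, hxy]; simp
    have h2 : (y⁻¹ * x) ^ Nat.card f.ker = 1 := by
      have := pow_card_eq_one' (x := (⟨_, h1⟩ : f.ker))
      exact congrArg Subtype.val this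
    rw [← QuotientGroup.eq_one_iff]
    have h3 : ((y⁻¹ * x : G) : G ⧸ ⁅H, (⊤ : Subgroup G)⁆) = (x : G ⧸ ⁅H, (⊤ : Subgroup G)⁆) := by
      rw [QuotientGroup.mk_mul, QuotientGroup.mk_inv, (QuotientGroup.eq_one_iff y).mpr hy]
      simp
    rw [QuotientGroup.mk_pow, ← h3, ← QuotientGroup.mk_pow, h2]
    rfl
  · rw [mem_bot.mp hn]; exact one_mem _

end PiLemmas

end ICPi

/-! ### Subgroups of prescribed order in `p`-groups, and powers in class two -/

namespace ICPi

open Subgroup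
open scoped commutatorElement

section PGroups

variable {G : Type*} [Group G]

/-- A `p`-group has no nontrivial `p'`-elements, so `primeResidual` is trivial and every chief
factor is cyclic. -/
theorem IsChiefFactor.relIndex_of_isPGroup [Finite G] {p : ℕ} [hp : Fact p.Prime]
    (hG : IsPGroup p G) {K L : Subgroup G} (hc : IsChiefFactor K L) : K.relIndex L = p := by
  have hps : PSection p K L := pSection_of_isPGroup (hG.to_subgroup L)
  refine hc.relIndex_of_cyclic (hc.cyclicSection_of_commutator_le hps ?_)
    (hps.dvd_relIndex hc.normal_bot hc.lt)
  have h1 : primeResidual p G = ⊥ := by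
    rw [primeResidual, closure_eq_bot_iff]
    rintro a ⟨-, ha⟩
    obtain ⟨n, hn⟩ := IsPGroup.iff_orderOf.mp hG a
    rw [hn] at ha
    rcases Nat.eq_zero_or_pos n with rfl | h0
    · simpa using hn
    · exact absurd ha (by
        rw [Nat.coprime_pow_left_iff h0, Nat.coprime_self]; exact hp.out.ne_one)
  rw [h1, commutator_bot_right]
  exact bot_le

theorem exists_normal_card_eq [Finite G] {p : ℕ} [hp : Fact p.Prime]
    (hG : IsPGroup p G) {A : Subgroup G} (hA : A.Normal) {k : ℕ} (hAk : Nat.card A ≤ p ^ k) :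
    ∀ B : Subgroup G, B.Normal → A ≤ B → p ^ k ≤ Nat.card B →
      ∃ C : Subgroup G, C.Normal ∧ A ≤ C ∧ C ≤ B ∧ Nat.card C = p ^ k := by
  intro B
  induction B using WellFoundedLT.induction with
  | ind B ih =>
    intro hB hAB hk
    rcases eq_or_lt_of_le hk with heq | hlt
    · exact ⟨B, hB, hAB, le_rfl, heq.symm⟩
    have hAB' : A < B := lt_of_le_of_ne hAB (by rintro rfl; exact absurd hlt hAk.not_gt)
    obtain ⟨N, hAN, hc⟩ := exists_chiefFactor_le hA hB hAB'
    have h1 := hc.relIndex_of_isPGroup hG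
    have h2 : Nat.card N * p = Nat.card B := by
      have := relIndex_mul_relIndex ⊥ N B bot_le hc.lt.le
      rwa [relIndex_bot_left, relIndex_bot_left, h1] at this
    obtain ⟨m, hm⟩ := IsPGroup.iff_card.mp (hG.to_subgroup B)
    have h3 : k < m := (Nat.pow_lt_pow_iff_right hp.out.one_lt).mp (hm ▸ hlt)
    have h4 : p ^ k ≤ Nat.card N := by
      refine Nat.le_of_mul_le_mul_right (c := p) ?_ hp.out.pos
      rw [h2, hm, ← pow_succ]
      exact Nat.pow_le_pow_right hp.out.pos h3
    obtain ⟨C, hC, h5, h6, h7⟩ := ih N hc.lt hc.normal_bot hAN h4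
    exact ⟨C, hC, h5, h6.trans hc.lt.le, h7⟩

theorem card_subgroupOf_of_le {A S : Subgroup G} (h : A ≤ S) :
    Nat.card (A.subgroupOf S) = Nat.card A :=
  Nat.card_congr (subgroupOfEquivOfLe h).toEquiv

theorem card_map_subtype {S : Subgroup G} (A : Subgroup S) :
    Nat.card (A.map S.subtype) = Nat.card A :=
  (Nat.card_congr (A.equivMapOfInjective _ S.subtype_injective).toEquiv).symm

/-- Between two `S`-invariant subgroups of a `p`-group `S` there are `S`-invariant subgroups of
every possible order. -/
theorem exists_invariant_card_eq [Finite G] {p : ℕ} [hp : Fact p.Prime] {S A B : Subgroup G}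
    (hS : IsPGroup p S) (hAB : A ≤ B) (hBS : B ≤ S) (hA : S ≤ normalizer (A : Set G))
    (hB : S ≤ normalizer (B : Set G)) {k : ℕ} (hAk : Nat.card A ≤ p ^ k)
    (hkB : p ^ k ≤ Nat.card B) :
    ∃ C, A ≤ C ∧ C ≤ B ∧ S ≤ normalizer (C : Set G) ∧ Nat.card C = p ^ k := by
  obtain ⟨C, hC, h1, h2, h3⟩ := exists_normal_card_eq hS (A := A.subgroupOf S)
    ((normal_subgroupOf_iff_le_normalizer (hAB.trans hBS)).mpr hA) (k := k)
    (by rwa [card_subgroupOf_of_le (hAB.trans hBS)]) (B.subgroupOf S)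
    ((normal_subgroupOf_iff_le_normalizer hBS).mpr hB) (fun x hx => hAB hx)
    (by rwa [card_subgroupOf_of_le hBS])
  have hCS : C.map S.subtype ≤ S := map_subtype_le C
  refine ⟨C.map S.subtype, ?_, ?_, ?_, by rw [card_map_subtype, h3]⟩
  · intro x hx
    exact ⟨⟨x, hBS (hAB hx)⟩, h1 hx, rfl⟩
  · rintro _ ⟨x, hx, rfl⟩
    exact h2 hx
  · rw [← normal_subgroupOf_iff_le_normalizer hCS]
    have : (C.map S.subtype).subgroupOf S = C := comap_map_eq_self_of_injective
      S.subtype_injective C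
    rwa [this]

theorem exists_card_eq [Finite G] {p : ℕ} [hp : Fact p.Prime] {Q A : Subgroup G}
    (hQ : IsPGroup p Q) (hAQ : A ≤ Q) {k : ℕ} (hAk : Nat.card A ≤ p ^ k)
    (hkQ : p ^ k ≤ Nat.card Q) : ∃ H, A ≤ H ∧ H ≤ Q ∧ Nat.card H = p ^ k := by
  obtain ⟨m, hm⟩ := IsPGroup.iff_card.mp (hQ.to_le hAQ)
  obtain ⟨n, hn⟩ := IsPGroup.iff_card.mp hQ
  rw [hm, Nat.pow_le_pow_iff_right hp.out.one_lt] at hAk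
  rw [hn, Nat.pow_le_pow_iff_right hp.out.one_lt] at hkQ
  obtain ⟨K, hK, hle⟩ := Sylow.exists_subgroup_card_pow_prime_le (G := Q) p (n := m) (m := k)
    (by rw [hn]; exact pow_dvd_pow p hkQ) (A.subgroupOf Q)
    (by rw [card_subgroupOf_of_le hAQ, hm]) hAk
  refine ⟨K.map Q.subtype, fun x hx => ⟨⟨x, hAQ hx⟩, hle hx, rfl⟩, map_subtype_le K, ?_⟩
  rw [card_map_subtype, hK]

/-- Moving `y ^ k` past `x` costs `c ^ k` for the commutator `c`; the exponents `0, …, n - 1` add up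
to `n.choose 2`. -/
theorem mul_pow_of_central {x y : G} (hx : Commute ⁅y, x⁆ x) (hy : Commute ⁅y, x⁆ y) (n : ℕ) :
    (x * y) ^ n = x ^ n * y ^ n * ⁅y, x⁆ ^ (n.choose 2) := by
  set c := ⁅y, x⁆ with hc
  have hyx : y * x = c * (x * y) := by rw [hc, commutatorElement_def]; group
  have hypow : ∀ k : ℕ, y ^ k * x = x * y ^ k * c ^ k := by
    intro k
    induction k with
    | zero => simp
    | succ k ih =>
      calc y ^ (k + 1) * x = y * (y ^ k * x) := by rw [pow_succ']; group
        _ = (y * x) * y ^ k * c ^ k := by rw [ih]; group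
        _ = c * (x * (y ^ (k + 1))) * c ^ k := by rw [hyx, pow_succ']; group
        _ = x * y ^ (k + 1) * c * c ^ k := by
            rw [(hx.mul_right (hy.pow_right (k + 1))).eq]
        _ = x * y ^ (k + 1) * c ^ (k + 1) := by rw [pow_succ' c]; group
  induction n with
  | zero => simp
  | succ n ih =>
    have h1 : Commute (c ^ n.choose 2) (x * y) := (hx.mul_right hy).pow_left _
    have h2 : Commute (c ^ n) y := hy.pow_left _
    calc (x * y) ^ (n + 1) = x ^ n * y ^ n * (c ^ n.choose 2 * (x * y)) := by
          rw [pow_succ, ih]; group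
      _ = x ^ n * (y ^ n * x) * y * c ^ n.choose 2 := by rw [h1.eq]; group
      _ = x ^ n * (x * y ^ n) * (c ^ n * y) * c ^ n.choose 2 := by rw [hypow]; group
      _ = x ^ (n + 1) * y ^ (n + 1) * (c ^ n * c ^ n.choose 2) := by
          rw [h2.eq, pow_succ x, pow_succ y]; group
      _ = _ := by rw [← pow_add, Nat.choose_succ_succ' n 1, Nat.choose_one_right]

theorem commutatorElement_pow_left_of_central {x y : G} (hy : Commute ⁅y, x⁆ y) (n : ℕ) :
    ⁅y ^ n, x⁆ = ⁅y, x⁆ ^ n := by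
  induction n with
  | zero => simp
  | succ n ih =>
    have h1 : ⁅y ^ (n + 1), x⁆ = y * ⁅y ^ n, x⁆ * y⁻¹ * ⁅y, x⁆ := by
      rw [commutatorElement_def, commutatorElement_def, commutatorElement_def, pow_succ']; group
    rw [h1, ih, ← (hy.pow_left n).eq, mul_assoc (⁅y, x⁆ ^ n), mul_inv_cancel, mul_one, pow_succ]

/-- `n` kills the commutators of a group of class two whose `n`-th powers satisfy the usual
conditions: `n = p` odd, `n = 4` for `p = 2`, or the group is abelian. -/
def GoodExponent (p n : ℕ) (T : Subgroup G) : Prop :=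
  (n = p ∧ (p ≠ 2 ∨ ∀ x ∈ T, ∀ y ∈ T, x * y = y * x)) ∨ (p = 2 ∧ n = 4)

/-- Here `[y, x] ^ p = [y ^ p, x] = 1`, and `p` divides `n.choose 2` for odd `n = p`, and for `p =
2`, `n = 4`, where it is `6`. The abelian case is immediate. -/
theorem GoodExponent.commutator_pow {p n : ℕ} [hp : Fact p.Prime] {T : Subgroup G}
    (h : GoodExponent p n T) {x y : G} (hx : x ∈ T) (hy : y ∈ T) (hcy : Commute ⁅y, x⁆ y)
    (hpow : Commute (y ^ p) x) : ⁅y, x⁆ ^ (n.choose 2) = 1 := by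
  have h1 : ⁅y, x⁆ ^ p = 1 := by
    rw [← commutatorElement_pow_left_of_central hcy]
    exact commutatorElement_eq_one_iff_commute.mpr hpow
  have h2 : p ∣ n.choose 2 → ⁅y, x⁆ ^ (n.choose 2) = 1 := by
    rintro ⟨m, hm⟩
    rw [hm, pow_mul, h1, one_pow]
  rcases h with ⟨rfl, h | h⟩ | ⟨rfl, rfl⟩
  · have := hp.out.two_le
    exact h2 (hp.out.dvd_choose_self (by lia) (by lia))
  · rw [commutatorElement_eq_one_iff_mul_comm.mpr (h y hy x hx), one_pow]
  · exact h2 ⟨3, rfl⟩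

/-- If `T = [T, A]` has a central subgroup `E` that contains all commutators and `p`-th powers of
`T` and is centralised by `A`, then `T` has exponent dividing `p`, or `4` if `p = 2`. -/
theorem pow_eq_one_of_le_commutator {p n : ℕ} [hp : Fact p.Prime] {T A E : Subgroup G}
    (hn : GoodExponent p n T) (hT : T ≤ ⁅T, A⁆) (hEA : ∀ e ∈ E, ∀ a ∈ A, Commute e a)
    (hET : ∀ e ∈ E, ∀ t ∈ T, Commute e t) (hTT : ∀ x ∈ T, ∀ y ∈ T, ⁅x, y⁆ ∈ E)
    (hpow : ∀ x ∈ T, x ^ p ∈ E) (hAT : ∀ a ∈ A, ∀ t ∈ T, a * t * a⁻¹ ∈ T) :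
    ∀ x ∈ T, x ^ n = 1 := by
  have hmul : ∀ x ∈ T, ∀ y ∈ T, (x * y) ^ n = x ^ n * y ^ n := by
    intro x hx y hy
    rw [mul_pow_of_central (hET _ (hTT y hy x hx) x hx) (hET _ (hTT y hy x hx) y hy),
      hn.commutator_pow hx hy (hET _ (hTT y hy x hx) y hy) (hET _ (hpow y hy) x hx), mul_one]
  have hnE : ∀ x ∈ T, x ^ n ∈ E := by
    intro x hx
    rcases hn with ⟨rfl, -⟩ | ⟨rfl, rfl⟩
    · exact hpow x hx
    · rw [show 4 = 2 * 2 from rfl, pow_mul]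
      exact pow_mem (hpow x hx) 2
  let D : Subgroup G :=
    { carrier := {x | x ∈ T ∧ x ^ n = 1}
      one_mem' := ⟨one_mem _, one_pow n⟩
      mul_mem' := by
        rintro a b ⟨ha, ha'⟩ ⟨hb, hb'⟩
        exact ⟨mul_mem ha hb, by rw [hmul a ha b hb, ha', hb', one_mul]⟩
      inv_mem' := by
        rintro a ⟨ha, ha'⟩
        exact ⟨inv_mem ha, by rw [inv_pow, ha', inv_one]⟩ }
  have hD : ⁅T, A⁆ ≤ D := by
    rw [Subgroup.commutator_le]
    intro t ht a ha
    have h1 : ⁅t, a⁆ = t * (a * t⁻¹ * a⁻¹) := by rw [commutatorElement_def]; group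
    have h2 := hAT a ha t⁻¹ (inv_mem ht)
    refine ⟨h1 ▸ mul_mem ht h2, ?_⟩
    -- The `n`-th power of `t (a t⁻¹ a⁻¹)` is `t ^ n` times a conjugate of its inverse by `a`, and
    -- `a` centralises `t ^ n ∈ E`.
    rw [h1, hmul t ht _ h2, conj_pow, inv_pow, ← (hEA _ (inv_mem (hnE t ht)) a ha).eq]
    group
  intro x hx
  exact (hD (hT hx)).2

end PGroups

end ICPi

/-! ### The step from a maximal invariant subgroup to `P` -/

namespace ICPi

open Subgroup
open scoped commutatorElement

section Star

variable {G : Type*} [Group G]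

theorem cyclicBetween_of_chiefFactor {p : ℕ} {K L : Subgroup G} (hc : IsChiefFactor K L)
    (h : CyclicSection K L) : CyclicBetween p K L := by
  intro A B hA hAB hB _
  have hA' := (hc.eq_or_eq A hAB.normal_bot hA (hAB.lt.le.trans hB)).resolve_right
    (fun h => hAB.lt.not_ge (h ▸ hB))
  have hB' := (hc.eq_or_eq B hAB.normal_top (hA.trans hAB.lt.le) hB).resolve_left
    (fun h => hAB.lt.not_ge (h ▸ hA))
  rwa [hA', hB']

theorem IsChiefFactor.sup_eq {N P T : Subgroup G} (hc : IsChiefFactor N P) (hT : T.Normal)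
    (hTP : T ≤ P) (hTN : ¬ T ≤ N) : T ⊔ N = P := by
  have := hc.normal_bot
  exact (hc.eq_or_eq (T ⊔ N) inferInstance le_sup_right (sup_le hTP hc.lt.le)).resolve_left
    fun h => hTN (h ▸ le_sup_left)

/-- By the second isomorphism theorem `T / (T ∩ N)` is `P / N`; modularity carries normal subgroups
across. -/
theorem IsChiefFactor.inf_chiefFactor {N P T : Subgroup G} (hc : IsChiefFactor N P)
    (hT : T.Normal) (hTP : T ≤ P) (hTN : ¬ T ≤ N) : IsChiefFactor (T ⊓ N) T := by
  have := hc.normal_bot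
  refine ⟨inferInstance, hT, lt_of_le_of_ne inf_le_left fun h => hTN (inf_eq_left.mp h), ?_⟩
  intro M hM h1 h2
  by_cases hMN : M ≤ N
  · exact Or.inl (le_antisymm (le_inf h2 hMN) h1)
  · right
    have h3 := hc.sup_eq hM (h2.trans hTP) hMN
    have h4 := sup_inf_of_le hc.normal_bot h2
    rw [h3, inf_eq_right.mpr hTP, inf_comm] at h4
    rw [h4]
    exact (sup_eq_left.mpr h1).symm

theorem commutator_sup_le_of_centralizes {Z E A : Subgroup G} (hE : E.Normal)
    (hEA : ∀ e ∈ E, ∀ a ∈ A, Commute e a) : ⁅Z ⊔ E, A⁆ ≤ ⁅Z, A⁆ := by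
  rw [Subgroup.commutator_le]
  intro x hx a ha
  obtain ⟨z, hz, e, he, rfl⟩ := mem_sup_of_normal_right.mp hx
  have h1 : ⁅z * e, a⁆ = z * ⁅e, a⁆ * z⁻¹ * ⁅z, a⁆ := by
    simp only [commutatorElement_def]; group
  rw [h1, commutatorElement_eq_one_iff_commute.mpr (hEA e he a ha), mul_one, mul_inv_cancel,
    one_mul]
  exact commutator_mem_commutator hz ha

theorem commute_of_commutator_le_bot {A B : Subgroup G} (h : ⁅A, B⁆ ≤ ⊥) :
    ∀ a ∈ A, ∀ b ∈ B, Commute a b := fun _ ha _ hb =>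
  commutatorElement_eq_one_iff_commute.mp (mem_bot.mp (h (commutator_mem_commutator ha hb)))

theorem card_dvd_sup_zpowers [Finite G] {p : ℕ} [hp : Fact p.Prime] {E C : Subgroup G}
    (hEC : E ≤ C) (hcard : Nat.card C = p * Nat.card E) {x : G} (hx : x ∈ C) (hxE : x ∉ E) :
    zpowers x ⊔ E = C := by
  have hle : zpowers x ⊔ E ≤ C := sup_le (zpowers_le.mpr hx) hEC
  have hlt : ¬ zpowers x ⊔ E ≤ E := fun h => hxE (h (mem_sup_left (mem_zpowers x)))
  have h1 := relIndex_mul_relIndex E (zpowers x ⊔ E) C le_sup_right hle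
  have h2 : E.relIndex C = p := by
    have := relIndex_mul_relIndex ⊥ E C bot_le hEC
    rw [relIndex_bot_left, relIndex_bot_left, hcard, mul_comm] at this
    exact Nat.eq_of_mul_eq_mul_right Nat.card_pos this
  rw [h2] at h1
  refine le_antisymm hle (relIndex_eq_one.mp ?_)
  rcases (Nat.dvd_prime hp.out).mp (Dvd.intro _ h1) with h3 | h3
  · exact absurd (relIndex_eq_one.mp h3) hlt
  · rw [h3] at h1
    exact Nat.eq_of_mul_eq_mul_left hp.out.pos (by rw [h1, mul_one])

/-- Extending cyclicity of chief factors from a maximal `G`-invariant subgroup `N` to `P`. -/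
theorem cyclicBetween_of_maximal [Finite G] {p : ℕ} [hp : Fact p.Prime] {N P : Subgroup G}
    (hP : IsPGroup p P) (hc : IsChiefFactor N P) (hN : CyclicBetween p ⊥ N)
    (hH : ∀ x ∈ P, x ∉ N →
      (x ^ p = 1 ∨ p = 2 ∧ x ^ 4 = 1 ∧ ¬ ∀ a ∈ P, ∀ b ∈ P, a * b = b * a) →
      ∃ H, x ∈ H ∧ H ≤ zpowers x ⊔ N ∧ ICPiProperty H) :
    CyclicBetween p ⊥ P := by
  have hNn := hc.normal_bot
  have hPn := hc.normal_top
  have hps : PSection p N P := pSection_of_isPGroup hP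
  suffices hsec : CyclicSection N P from
    cyclicBetween_trans hNn bot_le hN (cyclicBetween_of_chiefFactor hc hsec) hc.lt.le
  by_contra hncyc
  set A := primeResidual p G with hA
  have hNA : ⁅N, A⁆ ≤ ⊥ := hN.commutator_primeResidual_le normal_bot hNn bot_le
    (pSection_of_isPGroup (hP.to_le hc.lt.le))
  have hPA : ¬ ⁅P, A⁆ ≤ N := fun h => hncyc (hc.cyclicSection_of_commutator_le hps h)
  set T := ⁅P, A⁆ with hTdef
  have hTn : T.Normal := commutator_normal P A
  have hTP : T ≤ P := commutator_le_left P A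
  have hTN : T ⊔ N = P := hc.sup_eq hTn hTP hPA
  have hNA' := commute_of_commutator_le_bot hNA
  -- Since `P = TN` and `A` centralises `N`, nothing is lost: `T = [P, A] = [T, A]`.
  have hTT : T ≤ ⁅T, A⁆ := by
    conv_lhs => rw [hTdef, ← hTN]
    exact commutator_sup_le_of_centralizes hNn hNA'
  set E := T ⊓ N with hEdef
  have hEn : E.Normal := normal_inf_normal T N
  have hEA : ∀ e ∈ E, ∀ a ∈ A, Commute e a := fun e he a ha => hNA' e he.2 a ha
  have hEA' : ⁅E, A⁆ ≤ ⊥ := (commutator_mono inf_le_right le_rfl).trans hNA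
  -- Three subgroups lemma: `A` centralises `E`, so `[T, A] = T` does.
  have hET : ∀ e ∈ E, ∀ t ∈ T, Commute e t := by
    have h1 : ⁅⁅T, A⁆, E⁆ = ⊥ := by
      apply commutator_commutator_eq_bot_of_rotate
      · rw [commutator_comm A E, le_bot_iff.mp hEA', commutator_bot_left]
      · exact le_bot_iff.mp ((commutator_mono (commutator_le_left E T) le_rfl).trans hEA')
    intro e he t ht
    exact (commute_of_commutator_le_bot h1.le t (hTT ht) e he).symm
  have hTcomm : ∀ x ∈ T, ∀ y ∈ T, ⁅x, y⁆ ∈ E := fun x hx y hy =>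
    ⟨commutator_le_self T (commutator_mem_commutator hx hy),
      hc.commutator_le hps (commutator_mem_commutator (hTP hx) (hTP hy))⟩
  have hTpow : ∀ x ∈ T, x ^ p ∈ E := fun x hx =>
    ⟨pow_mem hx p, hc.pow_prime_mem hps x (hTP hx)⟩
  have hexp : ∀ x ∈ T, x ^ p = 1 ∨ p = 2 ∧ x ^ 4 = 1 ∧ ¬ ∀ a ∈ P, ∀ b ∈ P, a * b = b * a := by
    by_cases hgood : p ≠ 2 ∨ ∀ x ∈ T, ∀ y ∈ T, x * y = y * x
    · intro x hx
      exact Or.inl (pow_eq_one_of_le_commutator (Or.inl ⟨rfl, hgood⟩) hTT hEA hET hTcomm hTpow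
        (fun a _ t ht => hTn.conj_mem t ht a) x hx)
    · push Not at hgood
      obtain ⟨hp2, a, ha, b, hb, hab⟩ := hgood
      intro x hx
      exact Or.inr ⟨hp2, pow_eq_one_of_le_commutator (Or.inr ⟨hp2, rfl⟩) hTT hEA hET hTcomm hTpow
        (fun a _ t ht => hTn.conj_mem t ht a) x hx, fun h => hab (h a (hTP ha) b (hTP hb))⟩
  have hcE : IsChiefFactor E T := hc.inf_chiefFactor hTn hTP hPA
  have hncycE : ¬ CyclicSection E T := by
    rintro ⟨x, hx, hxT⟩
    refine hncyc ⟨x, hTP hx, ?_⟩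
    conv_lhs => rw [← hTN]
    exact sup_le (hxT.trans (sup_le_sup_left inf_le_right _)) le_sup_right
  obtain ⟨S⟩ : Nonempty (Sylow p G) := inferInstance
  have hPS : P ≤ S := hP.le_sylow_of_normal S
  obtain ⟨e, he⟩ := IsPGroup.iff_card.mp (hP.to_le (hcE.lt.le.trans hTP))
  obtain ⟨t, ht⟩ := IsPGroup.iff_card.mp (hP.to_le hTP)
  have het : e < t := by
    refine (Nat.pow_lt_pow_iff_right hp.out.one_lt).mp ?_
    rw [← he, ← ht]
    exact Set.ncard_lt_ncard hcE.lt
  -- A Sylow-invariant subgroup of order `p` above `E`; it will be the trace of `H` on `T / E`.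
  obtain ⟨C, hEC, hCT, hCS, hCcard⟩ := exists_invariant_card_eq S.isPGroup' hcE.lt.le
    (hTP.trans hPS) le_normalizer_of_normal le_normalizer_of_normal (k := e + 1)
    (by rw [he]; exact Nat.pow_le_pow_right hp.out.pos (by lia))
    (by rw [ht]; exact Nat.pow_le_pow_right hp.out.pos het)
  have hCE : E < C := lt_of_le_of_ne hEC (by
    rintro h
    rw [← h, he] at hCcard
    exact absurd (Nat.pow_right_injective hp.out.two_le hCcard) (by lia))
  obtain ⟨x, hxC, hxE⟩ := SetLike.exists_of_lt hCE
  have hxC' : zpowers x ⊔ E = C :=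
    card_dvd_sup_zpowers hEC (by rw [hCcard, he, pow_succ']) hxC hxE
  have hxT : x ∈ T := hCT hxC
  have hxN : x ∉ N := fun h => hxE ⟨hxT, h⟩
  obtain ⟨H, hxH, hHle, hIC⟩ := hH x (hTP hxT) hxN (hexp x hxT)
  have hHP : H ≤ P := hHle.trans (sup_le (zpowers_le.mpr (hTP hxT)) hc.lt.le)
  have hZ := hcE.le_commutator_sup hncycE (zpowers_le.mpr hxT)
    (fun h => hxE (h (mem_zpowers x)))
  have hZn := commutator_top_normal (zpowers x)
  -- The commutators of `x` cover `T` only modulo `E`; commuting with `A` once more removes `E`.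
  have hTH : T ≤ ⁅H, (⊤ : Subgroup G)⁆ :=
    calc T ≤ ⁅T, A⁆ := hTT
      _ ≤ ⁅⁅zpowers x, (⊤ : Subgroup G)⁆ ⊔ E, A⁆ := commutator_mono hZ le_rfl
      _ ≤ ⁅⁅zpowers x, (⊤ : Subgroup G)⁆, A⁆ := commutator_sup_le_of_centralizes hEn hEA
      _ ≤ ⁅zpowers x, (⊤ : Subgroup G)⁆ := commutator_le_left _ _
      _ ≤ ⁅H, (⊤ : Subgroup G)⁆ := commutator_mono (zpowers_le.mpr hxH) le_rfl
  have hHTE : H ⊓ T ⊔ E = C := by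
    rw [← hxC']
    refine le_antisymm (sup_le ?_ le_sup_right)
      (sup_le (zpowers_le.mpr (mem_sup_left ⟨hxH, hxT⟩)) le_sup_right)
    have h1 := inf_le_inf_right T hHle
    rw [sup_inf_of_le hNn (zpowers_le.mpr hxT), inf_comm N T] at h1
    exact h1
  -- The trace `C / E` would have to be trivial or all of `T / E`; the first contradicts its order,
  -- the second that `T / E` is noncyclic.
  rcases hIC.eq_or_eq (hP.to_le hHP) hcE (Or.inl hTH) S (by rwa [hHTE]) with h | h
  · rw [hHTE] at h
    exact hCE.ne h.symm
  · rw [hHTE] at h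
    exact hncycE ⟨x, hxT, (hxC'.trans h).ge⟩

/-- The `p`-group `P` fixes a nontrivial element of `L` under conjugation, and `L ∩ C_G(P)` is
normal in `G`. -/
theorem IsChiefFactor.le_centralizer_of_isPGroup [Finite G] {p : ℕ} [hp : Fact p.Prime]
    {L P : Subgroup G} (hc : IsChiefFactor ⊥ L) (hP : IsPGroup p P) (hPn : P.Normal)
    (hLP : L ≤ P) : ∀ x ∈ L, ∀ y ∈ P, Commute x y := by
  have := hc.normal_top
  have hdvd : p ∣ Nat.card L := by
    rw [← relIndex_bot_left]
    exact PSection.dvd_relIndex Subgroup.normal_bot (pSection_of_isPGroup (hP.to_le hLP)) hc.lt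
  have hPconj : IsPGroup p (ConjAct P) := hP
  have hnorm : (L.subgroupOf P).Normal := inferInstance
  obtain ⟨b, hb, hb1⟩ := hPconj.exists_fixed_point_of_prime_dvd_card_of_fixed_point
    (L.subgroupOf P) (by rwa [card_subgroupOf_of_le hLP]) (a := 1) (fun g => smul_one g)
  have hF : L ⊓ centralizer (P : Set G) = L := by
    refine (hc.eq_or_eq _ inferInstance bot_le inf_le_left).resolve_left fun h => hb1 ?_
    have h1 : ((b : P) : G) ∈ L ⊓ centralizer (P : Set G) := by
      refine ⟨b.2, mem_centralizer_iff.mpr fun y hy => ?_⟩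
      have h2 := hb (ConjAct.toConjAct ⟨y, hy⟩)
      have h3 : y * ((b : P) : G) * y⁻¹ = ((b : P) : G) :=
        congrArg (fun z : L.subgroupOf P => ((z : P) : G)) h2
      exact mul_inv_eq_iff_eq_mul.mp h3
    rw [h, mem_bot] at h1
    exact (Subtype.ext (Subtype.ext h1)).symm
  intro x hx y hy
  rw [← hF] at hx
  exact (mem_centralizer_iff.mp hx.2 y hy).symm

end Star

end ICPi

/-! ### Noncyclic minimal normal subgroups lie in the Frattini subgroup -/

namespace ICPi

open Subgroup
open scoped commutatorElement

section MinimalNormal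

variable {G : Type*} [Group G]

theorem exists_mul_of_mem_sup {A C : Subgroup G} (h : A ≤ normalizer (C : Set G)) {x : G}
    (hx : x ∈ A ⊔ C) : ∃ a ∈ A, ∃ c ∈ C, a * c = x := by
  rw [← SetLike.mem_coe, coe_mul_of_left_le_normalizer_right A C h] at hx
  exact Set.mem_mul.mp hx

/-- An element `x ^ i c` of `L` puts `x ^ i` in `LC`. If `p` did not divide `i`, Bézout with `x ^ p
∈ C` would put `x` there; otherwise `x ^ i ∈ C`. -/
theorem zpowers_sup_inf {p : ℕ} [hp : Fact p.Prime] {C L : Subgroup G} {x : G}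
    (hn : x ∈ normalizer (C : Set G)) (hxp : x ^ p ∈ C) (hx : x ∉ L ⊔ C) :
    (zpowers x ⊔ C) ⊓ L = C ⊓ L := by
  refine le_antisymm ?_ (inf_le_inf_right L le_sup_right)
  rintro y ⟨hy, hyL⟩
  obtain ⟨_, ⟨i, rfl⟩, c, hc, rfl⟩ := exists_mul_of_mem_sup (zpowers_le.mpr hn) hy
  refine ⟨mul_mem ?_ hc, hyL⟩
  have h1 : x ^ i ∈ L ⊔ C := by
    simpa using mul_mem (mem_sup_left hyL) (inv_mem (mem_sup_right (S := L) hc))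
  by_cases hi : (p : ℤ) ∣ i
  · obtain ⟨j, rfl⟩ := hi
    change x ^ ((p : ℤ) * j) ∈ C
    rw [zpow_mul, zpow_natCast]
    exact zpow_mem hxp j
  · refine absurd ?_ hx
    obtain ⟨a, b, hab⟩ := (Nat.prime_iff_prime_int.mp hp.out).coprime_iff_not_dvd.mpr hi
    have h2 : x = (x ^ p) ^ a * (x ^ i) ^ b := by
      rw [← zpow_natCast, ← zpow_mul, ← zpow_mul, ← zpow_add, mul_comm (p : ℤ), mul_comm i, hab,
        zpow_one]
    rw [h2]
    exact mul_mem (zpow_mem (mem_sup_right hxp) _) (zpow_mem h1 _)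

theorem card_zpowers_sup {p : ℕ} [hp : Fact p.Prime] {C : Subgroup G} {x : G}
    (hn : x ∈ normalizer (C : Set G)) (hx : x ∉ C) (hxp : x ^ p ∈ C) :
    Nat.card (zpowers x ⊔ C : Subgroup G) = p * Nat.card C := by
  set Z := zpowers x ⊔ C with hZ
  have hxZ : x ∈ Z := mem_sup_left (mem_zpowers x)
  have hCZ : C ≤ Z := le_sup_right
  have hnorm : (C.subgroupOf Z).Normal := (normal_subgroupOf_iff_le_normalizer hCZ).mpr
    (sup_le (zpowers_le.mpr hn) le_normalizer)
  have h1 : C.relIndex Z = p := by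
    let g : Z ⧸ C.subgroupOf Z := QuotientGroup.mk (⟨x, hxZ⟩ : Z)
    have hg : orderOf g = p := by
      refine orderOf_eq_prime ?_ ?_
      · rw [← QuotientGroup.mk_pow, QuotientGroup.eq_one_iff]
        exact hxp
      · rw [ne_eq, QuotientGroup.eq_one_iff]
        exact hx
    have htop : zpowers g = ⊤ := by
      have h2 : ((⊤ : Subgroup Z).map (QuotientGroup.mk' (C.subgroupOf Z))) = ⊤ :=
        map_top_of_surjective _ (QuotientGroup.mk'_surjective _)
      have h3 : (⊤ : Subgroup Z) ≤ zpowers (⟨x, hxZ⟩ : Z) ⊔ C.subgroupOf Z := by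
        rw [← map_le_map_iff_of_injective Z.subtype_injective, Subgroup.map_sup,
          MonoidHom.map_zpowers, subgroupOf_map_subtype, ← MonoidHom.range_eq_map, range_subtype,
          inf_eq_left.mpr hCZ]
        exact le_rfl
      rw [eq_top_iff, ← h2]
      refine (map_mono h3).trans ?_
      rw [Subgroup.map_sup, MonoidHom.map_zpowers]
      refine sup_le le_rfl ?_
      rintro _ ⟨c, hc, rfl⟩
      rw [QuotientGroup.mk'_apply, (QuotientGroup.eq_one_iff c).mpr hc]
      exact one_mem _
    rw [relIndex, index, ← hg, ← Nat.card_zpowers, htop, card_top]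
  have := relIndex_mul_relIndex ⊥ C Z bot_le hCZ
  rw [relIndex_bot_left, relIndex_bot_left, h1] at this
  rw [← this, mul_comm]

/-- The subgroup of a `p`-group `P` generated by its commutators and `p`-th powers. -/
def frat (p : ℕ) (P : Subgroup G) : Subgroup G :=
  ⁅P, P⁆ ⊔ closure {y | ∃ x ∈ P, x ^ p = y}

theorem frat_le (p : ℕ) (P : Subgroup G) : frat p P ≤ P := by
  refine sup_le (commutator_le_self P) ((closure_le _).mpr ?_)
  rintro _ ⟨x, hx, rfl⟩
  exact pow_mem hx p

theorem frat_normal (p : ℕ) {P : Subgroup G} (hP : P.Normal) : (frat p P).Normal := by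
  have : (closure {y | ∃ x ∈ P, x ^ p = y}).Normal := by
    refine ⟨fun y hy g => ?_⟩
    induction hy using closure_induction with
    | mem y hy =>
      obtain ⟨x, hx, rfl⟩ := hy
      exact subset_closure ⟨g * x * g⁻¹, hP.conj_mem x hx g, conj_pow⟩
    | one => simp
    | mul a b _ _ ha hb =>
      have : g * (a * b) * g⁻¹ = (g * a * g⁻¹) * (g * b * g⁻¹) := by group
      rw [this]; exact mul_mem ha hb
    | inv a _ ha =>
      have : g * a⁻¹ * g⁻¹ = (g * a * g⁻¹)⁻¹ := by group
      rw [this]; exact inv_mem ha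
  rw [frat]
  infer_instance

theorem pow_mem_frat {p : ℕ} {P : Subgroup G} {x : G} (hx : x ∈ P) : x ^ p ∈ frat p P :=
  mem_sup_right (subset_closure ⟨x, hx, rfl⟩)

theorem commutator_le_frat (p : ℕ) (P : Subgroup G) : ⁅P, P⁆ ≤ frat p P := le_sup_left

/-- Take `M` maximal among the subgroups above `Φ(P)L₀` with `M ∩ L = L₀`. An element `y` outside
`LM` has `y ^ p ∈ M`, so adjoining it would not change the intersection with `L`. -/
theorem exists_sup_eq_inf_eq [Finite G] {p : ℕ} [hp : Fact p.Prime] {P L L₀ : Subgroup G}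
    (hLP : L ≤ P) (hfrat : frat p P ⊓ L = ⊥) (hL₀ : L₀ ≤ L) :
    ∃ M, L₀ ≤ M ∧ M ≤ P ∧ L ⊔ M = P ∧ M ⊓ L = L₀ := by
  have hnorm : ∀ M, frat p P ≤ M → M ≤ P → P ≤ normalizer (M : Set G) := by
    intro M h1 h2
    rw [← normal_subgroupOf_iff_le_normalizer h2]
    refine ⟨fun m hm g => ?_⟩
    have h3 : ((g * m * g⁻¹ : P) : G) = ⁅(g : G), (m : G)⁆ * m := by
      rw [commutatorElement_def]; push_cast; group
    change ((g * m * g⁻¹ : P) : G) ∈ M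
    rw [h3]
    exact mul_mem (h1 (commutator_le_frat p P (commutator_mem_commutator g.2 m.2))) hm
  let 𝒮 : Set (Subgroup G) := {M | frat p P ⊔ L₀ ≤ M ∧ M ≤ P ∧ M ⊓ L = L₀}
  have h0 : frat p P ⊔ L₀ ∈ 𝒮 := by
    refine ⟨le_rfl, sup_le (frat_le p P) (hL₀.trans hLP), ?_⟩
    apply le_antisymm
    · rintro x ⟨hx, hxL⟩
      have hn := hnorm _ le_rfl (frat_le p P)
      rw [SetLike.mem_coe, sup_comm] at hx
      obtain ⟨l, hl, f, hf, rfl⟩ := exists_mul_of_mem_sup ((hL₀.trans hLP).trans hn) hx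
      have : f ∈ frat p P ⊓ L := ⟨hf, by simpa using mul_mem (inv_mem (hL₀ hl)) hxL⟩
      rw [hfrat, mem_bot] at this
      simpa [this] using hl
    · exact le_inf le_sup_right hL₀
  obtain ⟨M, hM⟩ := (Set.toFinite 𝒮).exists_maximal ⟨_, h0⟩
  obtain ⟨⟨h1, h2, h3⟩, hmax⟩ := hM
  refine ⟨M, le_sup_right.trans h1, h2, le_antisymm (sup_le hLP h2) fun y hy => ?_, h3⟩
  by_contra hyM
  have hyM' : y ∉ M := fun h => hyM (mem_sup_right h)
  have hle : zpowers y ⊔ M ∈ 𝒮 := by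
    refine ⟨h1.trans le_sup_right, sup_le (zpowers_le.mpr hy) h2, ?_⟩
    rw [zpowers_sup_inf ((hnorm M (le_sup_left.trans h1) h2) hy) (h1 (mem_sup_left (pow_mem_frat hy)))
      hyM, h3]
  exact hyM' (hmax hle le_sup_right (mem_sup_left (mem_zpowers y)))

/-- Proper nontrivial Sylow-invariant traces on a noncyclic chief factor are impossible for
subgroups with the `IC`-`Π`-property. -/
theorem ICPiProperty.false_of_inf_eq [Finite G] {p : ℕ} [hp : Fact p.Prime]
    {H K L L₀ : Subgroup G} (h : ICPiProperty H) (hH : IsPGroup p H) (hc : IsChiefFactor K L)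
    (hcyc : ¬ CyclicSection K L) (S : Sylow p G)
    (hS : (S : Subgroup G) ≤ normalizer (L₀ : Set G)) (hHL : H ⊓ L = L₀) (h0 : K < L₀)
    (hlt : L₀ < L) : False := by
  have hKH : K ≤ H := h0.le.trans (hHL ▸ inf_le_left)
  rcases h.inf_le_or_le hH hc hKH hcyc S (by rwa [hHL]) with h1 | h1
  · exact h0.not_ge (hHL ▸ h1)
  · rw [inf_eq_right.mpr h1] at hHL
    exact hlt.ne hHL.symm

/-- A Sylow-invariant hyperplane of a noncyclic chief factor `L / K`, where `L` is a
`p`-subgroup. -/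
theorem exists_hyperplane [Finite G] {p : ℕ} [hp : Fact p.Prime] {K L : Subgroup G}
    (hc : IsChiefFactor K L) (hL : IsPGroup p L) (hcyc : ¬ CyclicSection K L) (S : Sylow p G) :
    ∃ L₀, L₀ < L ∧ K < L₀ ∧ (S : Subgroup G) ≤ normalizer (L₀ : Set G) ∧
      Nat.card L = p * Nat.card L₀ := by
  have := hc.normal_top
  have := hc.normal_bot
  obtain ⟨n, hn⟩ := IsPGroup.iff_card.mp hL
  obtain ⟨m, hm⟩ := IsPGroup.iff_card.mp (hL.to_le hc.lt.le)
  have hmn : m < n := by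
    rw [← Nat.pow_lt_pow_iff_right hp.out.one_lt, ← hm, ← hn]
    exact Set.ncard_lt_ncard hc.lt
  -- A noncyclic factor has order at least `p ^ 2`, which leaves room for a hyperplane strictly
  -- above `K`.
  have hn2 : m + 2 ≤ n := by
    by_contra h
    obtain rfl : n = m + 1 := by lia
    refine hcyc (cyclicSection_of_relIndex_prime (p := p) hc.normal_bot ?_)
    have := relIndex_mul_relIndex ⊥ K L bot_le hc.lt.le
    rw [relIndex_bot_left, relIndex_bot_left, hm, hn, pow_succ] at this
    exact Nat.eq_of_mul_eq_mul_left (pow_pos hp.out.pos m) this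
  obtain ⟨C, hKC, hCL, hS, hC⟩ := exists_invariant_card_eq S.isPGroup' hc.lt.le
    (hL.le_sylow_of_normal S) le_normalizer_of_normal le_normalizer_of_normal (k := n - 1)
    (by rw [hm]; exact Nat.pow_le_pow_right hp.out.pos (by lia))
    (by rw [hn]; exact Nat.pow_le_pow_right hp.out.pos (by lia))
  have hcard : Nat.card L = p * Nat.card C := by
    rw [hn, hC, ← pow_succ']; congr 1; lia
  refine ⟨C, lt_of_le_of_ne hCL ?_, lt_of_le_of_ne hKC ?_, hS, hcard⟩
  · rintro rfl
    have := Nat.pow_right_injective hp.out.two_le (hn.symm.trans hC)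
    lia
  · rintro rfl
    have := Nat.pow_right_injective hp.out.two_le (hm.symm.trans hC)
    lia

/-- Supplements of `L` in `P` through all Sylow-invariant hyperplanes of a noncyclic chief factor
`L / K` contradict the `IC`-`Π`-property of the subgroups of `P` of order `p ^ k`. -/
theorem false_of_supplement [Finite G] {p : ℕ} [hp : Fact p.Prime] {P K L : Subgroup G} {k : ℕ}
    (hP : IsPGroup p P) (hc : IsChiefFactor K L) (hLP : L ≤ P)
    (hcyc : ¬ CyclicSection K L) (hLk : Nat.card L ≤ p ^ k) (hkP : p ^ k < Nat.card P)
    (hIC : ∀ H ≤ P, Nat.card H = p ^ k → ICPiProperty H) (S : Sylow p G)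
    (hM : ∀ L₀, K ≤ L₀ → L₀ ≤ L → (S : Subgroup G) ≤ normalizer (L₀ : Set G) →
      ∃ M, L₀ ≤ M ∧ M ≤ P ∧ L ⊔ M = P ∧ M ⊓ L = L₀) : False := by
  have hLn := hc.normal_top
  obtain ⟨L₀, hlt, h0, hS, hcard⟩ := exists_hyperplane hc (hP.to_le hLP) hcyc S
  obtain ⟨M, h1, h2, h3, h4⟩ := hM L₀ h0.le hlt.le hS
  obtain ⟨m, hm⟩ := IsPGroup.iff_card.mp hP
  -- Since `LM = P` and `M ∩ L = L₀`, the index of `M` in `P` equals that of the hyperplane `L₀` in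
  -- `L`.
  have hMcard : p * Nat.card M = Nat.card P := by
    have e1 := relIndex_mul_relIndex ⊥ L P bot_le hLP
    have e2 := relIndex_mul_relIndex ⊥ (L ⊓ M) M bot_le inf_le_right
    rw [inf_relIndex_right, inf_comm, h4, relIndex_bot_left, relIndex_bot_left] at e2
    rw [← h3, relIndex_sup_left, h3, relIndex_bot_left, relIndex_bot_left, hcard, mul_assoc,
      e2] at e1
    exact e1
  have hkM : p ^ k ≤ Nat.card M := by
    refine Nat.le_of_mul_le_mul_left (c := p) ?_ hp.out.pos
    rw [hMcard, hm, ← pow_succ']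
    rw [hm] at hkP
    exact Nat.pow_le_pow_right hp.out.pos ((Nat.pow_lt_pow_iff_right hp.out.one_lt).mp hkP)
  obtain ⟨H, hH1, hH2, hH3⟩ := exists_card_eq (hP.to_le h2) h1 (k := k)
    (((Nat.card_le_card_of_injective _ (inclusion_injective hlt.le))).trans hLk) hkM
  refine (hIC H (hH2.trans h2) hH3).false_of_inf_eq (hP.to_le (hH2.trans h2)) hc hcyc S hS ?_
    h0 hlt
  exact le_antisymm ((inf_le_inf_right L hH2).trans h4.le) (le_inf hH1 hlt.le)

/-- If all subgroups of the normal `p`-subgroup `P` of order `p ^ k` have the `IC`-`Π`-property,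
then a noncyclic minimal normal subgroup `L` of `P` of order at most `p ^ k < |P|` lies in the
Frattini subgroup of `P`. -/
theorem le_frat [Finite G] {p : ℕ} [hp : Fact p.Prime] {P L : Subgroup G} {k : ℕ}
    (hPn : P.Normal) (hP : IsPGroup p P) (hc : IsChiefFactor ⊥ L) (hLP : L ≤ P)
    (hcyc : ¬ CyclicSection ⊥ L) (hLk : Nat.card L ≤ p ^ k) (hkP : p ^ k < Nat.card P)
    (hIC : ∀ H ≤ P, Nat.card H = p ^ k → ICPiProperty H) : L ≤ frat p P := by
  obtain ⟨S⟩ : Nonempty (Sylow p G) := inferInstance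
  have hLn := hc.normal_top
  have hfn := frat_normal p hPn
  rcases hc.eq_or_eq (frat p P ⊓ L) inferInstance bot_le inf_le_right with h | h
  · exact (false_of_supplement hP hc hLP hcyc hLk hkP hIC S fun L₀ _ h2 _ =>
      exists_sup_eq_inf_eq hLP h h2).elim
  · exact inf_eq_right.mp h

/-- If the `p'`-element `a` acts trivially on `P / L`, where `L` is central in `P`, and on the
Frattini quotient of `P`, then it acts trivially on `P`. -/
theorem commute_of_le_frat {p : ℕ} {P L : Subgroup G}
    (hLP : L ≤ P)
    (hLZ : ∀ x ∈ L, ∀ y ∈ P, Commute x y) (hLp : ∀ x ∈ L, x ^ p = 1) {a : G}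
    (ha : (orderOf a).Coprime p) (haP : ∀ x ∈ P, ⁅x, a⁆ ∈ L)
    (haf : ∀ x ∈ P, ⁅x, a⁆ ∈ frat p P) : ∀ x ∈ P, ⁅x, a⁆ = 1 := by
  -- As `L` is central in `P`, commutation with `a` is a homomorphism into `L`. Its image is abelian
  -- of exponent dividing `p`, so it kills the Frattini subgroup and `[[x, a], a] = 1`.
  let φ : P →* L := MonoidHom.mk' (fun x => ⟨⁅(x : G), a⁆, haP x x.2⟩) (by
    intro x y
    apply Subtype.ext
    change ⁅(x : G) * y, a⁆ = ⁅(x : G), a⁆ * ⁅(y : G), a⁆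
    have h1 : ⁅(x : G) * y, a⁆ = x * ⁅(y : G), a⁆ * (x : G)⁻¹ * ⁅(x : G), a⁆ := by
      simp only [commutatorElement_def]; group
    rw [h1, ← (hLZ _ (haP y y.2) x x.2).eq, mul_inv_cancel_right,
      (hLZ _ (haP y y.2) _ (hLP (haP x x.2))).eq])
  have hker : frat p P ≤ φ.ker.map P.subtype := by
    refine sup_le (Subgroup.commutator_le.mpr fun x hx y hy => ?_) ((closure_le _).mpr ?_)
    · refine ⟨⁅(⟨x, hx⟩ : P), (⟨y, hy⟩ : P)⁆, ?_, rfl⟩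
      rw [SetLike.mem_coe, MonoidHom.mem_ker, map_commutatorElement,
        commutatorElement_eq_one_iff_commute]
      exact Subtype.ext (hLZ _ (φ _).2 _ (hLP (φ _).2)).eq
    · rintro _ ⟨x, hx, rfl⟩
      refine ⟨⟨x, hx⟩ ^ p, ?_, rfl⟩
      rw [SetLike.mem_coe, MonoidHom.mem_ker, map_pow]
      exact Subtype.ext (hLp _ (φ _).2)
  intro x hx
  refine mem_bot.mp (commutator_mem_of_coprime (p := p) (n := orderOf a) (m := 1)
    Subgroup.normal_bot (by rw [pow_orderOf_eq_one]; exact one_mem _) ha ?_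
    (by rw [pow_one, hLp _ (haP x hx)]; exact one_mem _))
  obtain ⟨y, hy, hyx⟩ := hker (haf x hx)
  rw [mem_bot, ← hyx]
  exact congrArg Subtype.val (MonoidHom.mem_ker.mp hy)

end MinimalNormal

end ICPi

/-! ### Class-two exclusions: `|L| = d`, and `|N : L| = 2` -/

namespace ICPi

open Subgroup
open scoped commutatorElement

section ClassTwo

variable {G : Type*} [Group G]

theorem mem_normalizer_of_commute {C : Subgroup G} {x : G} (h : ∀ c ∈ C, Commute c x) :
    x ∈ normalizer (C : Set G) :=
  centralizer_le_normalizer _ (mem_centralizer_iff.mpr fun c hc => h c hc)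

theorem commutatorElement_mul_left_of_central {a b x : G} (h : Commute a ⁅b, x⁆)
    (h' : Commute ⁅a, x⁆ ⁅b, x⁆) : ⁅a * b, x⁆ = ⁅a, x⁆ * ⁅b, x⁆ := by
  have h1 : ⁅a * b, x⁆ = a * ⁅b, x⁆ * a⁻¹ * ⁅a, x⁆ := by
    simp only [commutatorElement_def]; group
  rw [h1, h.eq, mul_inv_cancel_right, h'.eq]

/-- In a group of nilpotency class two, commutators with `x` in a given subgroup `Z` come from
a subgroup. -/
def commutatorSubgroup (P Z : Subgroup G) (x : G) (hx : x ∈ P)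
    (hP : ∀ a ∈ P, ∀ b ∈ P, ∀ c ∈ P, Commute a ⁅b, c⁆) : Subgroup G where
  carrier := {a | a ∈ P ∧ ⁅a, x⁆ ∈ Z}
  one_mem' := ⟨one_mem _, by simp⟩
  mul_mem' := by
    rintro a b ⟨ha, ha'⟩ ⟨hb, hb'⟩
    refine ⟨mul_mem ha hb, ?_⟩
    rw [commutatorElement_mul_left_of_central (hP a ha b hb x hx)
      (hP _ (commutator_le_self P (commutator_mem_commutator ha hx)) b hb x hx)]
    exact mul_mem ha' hb'
  inv_mem' := by
    rintro a ⟨ha, ha'⟩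
    refine ⟨inv_mem ha, ?_⟩
    have h1 := commutatorElement_mul_left_of_central (hP _ (inv_mem ha) a ha x hx)
      (hP _ (commutator_le_self P (commutator_mem_commutator (inv_mem ha) hx)) a ha x hx)
    rw [inv_mul_cancel, commutatorElement_one_left] at h1
    rw [eq_inv_of_mul_eq_one_left h1.symm]
    exact inv_mem ha'

/-- When `P` is generated by the central subgroup `L` and two elements, bilinearity of commutators
in class two leaves one generating commutator. -/
theorem commutator_le_zpowers {P L : Subgroup G}
    (hP : ∀ a ∈ P, ∀ b ∈ P, ∀ c ∈ P, Commute a ⁅b, c⁆) (hLP : L ≤ P)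
    (hL : ∀ a ∈ L, ∀ b ∈ P, Commute a b) {x y : G} (hx : x ∈ P) (hy : y ∈ P)
    (hgen : ∀ B : Subgroup G, L ≤ B → x ∈ B → y ∈ B → P ≤ B) : ⁅P, P⁆ ≤ zpowers ⁅y, x⁆ := by
  have hswap : ∀ a b : G, ⁅a, b⁆ ∈ zpowers ⁅y, x⁆ → ⁅b, a⁆ ∈ zpowers ⁅y, x⁆ := fun a b h => by
    exact commutatorElement_inv a b ▸ inv_mem h
  have hB : ∀ c ∈ P, ⁅x, c⁆ ∈ zpowers ⁅y, x⁆ → ⁅y, c⁆ ∈ zpowers ⁅y, x⁆ →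
      ∀ a ∈ P, ⁅a, c⁆ ∈ zpowers ⁅y, x⁆ := by
    intro c hc h1 h2 a ha
    refine (hgen (commutatorSubgroup P (zpowers ⁅y, x⁆) c hc hP) ?_ ⟨hx, h1⟩ ⟨hy, h2⟩ ha).2
    intro l hl
    refine ⟨hLP hl, ?_⟩
    rw [commutatorElement_eq_one_iff_commute.mpr (hL l hl c hc)]
    exact one_mem _
  have hyx : ⁅y, x⁆ ∈ zpowers ⁅y, x⁆ := mem_zpowers _
  rw [Subgroup.commutator_le]
  intro a ha b hb
  refine hB b hb (hswap _ _ (hB x hx ?_ hyx b hb)) (hswap _ _ (hB y hy ?_ ?_ b hb)) a ha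
  · rw [commutatorElement_self]; exact one_mem _
  · exact hswap _ _ hyx
  · rw [commutatorElement_self]; exact one_mem _

theorem mul_mem_of_relIndex_two {A B : Subgroup G} (h : A.relIndex B = 2) {u v : G} (hu : u ∈ B)
    (hv : v ∈ B) (hu' : u ∉ A) (hv' : v ∉ A) : u * v ∈ A := by
  have := mul_mem_iff_of_index_two (H := A.subgroupOf B) h (a := ⟨u, hu⟩) (b := ⟨v, hv⟩)
  exact this.mpr (by simp only [mem_subgroupOf]; exact iff_of_false hu' hv')

/-- Subgroups `P` with a noncyclic minimal normal subgroup `L` such that `P / L` is a chief factor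
and all subgroups of order `|L|` have the `IC`-`Π`-property do not exist. -/
theorem false_of_card_eq_minimal [Finite G] {p : ℕ} [hp : Fact p.Prime] {P L : Subgroup G}
    (hP : IsPGroup p P) (hc : IsChiefFactor ⊥ L) (hcP : IsChiefFactor L P)
    (hcyc : ¬ CyclicSection ⊥ L) (hIC : ∀ H ≤ P, Nat.card H = Nat.card L → ICPiProperty H) :
    False := by
  obtain ⟨S⟩ : Nonempty (Sylow p G) := inferInstance
  have hLn := hc.normal_top
  have hPn := hcP.normal_top
  have hLP := hcP.lt.le
  have hL := hP.to_le hLP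
  obtain ⟨L₀, hlt, h0, hS, hcard⟩ := exists_hyperplane hc hL hcyc S
  have hZ := hc.le_centralizer_of_isPGroup hP hPn hLP
  have hLp : ∀ x ∈ L, x ^ p = 1 := fun x hx =>
    mem_bot.mp (hc.pow_prime_mem (pSection_of_isPGroup hL) x hx)
  have hPp : ∀ x ∈ P, x ^ p ∈ L := hcP.pow_prime_mem (pSection_of_isPGroup hP)
  have hcomm : ∀ x ∈ P, ∀ y ∈ P, ⁅x, y⁆ ∈ L := fun x hx y hy =>
    hcP.commutator_le (pSection_of_isPGroup hP) (commutator_mem_commutator hx hy)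
  have hcent : ∀ a ∈ P, ∀ b ∈ P, ∀ c ∈ P, Commute a ⁅b, c⁆ := fun a ha b hb c hc =>
    (hZ _ (hcomm b hb c hc) a ha).symm
  -- Otherwise `⟨x⟩L₀` has order `p |L₀| = |L|` and meets `L` exactly in the hyperplane `L₀`.
  have key : ∀ x ∈ P, x ∉ L → x ^ p ∉ L₀ := by
    intro x hx hxL hxp
    have hn : x ∈ normalizer (L₀ : Set G) :=
      mem_normalizer_of_commute fun c hc => hZ c (hlt.le hc) x hx
    have h1 : zpowers x ⊔ L₀ ≤ P := sup_le (zpowers_le.mpr hx) (hlt.le.trans hLP)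
    refine (hIC _ h1 ?_).false_of_inf_eq (hP.to_le h1) hc hcyc S hS ?_ h0 hlt
    · rw [hcard, card_zpowers_sup hn (fun h => hxL (hlt.le h)) hxp]
    · rw [zpowers_sup_inf hn hxp (by rwa [sup_eq_left.mpr hlt.le]), inf_eq_left.mpr hlt.le]
  obtain ⟨x, hx, hxL⟩ := SetLike.exists_of_lt hcP.lt
  by_cases hgood : p ≠ 2 ∨ ∀ x ∈ P, ∀ y ∈ P, x * y = y * x
  · have hmul : ∀ x ∈ P, ∀ y ∈ P, (x * y) ^ p = x ^ p * y ^ p := by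
      intro x hx y hy
      rw [mul_pow_of_central (hcent x hx y hy x hx).symm (hcent y hy y hy x hx).symm,
        GoodExponent.commutator_pow (T := P) (Or.inl ⟨rfl, hgood⟩) hx hy
        (hcent y hy y hy x hx).symm (hZ _ (hPp y hy) x hx), mul_one]
    -- The image of the `p`-power homomorphism is normal and inside `L`. Being trivial contradicts
    -- `key` at `x`; being `L` contradicts it at a preimage of a nontrivial element of `L₀`.
    let φ : P →* G := MonoidHom.mk' (fun x => (x : G) ^ p) fun x y => hmul x x.2 y y.2
    have hn : φ.range.Normal := by
      refine ⟨?_⟩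
      rintro _ ⟨y, rfl⟩ g
      exact ⟨⟨g * y * g⁻¹, hPn.conj_mem y y.2 g⟩, conj_pow⟩
    have hle : φ.range ≤ L := by
      rintro _ ⟨y, rfl⟩
      exact hPp y y.2
    rcases hc.eq_or_eq _ hn bot_le hle with h | h
    · refine key x hx hxL ?_
      have : x ^ p ∈ φ.range := ⟨⟨x, hx⟩, rfl⟩
      rw [h, mem_bot] at this
      rw [this]
      exact one_mem _
    · obtain ⟨l, hl, hl1⟩ := (bot_or_exists_ne_one L₀).resolve_left h0.ne'
      have : l ∈ φ.range := h ▸ hlt.le hl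
      obtain ⟨y, rfl⟩ := this
      refine key y y.2 (fun hy => hl1 (hLp y hy)) hl
  · push Not at hgood
    obtain ⟨rfl, a, ha, b, hb, hab⟩ := hgood
    have hidx : L₀.relIndex L = 2 := by
      have := relIndex_mul_relIndex ⊥ L₀ L bot_le hlt.le
      rw [relIndex_bot_left, relIndex_bot_left, hcard, mul_comm] at this
      exact Nat.eq_of_mul_eq_mul_right Nat.card_pos this
    -- In `(uv)² = u²v²[v, u]` the two squares lie outside `L₀`, of index two in `L`, so their
    -- product is inside; the commutator must then be outside.
    have hstar : ∀ u ∈ P, ∀ v ∈ P, u ∉ L → v ∉ L → u * v ∉ L → ⁅v, u⁆ ∉ L₀ := by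
      intro u hu v hv huL hvL huv h
      refine key (u * v) (mul_mem hu hv) huv ?_
      rw [mul_pow_of_central (hcent u hu v hv u hu).symm (hcent v hv v hv u hu).symm,
        Nat.choose_self, pow_one]
      exact mul_mem (mul_mem_of_relIndex_two hidx (hPp u hu) (hPp v hv) (key u hu huL)
        (key v hv hvL)) h
    -- If `L`, `x`, `y` did not generate `P`, a further `w` would give `[yw, x] = [y, x][w, x]`, a
    -- product of two elements outside `L₀`, hence inside, against `hstar`.
    have hgen : ∃ y ∈ P, ∀ B : Subgroup G, L ≤ B → x ∈ B → y ∈ B → P ≤ B := by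
      by_cases hy : ∃ y ∈ P, y ∉ L ∧ x * y ∉ L
      · obtain ⟨y, hy, hyL, hxy⟩ := hy
        refine ⟨y, hy, fun B hLB hxB hyB w hw => ?_⟩
        by_contra hwB
        have h1 : w ∉ L := fun h => hwB (hLB h)
        have h2 : x * w ∉ L := fun h => hwB ((mul_mem_cancel_left hxB).mp (hLB h))
        have h3 : y * w ∉ L := fun h => hwB ((mul_mem_cancel_left hyB).mp (hLB h))
        have h4 : x * (y * w) ∉ L := fun h =>
          hwB ((mul_mem_cancel_left hyB).mp ((mul_mem_cancel_left hxB).mp (hLB h)))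
        refine hstar x hx (y * w) (mul_mem hy hw) hxL h3 h4 ?_
        rw [commutatorElement_mul_left_of_central (hcent y hy w hw x hx)
          (hcent _ (hLP (hcomm y hy x hx)) w hw x hx)]
        exact mul_mem_of_relIndex_two hidx (hcomm y hy x hx) (hcomm w hw x hx)
          (hstar x hx y hy hxL hyL hxy) (hstar x hx w hw hxL h1 h2)
      · push Not at hy
        refine ⟨1, one_mem _, fun B hLB hxB _ w hw => ?_⟩
        by_cases hwL : w ∈ L
        · exact hLB hwL
        · exact (mul_mem_cancel_left hxB).mp (hLB (hy w hw hwL))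
    obtain ⟨y, hy, hgen⟩ := hgen
    have h1 := commutator_le_zpowers hcent hLP hZ hx hy hgen
    rcases hc.eq_or_eq ⁅P, P⁆ inferInstance bot_le (hcP.commutator_le (pSection_of_isPGroup hP))
      with h | h
    · exact hab (commutatorElement_eq_one_iff_mul_comm.mp
        (mem_bot.mp (h ▸ commutator_mem_commutator ha hb)))
    · exact hcyc ⟨⁅y, x⁆, hcomm y hy x hx, by rw [← h]; exact h1.trans le_sup_left⟩

/-- The exceptional case `|N : L| = 2`: all squares of `P` lie in `L`. -/
theorem sq_mem_of_card_eq_two_mul [Finite G] {P N L : Subgroup G}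
    (hP : IsPGroup 2 P) (hc : IsChiefFactor ⊥ L) (hLN : L ≤ N) (hcP : IsChiefFactor N P)
    (hcyc : ¬ CyclicSection ⊥ L) (hN2 : L.relIndex N = 2)
    (hIC : ∀ H ≤ P, Nat.card H = 2 * Nat.card L → ICPiProperty H) : ∀ y ∈ P, y ^ 2 ∈ L := by
  have hp : Fact (Nat.Prime 2) := ⟨Nat.prime_two⟩
  obtain ⟨S⟩ : Nonempty (Sylow 2 G) := inferInstance
  have hLn := hc.normal_top
  have hNn := hcP.normal_bot
  have hPn := hcP.normal_top
  have hNP := hcP.lt.le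
  have hLP := hLN.trans hNP
  have hL := hP.to_le hLP
  obtain ⟨L₀, hlt, h0, hS, hcard⟩ := exists_hyperplane hc hL hcyc S
  have hZ := hc.le_centralizer_of_isPGroup hP hPn hLP
  have hLp : ∀ x ∈ L, x ^ 2 = 1 := fun x hx =>
    mem_bot.mp (hc.pow_prime_mem (pSection_of_isPGroup hL) x hx)
  have hNL : ∀ n ∈ N, n ^ 2 ∈ L := fun n hn => by
    by_cases h : n ∈ L
    · exact pow_mem h 2
    · rw [pow_two]; exact mul_mem_of_relIndex_two hN2 hn hn h h
  have hNsq : ∀ n ∈ N, n ^ 2 = 1 := by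
    intro n hn
    by_cases hnL : n ∈ L
    · exact hLp n hnL
    by_contra hne
    -- A conjugate of `n` is `l n` with `l ∈ L` central in `P` and `l² = 1`, so it has the same
    -- square. Then `⟨n²⟩` is normal, hence trivial or equal to `L`, which is noncyclic.
    have hfix : ∀ g : G, g * n ^ 2 * g⁻¹ = n ^ 2 := by
      intro g
      have hgN : g * n * g⁻¹ ∈ N := hNn.conj_mem n hn g
      have hgL : g * n * g⁻¹ ∉ L := fun h => hnL (by
        have := hLn.conj_mem _ h g⁻¹
        simpa [mul_assoc] using this)
      have hl := mul_mem_of_relIndex_two hN2 hgN (inv_mem hn) hgL (fun h => hnL (inv_mem_iff.mp h))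
      have h1 : g * n * g⁻¹ = (g * n * g⁻¹ * n⁻¹) * n := by group
      have h2 : Commute (g * n * g⁻¹ * n⁻¹) n := hZ _ hl n (hNP hn)
      rw [← conj_pow, h1, h2.mul_pow, hLp _ hl, one_mul]
    have hn2 : (zpowers (n ^ 2)).Normal := by
      refine ⟨?_⟩
      rintro _ ⟨i, rfl⟩ g
      exact ⟨i, by simp only; rw [← conj_zpow, hfix g]⟩
    rcases hc.eq_or_eq _ hn2 bot_le (zpowers_le.mpr (hNL n hn)) with h | h
    · exact hne (zpowers_eq_bot.mp h)
    · exact hcyc ⟨n ^ 2, hNL n hn, by rw [h]; exact le_sup_left⟩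
  intro y hy
  by_cases hyN : y ∈ N
  · rw [hNsq y hyN]; exact one_mem _
  by_contra hyL
  have hy2 : y ^ 2 ∈ N := hcP.pow_prime_mem (pSection_of_isPGroup hP) y hy
  have hy4 : (y ^ 2) ^ 2 ∈ L₀ := by rw [hNsq _ hy2]; exact one_mem _
  have hn1 : y ^ 2 ∈ normalizer (L₀ : Set G) :=
    mem_normalizer_of_commute fun c hc => hZ c (hlt.le hc) _ (pow_mem hy 2)
  set C := zpowers (y ^ 2) ⊔ L₀ with hC
  have hCN : C ≤ N := sup_le (zpowers_le.mpr hy2) (hlt.le.trans hLN)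
  have hn2 : y ∈ normalizer (C : Set G) := by
    refine mem_normalizer_of_commute fun c hc => ?_
    obtain ⟨_, ⟨i, rfl⟩, l, hl, rfl⟩ := exists_mul_of_mem_sup (zpowers_le.mpr hn1) hc
    exact (((Commute.refl y).pow_left 2).zpow_left i).mul_left (hZ l (hlt.le hl) y hy)
  have hy2C : y ^ 2 ∈ C := mem_sup_left (mem_zpowers _)
  have hCL : C ⊓ L = L₀ := by
    rw [hC, zpowers_sup_inf hn1 hy4 (by rwa [sup_eq_left.mpr hlt.le]), inf_eq_left.mpr hlt.le]
  -- Adjoining `y²` and then `y` to `L₀` doubles the order twice, to `4 |L₀| = 2 |L|`, without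
  -- enlarging the intersection with `L`.
  have h1 : zpowers y ⊔ C ≤ P := sup_le (zpowers_le.mpr hy) (hCN.trans hNP)
  refine (hIC _ h1 ?_).false_of_inf_eq (hP.to_le h1) hc hcyc S hS ?_ h0 hlt
  · rw [card_zpowers_sup hn2 (fun h => hyN (hCN h)) hy2C, hC,
      card_zpowers_sup hn1 (fun h => hyL (hlt.le h)) hy4, hcard]
  · rw [← hCL, ← inf_eq_right.mpr hLN, ← inf_assoc, zpowers_sup_inf hn2 hy2C
      (by rwa [sup_eq_left.mpr hCN]), inf_assoc]

end ClassTwo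

end ICPi

/-! ### The theorem for normal `p`-subgroups -/

namespace ICPi

open Subgroup
open scoped commutatorElement

universe u

/-- The assumptions of the main theorem on the subgroups of order `d` of a `p`-subgroup `P`. -/
structure OrderHypothesis {G : Type*} [Group G] (p d : ℕ) (P : Subgroup G) : Prop where
  isPGroup : IsPGroup p P
  exists_pow : ∃ k : ℕ, d = p ^ k
  one_lt : 1 < d
  lt_card : d < Nat.card P
  ic : ∀ H ≤ P, Nat.card H = d → ICPiProperty H
  ic_four : p = 2 → d = 2 → ¬ (∀ a ∈ P, ∀ b ∈ P, a * b = b * a) →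
    ∀ H ≤ P, IsCyclic H → Nat.card H = 4 → ICPiProperty H

section NormalPSubgroup

variable {G : Type*} [Group G]

theorem OrderHypothesis.mono {p d : ℕ} {P Q : Subgroup G} (h : OrderHypothesis p d P)
    (hQ : Q ≤ P) (hd : d < Nat.card Q) : OrderHypothesis p d Q where
  isPGroup := h.isPGroup.to_le hQ
  exists_pow := h.exists_pow
  one_lt := h.one_lt
  lt_card := hd
  ic H hH := h.ic H (hH.trans hQ)
  ic_four h2 hd2 hab H hH := h.ic_four h2 hd2
    (fun hc => hab fun a ha b hb => hc a (hQ ha) b (hQ hb)) H (hH.trans hQ)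

theorem OrderHypothesis.dvd {p d : ℕ} {P : Subgroup G}
    (h : OrderHypothesis p d P) : p ∣ d := by
  obtain ⟨k, rfl⟩ := h.exists_pow
  have := h.one_lt
  refine dvd_pow_self p ?_
  rintro rfl
  simp at this

theorem card_eq_mul_card_map [Finite G] {G' : Type*} [Group G'] (f : G →* G') {H : Subgroup G}
    (h : f.ker ≤ H) : Nat.card H = Nat.card f.ker * Nat.card (H.map f) := by
  have := relIndex_mul_relIndex ⊥ f.ker H bot_le h
  rw [relIndex_bot_left, relIndex_bot_left, relIndex_ker] at this
  exact this.symm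

/-- Subgroups of order `d` in the image pull back to subgroups of order `|ker f| d` containing the
kernel. The condition on cyclic subgroups of order four does not pull back this way; `hab` makes it
vacuous. -/
theorem OrderHypothesis.map_of_ker_le [Finite G] {p d : ℕ} [hp : Fact p.Prime] {P : Subgroup G}
    {G' : Type*} [Group G'] {f : G →* G'} (hf : Function.Surjective f)
    (h : OrderHypothesis p (Nat.card f.ker * d) P) (hker : f.ker ≤ P) (hd : 1 < d)
    (hab : p = 2 → d = 2 → ∀ a ∈ P.map f, ∀ b ∈ P.map f, a * b = b * a) :
    OrderHypothesis p d (P.map f) where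
  isPGroup := h.isPGroup.map f
  exists_pow := by
    obtain ⟨k, hk⟩ := h.exists_pow
    obtain ⟨j, -, hj⟩ := (Nat.dvd_prime_pow hp.out).mp (Dvd.intro_left _ hk)
    exact ⟨j, hj⟩
  one_lt := hd
  lt_card := by
    have := h.lt_card
    rw [card_eq_mul_card_map f hker] at this
    exact lt_of_mul_lt_mul_left this (Nat.zero_le _)
  ic H hH hHd := by
    have h1 : H.comap f ≤ P := by
      rw [← comap_map_eq_self hker]
      exact comap_mono hH
    have h2 : f.ker ≤ H.comap f := MonoidHom.ker_le_comap f H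
    have h3 : (H.comap f).map f = H := map_comap_eq_self_of_surjective hf H
    rw [← h3]
    exact (h.ic _ h1 (by rw [card_eq_mul_card_map f h2, h3, hHd])).map_of_ker_le hf h2
  ic_four h2 hd2 hn := absurd (hab h2 hd2) hn

/-- The group `⟨x⟩` extends inside `Q` to a subgroup of order `d`, unless `x` has order `4` and `d =
2`, where `ic_four` applies to `⟨x⟩` itself. -/
theorem exists_ic_of_mem [Finite G] {p d : ℕ} [hp : Fact p.Prime] {P Q : Subgroup G}
    (h : OrderHypothesis p d P) (hQP : Q ≤ P) (hd : d ≤ Nat.card Q) {x : G} (hx : x ∈ Q)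
    (hexp : x ^ p = 1 ∨ p = 2 ∧ x ^ 4 = 1 ∧ ¬ ∀ a ∈ P, ∀ b ∈ P, a * b = b * a) :
    ∃ H, x ∈ H ∧ H ≤ Q ∧ ICPiProperty H := by
  obtain ⟨k, rfl⟩ := h.exists_pow
  have hcase : orderOf x ≤ p ^ k → ∃ H, x ∈ H ∧ H ≤ Q ∧ ICPiProperty H := by
    intro ho
    obtain ⟨H, h1, h2, h3⟩ := exists_card_eq (h.isPGroup.to_le hQP) (zpowers_le.mpr hx)
      (k := k) (by rwa [Nat.card_zpowers]) hd
    exact ⟨H, h1 (mem_zpowers x), h2, h.ic H (h2.trans hQP) h3⟩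
  have hpk : p ≤ p ^ k := Nat.le_of_dvd (zero_lt_one.trans h.one_lt) h.dvd
  by_cases hxp : x ^ p = 1
  · exact hcase ((orderOf_le_of_pow_eq_one hp.out.pos hxp).trans hpk)
  obtain ⟨rfl, hx4, hab⟩ := hexp.resolve_left hxp
  have ho : orderOf x = 2 ^ 2 := orderOf_eq_prime_pow (by simpa using hxp) (by simpa using hx4)
  by_cases hk : 2 ≤ k
  · exact hcase (by rw [ho]; exact Nat.pow_le_pow_right (by lia) hk)
  · have hk1 : 2 ^ k = 2 := by
      have := h.one_lt
      interval_cases k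
      · simp at this
      · rfl
    refine ⟨zpowers x, mem_zpowers x, zpowers_le.mpr hx, h.ic_four rfl hk1 hab _
      (zpowers_le.mpr (hQP hx)) inferInstance ?_⟩
    rw [Nat.card_zpowers, ho]; rfl

/-- A Sylow-invariant subgroup of order `d` strictly between `N` and `P` is a forbidden trace on a
noncyclic `P / N`. -/
theorem IsChiefFactor.cyclicSection_of_card_lt [Finite G] {p d : ℕ} [hp : Fact p.Prime]
    {N P : Subgroup G} (h : OrderHypothesis p d P) (hc : IsChiefFactor N P)
    (hd : Nat.card N < d) : CyclicSection N P := by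
  by_contra hcyc
  obtain ⟨S⟩ : Nonempty (Sylow p G) := inferInstance
  have := hc.normal_bot
  have := hc.normal_top
  obtain ⟨k, rfl⟩ := h.exists_pow
  obtain ⟨C, hNC, hCP, hS, hC⟩ := exists_invariant_card_eq S.isPGroup' hc.lt.le
    (h.isPGroup.le_sylow_of_normal S) le_normalizer_of_normal le_normalizer_of_normal hd.le
    h.lt_card.le
  rcases (h.ic C hCP hC).inf_le_or_le (h.isPGroup.to_le hCP) hc hNC hcyc S
    (by rwa [inf_eq_left.mpr hCP]) with h1 | h1
  · rw [inf_eq_left.mpr hCP] at h1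
    have := le_antisymm hNC h1
    rw [← this] at hC
    exact hd.ne hC
  · have := le_antisymm hCP h1
    rw [this] at hC
    exact h.lt_card.ne' hC

theorem card_mul_relIndex (N P : Subgroup G) (h : N ≤ P) :
    Nat.card N * N.relIndex P = Nat.card P := by
  have := relIndex_mul_relIndex ⊥ N P bot_le h
  rwa [relIndex_bot_left, relIndex_bot_left] at this

end NormalPSubgroup

theorem cyclicBetween_of_orderHypothesis_aux {p : ℕ} [hp : Fact p.Prime] (n : ℕ) :
    ∀ {G : Type u} [Group G] [Finite G] {d : ℕ} {P : Subgroup G}, Nat.card P = n → P.Normal →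
      OrderHypothesis p d P → CyclicBetween p ⊥ P := by
  induction n using Nat.strong_induction_on with
  | _ n ih =>
  intro G _ _ d P hn hPn h
  have hP := h.isPGroup
  have hP1 : ⊥ < P := bot_lt_iff_ne_bot.mpr (by
    rintro rfl
    have := h.lt_card
    have := h.one_lt
    rw [card_bot] at *
    lia)
  obtain ⟨N, -, hc⟩ := exists_chiefFactor_le Subgroup.normal_bot hPn hP1
  have hNn := hc.normal_bot
  have hNP := hc.lt.le
  have hNcard : Nat.card N < Nat.card P := Set.ncard_lt_ncard hc.lt
  have hstar : d ≤ Nat.card N → CyclicBetween p ⊥ N → CyclicBetween p ⊥ P := fun hd hN =>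
    cyclicBetween_of_maximal hP hc hN fun x hx _ hexp =>
      exists_ic_of_mem h (sup_le (zpowers_le.mpr hx) hNP)
        (hd.trans (Nat.card_le_card_of_injective _ (inclusion_injective le_sup_right)))
        (mem_sup_left (mem_zpowers x)) hexp
  rcases lt_trichotomy (Nat.card N) d with hlt | heq | hgt
  -- Here `|P / N| = p`, so `|P| = p |N| ≤ d`, against `d < |P|`.
  · exfalso
    have h1 := hc.relIndex_of_cyclic (hc.cyclicSection_of_card_lt h hlt)
      ((pSection_of_isPGroup hP).dvd_relIndex hNn hc.lt)
    have h2 := card_mul_relIndex N P hNP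
    rw [h1] at h2
    obtain ⟨k, rfl⟩ := h.exists_pow
    obtain ⟨m, hm⟩ := IsPGroup.iff_card.mp (hP.to_le hNP)
    have h3 := h.lt_card
    rw [← h2, hm, ← pow_succ, Nat.pow_lt_pow_iff_right hp.out.one_lt] at h3
    rw [hm, Nat.pow_lt_pow_iff_right hp.out.one_lt] at hlt
    lia
  · by_contra hcon
    have hNcyc : ¬ CyclicBetween p ⊥ N := fun hN => hcon (hstar heq.ge hN)
    have hN1 : ⊥ < N := bot_lt_iff_ne_bot.mpr (by
      rintro rfl
      have := h.one_lt
      rw [card_bot] at heq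
      lia)
    obtain ⟨L, hLN, hcL⟩ := exists_le_chiefFactor Subgroup.normal_bot hNn hN1
    have hLn := hcL.normal_top
    have hLP := hLN.trans hNP
    have hL := hP.to_le hLP
    rcases eq_or_lt_of_le hLN with rfl | hLN'
    · refine false_of_card_eq_minimal hP hcL hc
        (fun hcy => hNcyc (cyclicBetween_of_chiefFactor hcL hcy)) fun H hH hHc => ?_
      exact h.ic H hH (hHc.trans heq)
    let f := QuotientGroup.mk' L
    have hf : Function.Surjective f := QuotientGroup.mk'_surjective L
    have hker : f.ker = L := QuotientGroup.ker_mk' L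
    set d' := L.relIndex N with hd'
    have hdd : Nat.card f.ker * d' = d := by
      rw [hker, ← heq]
      exact card_mul_relIndex L N hLN
    have hd'1 : 1 < d' := by
      have h1 : d' ≠ 0 := fun h0 => by
        have := h.one_lt
        rw [h0, mul_zero] at hdd
        lia
      have h2 : d' ≠ 1 := fun h1 => hLN'.not_ge (relIndex_eq_one.mp h1)
      lia
    have hLd : Nat.card L ≤ d := by
      rw [← hdd, hker]
      exact Nat.le_mul_of_pos_right _ (by lia)
    -- When `|N : L| = p`, the factor `N / L` is cyclic, so a cyclic `L` would make all factors of
    -- `N` cyclic.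
    have hLcyc : p = 2 → d' = 2 → ¬ CyclicSection ⊥ L := by
      intro h2 hd2 hcy
      refine hNcyc (cyclicBetween_trans hLn bot_le (cyclicBetween_of_chiefFactor hcL hcy) ?_ hLN)
      have h3 : CyclicSection L N := cyclicSection_of_relIndex_prime (p := p) hLn (by rw [h2, ← hd2])
      refine cyclicBetween_of_chiefFactor ⟨hLn, hNn, hLN', fun M hM h4 h5 => ?_⟩ h3
      have h6 := relIndex_mul_relIndex L M N h4 h5
      rw [← hd', hd2] at h6
      rcases (Nat.dvd_prime Nat.prime_two).mp (Dvd.intro _ h6) with h7 | h7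
      · exact Or.inl (le_antisymm (relIndex_eq_one.mp h7) h4)
      · rw [h7] at h6
        exact Or.inr (le_antisymm h5 (relIndex_eq_one.mp (by lia)))
    have hq : OrderHypothesis p d' (P.map f) := by
      refine OrderHypothesis.map_of_ker_le hf (by rwa [hdd]) (hker.le.trans hLP) hd'1 ?_
      rintro rfl hd2
      -- Now `d = 2 |L| > 2`, so nothing is known about cyclic subgroups of order four; instead `P /
      -- L` is abelian, having exponent dividing two.
      have hsq := sq_mem_of_card_eq_two_mul hP hcL hLN hc (hLcyc rfl hd2) hd2 fun H hH hHc =>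
        h.ic H hH (by rw [hHc, ← hdd, hker, hd2, mul_comm])
      have hsq' : ∀ a ∈ P.map f, a * a = 1 := by
        rintro _ ⟨a, ha, rfl⟩
        rw [← map_mul, ← pow_two]
        exact (QuotientGroup.eq_one_iff _).mpr (hsq a ha)
      intro a ha b hb
      have h1 := hsq' _ (mul_mem ha hb)
      have h2 : a * b = (a * b)⁻¹ := eq_inv_of_mul_eq_one_left h1
      rw [h2, mul_inv_rev, ← eq_inv_of_mul_eq_one_left (hsq' a ha),
        ← eq_inv_of_mul_eq_one_left (hsq' b hb)]
    have hLP' : CyclicBetween p L P := by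
      have h1 : CyclicBetween p ⊥ (P.map f) := by
        refine ih _ ?_ rfl (hPn.map f hf) hq
        rw [← hn, card_eq_mul_card_map f (hker.le.trans hLP), hker]
        refine lt_mul_of_one_lt_left Nat.card_pos ?_
        exact (one_lt_card_iff_ne_bot L).mpr hcL.lt.ne'
      rw [← hker]
      exact cyclicBetween_of_map hf h1
    by_cases hcy : CyclicSection ⊥ L
    · exact hcon (cyclicBetween_trans hLn bot_le (cyclicBetween_of_chiefFactor hcL hcy) hLP' hLP)
    obtain ⟨k, hk⟩ := h.exists_pow
    have hLf : L ≤ frat p P := le_frat hPn hP hcL hLP hcy (hk ▸ hLd) (hk ▸ h.lt_card)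
      (fun H hH hHk => h.ic H hH (hHk.trans hk.symm))
    -- The `p'`-elements generating `primeResidual` centralise `P / L`, hence `P / Φ(P)` because `L
    -- ≤ Φ(P)`, hence `P`.
    have hPA := hLP'.commutator_primeResidual_le hLn hPn hLP (pSection_of_isPGroup hP)
    refine hcon (cyclicBetween_of_commutator_le (pSection_of_isPGroup hP)
      (commutator_primeResidual_le Subgroup.normal_bot fun a ha hap x hx => mem_bot.mpr ?_))
    have haL : ∀ x ∈ P, ⁅x, a⁆ ∈ L := fun x hx =>
      hPA (commutator_mem_commutator hx (subset_closure ⟨ha, hap⟩))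
    exact commute_of_le_frat hLP (hcL.le_centralizer_of_isPGroup hP hPn hLP)
      (fun x hx => mem_bot.mp (hcL.pow_prime_mem (pSection_of_isPGroup hL) x hx)) hap
      haL (fun x hx => hLf (haL x hx)) x hx
  · exact hstar hgt.le (ih _ (hn ▸ hNcard) rfl hNn (h.mono hNP hgt))

/-- Normal `p`-subgroups satisfying the order hypothesis have only cyclic chief factors. -/
theorem OrderHypothesis.cyclicBetween {p : ℕ} [Fact p.Prime] {G : Type*} [Group G] [Finite G]
    {d : ℕ} {P : Subgroup G} (h : OrderHypothesis p d P) (hP : P.Normal) : CyclicBetween p ⊥ P :=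
  cyclicBetween_of_orderHypothesis_aux _ rfl hP h

end ICPi

/-! ### Fusion and a Frobenius-type criterion for perfect groups -/

namespace ICPi

open Subgroup
open scoped commutatorElement Pointwise

section Fusion

variable {G : Type*} [Group G]

theorem IsPGroup.frat_lt [Finite G] {p : ℕ} [hp : Fact p.Prime] {T : Subgroup G}
    (hT : IsPGroup p T) (hT1 : T ≠ ⊥) : frat p T < T := by
  have hlt : (⊥ : Subgroup T) < ⊤ := by
    rw [bot_lt_iff_ne_bot]
    intro h
    refine hT1 ((Subgroup.eq_bot_iff_forall T).mpr fun x hx => ?_)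
    have : (⟨x, hx⟩ : T) ∈ (⊤ : Subgroup T) := mem_top _
    rw [h, mem_bot] at this
    exact congrArg Subtype.val this
  obtain ⟨N, -, hc⟩ := exists_chiefFactor_le Subgroup.normal_bot Subgroup.normal_top hlt
  have hps : PSection p N (⊤ : Subgroup T) := pSection_of_isPGroup (hT.to_subgroup ⊤)
  have hle : frat p T ≤ N.map T.subtype := by
    refine sup_le (Subgroup.commutator_le.mpr fun x hx y hy => ?_) ((closure_le _).mpr ?_)
    · exact ⟨⁅(⟨x, hx⟩ : T), (⟨y, hy⟩ : T)⁆,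
        hc.commutator_le hps (commutator_mem_commutator (mem_top _) (mem_top _)), rfl⟩
    · rintro _ ⟨x, hx, rfl⟩
      exact ⟨(⟨x, hx⟩ : T) ^ p, hc.pow_prime_mem hps _ (mem_top _), rfl⟩
  refine lt_of_le_of_ne (frat_le p T) fun h => hc.lt.not_ge fun x _ => ?_
  have hx : (x : G) ∈ N.map T.subtype := hle (h.symm ▸ x.2)
  obtain ⟨y, hy, hyx⟩ := hx
  rwa [← Subtype.ext hyx]

theorem conj_mem_frat {p : ℕ} {T : Subgroup G} {a : G} (ha : ∀ t ∈ T, a * t * a⁻¹ ∈ T) :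
    ∀ x ∈ frat p T, a * x * a⁻¹ ∈ frat p T := by
  have h : frat p T ≤ (frat p T).comap (MulAut.conj a).toMonoidHom := by
    refine sup_le (Subgroup.commutator_le.mpr fun x hx y hy => ?_) ((closure_le _).mpr ?_)
    · rw [mem_comap, map_commutatorElement]
      exact commutator_le_frat p T (commutator_mem_commutator (ha x hx) (ha y hy))
    · rintro _ ⟨x, hx, rfl⟩
      rw [SetLike.mem_coe, mem_comap, map_pow]
      exact pow_mem_frat (ha x hx)
  exact fun x hx => h hx

theorem zpow_conj_mem [Finite G] {T : Subgroup G} {a : G} (ha : ∀ t ∈ T, a * t * a⁻¹ ∈ T) :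
    ∀ b ∈ zpowers a, ∀ t ∈ T, b * t * b⁻¹ ∈ T := by
  intro b hb t ht
  rw [← mem_powers_iff_mem_zpowers] at hb
  obtain ⟨n, rfl⟩ := hb
  simp only
  induction n with
  | zero => simpa using ht
  | succ n ih =>
    have : a ^ (n + 1) * t * (a ^ (n + 1))⁻¹ = a * (a ^ n * t * (a ^ n)⁻¹) * a⁻¹ := by
      rw [pow_succ']; group
    rw [this]
    exact ha _ ih

/-- A `p'`-element that normalises a `p`-subgroup `T` and centralises its elements of exponent
`p` (or `4`) centralises `T`. -/
theorem commute_of_coprime_of_pow [Finite G] {p n : ℕ} [hp : Fact p.Prime] {a : G}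
    (hap : (orderOf a).Coprime p) : ∀ T : Subgroup G, IsPGroup p T → GoodExponent p n T →
      (∀ t ∈ T, a * t * a⁻¹ ∈ T) → (∀ t ∈ T, t ^ n = 1 → Commute t a) → ∀ t ∈ T, Commute t a := by
  intro T
  induction T using WellFoundedLT.induction with
  | ind T ih =>
  intro hT hn ha hcent
  by_contra hcon
  have hsub : ∀ D < T, (∀ t ∈ D, a * t * a⁻¹ ∈ D) → ∀ t ∈ D, Commute t a := by
    intro D hD haD
    refine ih D hD (hT.to_le hD.le) ?_ haD fun t ht => hcent t (hD.le ht)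
    rcases hn with ⟨h1, h2 | h2⟩ | h
    · exact Or.inl ⟨h1, Or.inl h2⟩
    · exact Or.inl ⟨h1, Or.inr fun x hx y hy => h2 x (hD.le hx) y (hD.le hy)⟩
    · exact Or.inr h
  have hcomm : ∀ D : Subgroup G, (∀ t ∈ D, Commute t a) → ∀ t ∈ D, ∀ b ∈ zpowers a,
      Commute t b := by
    rintro D hD t ht _ ⟨i, rfl⟩
    exact (hD t ht).zpow_right i
  set A := zpowers a with hA
  have hAT := zpow_conj_mem ha
  have hAN : A ≤ normalizer (T : Set G) := by
    intro b hb
    rw [mem_normalizer_iff]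
    intro t
    refine ⟨fun ht => hAT b hb t ht, fun ht => ?_⟩
    have := hAT b⁻¹ (inv_mem hb) _ ht
    simpa [mul_assoc] using this
  have hle : ⁅T, A⁆ ≤ T := by
    rw [Subgroup.commutator_le]
    intro t ht b hb
    have : ⁅t, b⁆ = t * (b * t⁻¹ * b⁻¹) := by rw [commutatorElement_def]; group
    rw [this]
    exact mul_mem ht (hAT b hb _ (inv_mem ht))
  -- Were `[T, A]` proper, minimality of `T` would make `a` centralise it, and coprime action would
  -- make `a` centralise `T`.
  have htop : T ≤ ⁅T, A⁆ := by
    by_contra h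
    have hlt : ⁅T, A⁆ < T := lt_of_le_of_ne hle fun h' => h h'.ge
    have hC := hsub _ hlt fun t ht => by
      have h1 := normalizer_commutator_ge_right T A (mem_zpowers a)
      exact (mem_normalizer_iff.mp h1 t).mp ht
    refine hcon fun t ht => ?_
    have hta : ⁅t, a⁆ ∈ ⁅T, A⁆ := commutator_mem_commutator ht (mem_zpowers a)
    obtain ⟨m, hm⟩ := pSection_of_isPGroup (K := ⊥) hT _ (hle hta)
    refine commutatorElement_eq_one_iff_commute.mp (mem_bot.mp (commutator_mem_of_coprime
      (p := p) (n := orderOf a) (m := m) Subgroup.normal_bot ?_ hap ?_ hm))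
    · rw [pow_orderOf_eq_one]; exact one_mem _
    · rw [mem_bot, commutatorElement_eq_one_iff_commute]; exact hC _ hta
  have hT1 : T ≠ ⊥ := by
    rintro rfl
    refine hcon fun t ht => ?_
    rw [mem_bot.mp ht]
    exact Commute.one_left a
  have hE := hcomm _ (hsub _ (IsPGroup.frat_lt hT hT1) (conj_mem_frat ha))
  have hET : ∀ e ∈ frat p T, ∀ t ∈ T, Commute e t := by
    have hEA : ⁅frat p T, A⁆ = ⊥ := by
      rw [eq_bot_iff, Subgroup.commutator_le]
      intro e he b hb
      exact mem_bot.mpr (commutatorElement_eq_one_iff_commute.mpr (hE e he b hb))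
    have hETle : ⁅frat p T, T⁆ ≤ frat p T :=
      (commutator_mono (frat_le p T) le_rfl).trans (commutator_le_frat p T)
    have h1 : ⁅⁅T, A⁆, frat p T⁆ = ⊥ := by
      apply commutator_commutator_eq_bot_of_rotate
      · rw [commutator_comm A, hEA, commutator_bot_left]
      · exact le_bot_iff.mp ((commutator_mono hETle le_rfl).trans hEA.le)
    intro e he t ht
    exact (commute_of_commutator_le_bot h1.le t (htop ht) e he).symm
  refine hcon fun t ht => hcent t ht (pow_eq_one_of_le_commutator hn htop hE hET
    (fun x hx y hy => commutator_le_frat p T (commutator_mem_commutator hx hy))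
    (fun x hx => pow_mem_frat hx) hAT t ht)

theorem exists_pow_coprime [Finite G] {p : ℕ} [hp : Fact p.Prime] (x : G) :
    ∃ n, (orderOf (x ^ p ^ n)).Coprime p := by
  obtain ⟨n, m, hm, h⟩ := Nat.exists_eq_pow_mul_and_not_dvd (orderOf_pos x).ne' p hp.out.ne_one
  refine ⟨n, ?_⟩
  rw [orderOf_pow_of_dvd (pow_ne_zero n hp.out.ne_zero) (h ▸ Dvd.intro _ rfl), h,
    Nat.mul_div_cancel_left _ (pow_pos hp.out.pos n)]
  exact ((Nat.Prime.coprime_iff_not_dvd hp.out).mpr hm).symm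

/-- By `h` the quotient of the normaliser of `D` by its centraliser is a `p`-group, so it is covered
by any Sylow `p`-subgroup. -/
theorem exists_mul_sylow_normalizer [Finite G] {p : ℕ} [hp : Fact p.Prime] {D : Subgroup G}
    (h : ∀ a ∈ normalizer (D : Set G), (orderOf a).Coprime p → a ∈ centralizer (D : Set G))
    (T : Sylow p (normalizer (D : Set G))) (x : normalizer (D : Set G)) :
    ∃ c : normalizer (D : Set G), (c : G) ∈ centralizer (D : Set G) ∧ ∃ t ∈ T, x = c * t := by
  set K := (centralizer (D : Set G)).subgroupOf (normalizer (D : Set G)) with hK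
  have hps : PSection p K ⊤ := by
    intro y _
    obtain ⟨n, hn⟩ := exists_pow_coprime (p := p) y
    refine ⟨n, h _ (y ^ p ^ n).2 ?_⟩
    rwa [orderOf_injective _ (normalizer (D : Set G)).subtype_injective]
  have hKn : K.Normal := by
    rw [hK]
    infer_instance
  obtain ⟨n, hn⟩ := hps.exists_relIndex hKn
  rw [relIndex_top_right] at hn
  obtain ⟨q, hq, k, hk, he⟩ := exists_eq_mul_of_coprime_index (Q := (T : Subgroup _)) (N := K)
    (by rw [hn]; exact Nat.Coprime.pow_left _ ((Nat.Prime.coprime_iff_not_dvd hp.out).mpr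
      T.not_dvd_index)) x⁻¹
  refine ⟨k⁻¹, inv_mem hk, q⁻¹, inv_mem hq, ?_⟩
  rw [← mul_inv_rev, ← he, inv_inv]

theorem IsPGroup.lt_inf_normalizer [Finite G] {p : ℕ} [hp : Fact p.Prime] {D P : Subgroup G}
    (hP : IsPGroup p P) (h : D < P) : D < P ⊓ normalizer (D : Set G) := by
  have := hP.isNilpotent
  have h1 : D.subgroupOf P < ⊤ := lt_top_iff_ne_top.mpr fun h' =>
    h.not_ge (subgroupOf_eq_top.mp h')
  obtain ⟨x, hx, hxD⟩ := SetLike.exists_of_lt (Group.normalizerCondition_of_isNilpotent _ h1)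
  refine lt_of_le_of_ne (le_inf h.le le_normalizer) fun he => hxD ?_
  change (x : G) ∈ D
  rw [he]
  refine ⟨x.2, mem_normalizer_iff.mpr fun y => ⟨fun hy => ?_, fun hy => ?_⟩⟩
  · exact (mem_normalizer_iff.mp hx ⟨y, h.le hy⟩).mp hy
  · have hyP : y ∈ P := by
      have := mul_mem (mul_mem (inv_mem x.2) (h.le hy)) x.2
      simpa [mul_assoc] using this
    exact (mem_normalizer_iff.mp hx ⟨y, hyP⟩).mpr hy

/-- A simple form of Alperin's fusion theorem, by downward induction on `D = P ∩ Q`. Both `P ∩ N(D)`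
and `Q ∩ N(D)` exceed `D`. Sylow subgroups of `N(D)` above them are conjugate by some `ct` with `c ∈
C(D)` and `t` in the first, so `c` alone suffices, and induction links `P` to `R` and `c • R` to
`Q`. -/
theorem exists_centralizer_smul_eq [Finite G] {p : ℕ} [hp : Fact p.Prime]
    (h : ∀ D : Subgroup G, IsPGroup p D → ∀ a ∈ normalizer (D : Set G), (orderOf a).Coprime p →
      a ∈ centralizer (D : Set G)) (n : ℕ) :
    ∀ P Q : Sylow p G, Nat.card G - Nat.card (P ⊓ Q : Subgroup G) ≤ n →
      ∃ c ∈ centralizer ((P ⊓ Q : Subgroup G) : Set G), c • P = Q := by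
  induction n with
  | zero =>
    intro P Q hn
    have h1 : (P ⊓ Q : Subgroup G) = ⊤ :=
      eq_top_of_card_eq _ (le_antisymm (card_le_card_group _) (by lia))
    refine ⟨1, one_mem _, ?_⟩
    rw [one_smul]
    refine Sylow.ext ?_
    rw [top_le_iff.mp (h1.ge.trans inf_le_left), top_le_iff.mp (h1.ge.trans inf_le_right)]
  | succ n ih =>
    intro P Q hn
    set D : Subgroup G := P ⊓ Q with hD
    have hDp : IsPGroup p D := P.isPGroup'.to_le inf_le_left
    by_cases hPQ : P = Q
    · exact ⟨1, one_mem _, by rw [one_smul, hPQ]⟩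
    have hDP : D < P := lt_of_le_of_ne inf_le_left fun he =>
      hPQ (Sylow.ext (P.is_maximal' Q.isPGroup' (inf_eq_left.mp he)).symm)
    have hDQ : D < Q := lt_of_le_of_ne inf_le_right fun he =>
      hPQ (Sylow.ext (Q.is_maximal' P.isPGroup' (inf_eq_right.mp he)))
    have key : ∀ R R' : Sylow p G, D < (R ⊓ R' : Subgroup G) → ∃ c ∈ centralizer (D : Set G), c • R = R' := by
      intro R R' hlt
      have hcard : Nat.card D < Nat.card (R ⊓ R' : Subgroup G) := Set.ncard_lt_ncard hlt
      obtain ⟨c, hc, he⟩ := ih R R' (by lia)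
      exact ⟨c, centralizer_le hlt.le hc, he⟩
    obtain ⟨T₁, hT₁⟩ := (P.isPGroup'.to_le (inf_le_left : (P : Subgroup G) ⊓
      normalizer (D : Set G) ≤ P)).comap_subtype (K := normalizer (D : Set G)) |>.exists_le_sylow
    obtain ⟨T₂, hT₂⟩ := (Q.isPGroup'.to_le (inf_le_left : (Q : Subgroup G) ⊓
      normalizer (D : Set G) ≤ Q)).comap_subtype (K := normalizer (D : Set G)) |>.exists_le_sylow
    obtain ⟨R, hR⟩ := (T₁.isPGroup'.map (normalizer (D : Set G)).subtype).exists_le_sylow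
    obtain ⟨x, hx⟩ := MulAction.exists_smul_eq (normalizer (D : Set G)) T₁ T₂
    obtain ⟨c, hc, t, ht, rfl⟩ := exists_mul_sylow_normalizer (h D hDp) T₁ x
    obtain ⟨c₁, hc₁, he₁⟩ := key P R ((IsPGroup.lt_inf_normalizer P.isPGroup' hDP).trans_le
      fun y hy => ⟨hy.1, hR ⟨⟨y, hy.2⟩, hT₁ hy, rfl⟩⟩)
    have hQR : (Q : Subgroup G) ⊓ normalizer (D : Set G) ≤ ((((c : G) • R : Sylow p G) : Subgroup G) ⊓ Q) := by
      refine fun y hy => ⟨?_, hy.1⟩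
      have h1 : (⟨y, hy.2⟩ : normalizer (D : Set G)) ∈ T₂ := hT₂ hy
      have h3 : t • T₁ = T₁ := Sylow.smul_eq_iff_mem_normalizer.mpr (le_normalizer ht)
      rw [← hx, mul_smul, h3] at h1
      change _ ∈ MulAut.conj c • (T₁ : Subgroup (normalizer (D : Set G))) at h1
      rw [mem_pointwise_smul_iff_inv_smul_mem] at h1
      change y ∈ MulAut.conj (c : G) • (R : Subgroup G)
      rw [mem_pointwise_smul_iff_inv_smul_mem]
      exact hR ⟨_, h1, rfl⟩
    obtain ⟨c₂, hc₂, he₂⟩ := key ((c : G) • R) Q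
      ((IsPGroup.lt_inf_normalizer Q.isPGroup' hDQ).trans_le hQR)
    refine ⟨c₂ * (c * c₁), mul_mem hc₂ (mul_mem hc hc₁), ?_⟩
    rw [mul_smul, mul_smul, he₁, he₂]

/-- A perfect group in which `p'`-elements centralise the `p`-subgroups they normalise is a
`p'`-group. -/
theorem not_dvd_card_of_isPerfect [Finite G] {p : ℕ} [hp : Fact p.Prime] (hG : Group.IsPerfect G)
    (h : ∀ D : Subgroup G, IsPGroup p D → ∀ a ∈ normalizer (D : Set G), (orderOf a).Coprime p →
      a ∈ centralizer (D : Set G)) : ¬ p ∣ Nat.card G := by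
  obtain ⟨P⟩ : Nonempty (Sylow p G) := inferInstance
  -- If `x` and `u x u⁻¹` lie in `P`, fusion replaces `u` by an element of `P`, so `[x, u] ∈ P'`.
  -- The focal subgroup theorem then gives `P = P'` in a perfect group.
  have hfoc : focalSubgroup (P : Subgroup G) ≤ ⁅(P : Subgroup G), (P : Subgroup G)⁆ := by
    rw [focalSubgroup_def, closure_le]
    rintro _ ⟨hg, x, hx, u, rfl⟩
    have hux : u * x⁻¹ * u⁻¹ ∈ P := by
      have : u * x⁻¹ * u⁻¹ = x⁻¹ * ⁅x, u⁆ := by rw [commutatorElement_def]; group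
      rw [this]; exact mul_mem (inv_mem hx) hg
    obtain ⟨c, hc, he⟩ := exists_centralizer_smul_eq h _ P (u⁻¹ • P) le_rfl
    have hxc : Commute x⁻¹ c := by
      refine mem_centralizer_iff.mp hc _ ⟨inv_mem (S := Subgroup G) hx, ?_⟩
      change x⁻¹ ∈ MulAut.conj u⁻¹ • (P : Subgroup G)
      rw [mem_pointwise_smul_iff_inv_smul_mem]
      have h4 : (MulAut.conj u⁻¹)⁻¹ • x⁻¹ = u * x⁻¹ * u⁻¹ := by simp [mul_assoc]
      rw [h4]
      exact hux
    have hN : u * c ∈ normalizer ((P : Subgroup G) : Set G) := by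
      refine Sylow.smul_eq_iff_mem_normalizer.mp ?_
      rw [mul_smul, he, smul_inv_smul]
    obtain ⟨k, hk, t, ht, hkt⟩ := exists_mul_sylow_normalizer (h P P.isPGroup')
      (P.subtype le_normalizer) ⟨u * c, hN⟩⁻¹
    have hkt' : u * c = (t : G)⁻¹ * (k : G)⁻¹ := by
      have h1 : (u * c)⁻¹ = (k : G) * t := congrArg Subtype.val hkt
      rw [← mul_inv_rev, ← h1, inv_inv]
    have htP : (t : G) ∈ P := ht
    have hxk : Commute x⁻¹ (k : G)⁻¹ :=
      (mem_centralizer_iff.mp (inv_mem hk) _ (inv_mem hx) : x⁻¹ * (k : G)⁻¹ = (k : G)⁻¹ * x⁻¹)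
    have h2 : u * x⁻¹ * u⁻¹ = (t : G)⁻¹ * x⁻¹ * t := by
      calc u * x⁻¹ * u⁻¹ = u * (x⁻¹ * c) * (u * c)⁻¹ := by group
        _ = (u * c) * x⁻¹ * (u * c)⁻¹ := by rw [hxc.eq]; group
        _ = (t : G)⁻¹ * ((k : G)⁻¹ * x⁻¹) * k * t := by rw [hkt']; group
        _ = (t : G)⁻¹ * x⁻¹ * t := by rw [← hxk.eq]; group
    have h3 : ⁅x, u⁆ = ⁅x, (t : G)⁻¹⁆ := by
      calc ⁅x, u⁆ = x * (u * x⁻¹ * u⁻¹) := by rw [commutatorElement_def]; group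
        _ = ⁅x, (t : G)⁻¹⁆ := by rw [h2, commutatorElement_def]; group
    rw [h3]
    exact commutator_mem_commutator hx (inv_mem htP)
  have h1 : commutator G ⊓ (P : Subgroup G) = focalSubgroup (P : Subgroup G) := by
    exact commutator_inf_eq_focalSubgroup P
  rw [hG.commutator_eq_top, top_inf_eq] at h1
  have h2 : (P : Subgroup G) ≤ ⁅(P : Subgroup G), (P : Subgroup G)⁆ := h1.le.trans hfoc
  intro hdvd
  have hP1 : (P : Subgroup G) ≠ ⊥ := P.ne_bot_of_dvd_card hdvd
  exact (IsPGroup.frat_lt P.isPGroup' hP1).not_ge (h2.trans (commutator_le_frat p _))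

end Fusion

end ICPi

/-! ### Perfect normal subgroups -/

namespace ICPi

open Subgroup
open scoped commutatorElement

section Perfect

variable {G : Type*} [Group G]

theorem exists_greatest [Finite G] {Φ : Subgroup G → Prop} {A : Subgroup G} (h0 : Φ A)
    (hsup : ∀ B C, Φ B → Φ C → Φ (B ⊔ C)) : ∃ V, Φ V ∧ ∀ R, Φ R → R ≤ V := by
  obtain ⟨V, hV⟩ := (Set.toFinite {V | Φ V}).exists_maximal ⟨A, h0⟩
  exact ⟨V, hV.1, fun R hR => le_sup_right.trans (hV.2 (hsup V R hV.1 hR) le_sup_left)⟩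

theorem PSection.sup {p : ℕ} {O A B : Subgroup G} (hA' : A.Normal) (hOA : O ≤ A)
    (hA : PSection p O A) (hB : PSection p O B) : PSection p O (A ⊔ B) := by
  intro x hx
  obtain ⟨a, ha, b, hb, rfl⟩ := mem_sup_of_normal_left.mp hx
  obtain ⟨n, hn⟩ := hB b hb
  have h1 : (a * b) ^ p ^ n ∈ A := by
    rw [← QuotientGroup.eq_one_iff, QuotientGroup.mk_pow, QuotientGroup.mk_mul,
      (QuotientGroup.eq_one_iff a).mpr ha, one_mul, ← QuotientGroup.mk_pow]
    exact (QuotientGroup.eq_one_iff _).mpr (hOA hn)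
  obtain ⟨m, hm⟩ := hA _ h1
  exact ⟨n + m, by rwa [pow_add, pow_mul]⟩

theorem not_dvd_relIndex_sup {p : ℕ} [hp : Fact p.Prime] {O A B : Subgroup G} (hA' : A.Normal)
    (hOA : O ≤ A) (hA : ¬ p ∣ O.relIndex A) (hB : ¬ p ∣ O.relIndex B) :
    ¬ p ∣ O.relIndex (A ⊔ B) := by
  rw [← relIndex_mul_relIndex O A (A ⊔ B) hOA le_sup_left, relIndex_sup_left, hp.out.dvd_mul]
  rintro (h | h)
  · exact hA h
  · exact hB (h.trans (relIndex_dvd_of_le_left B hOA))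

theorem exists_greatest_pSection [Finite G] (p : ℕ) {O N : Subgroup G} (hO : O.Normal)
    (hON : O ≤ N) : ∃ V, V.Normal ∧ O ≤ V ∧ V ≤ N ∧ PSection p O V ∧
      ∀ R : Subgroup G, R.Normal → O ≤ R → R ≤ N → PSection p O R → R ≤ V := by
  obtain ⟨V, ⟨h1, h2, h3, h4⟩, h5⟩ := exists_greatest
    (Φ := fun R : Subgroup G => R.Normal ∧ O ≤ R ∧ R ≤ N ∧ PSection p O R) (A := O)
    ⟨hO, le_rfl, hON, fun x hx => ⟨0, by simpa using hx⟩⟩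
    fun B C ⟨hB1, hB2, hB3, hB4⟩ ⟨hC1, hC2, hC3, hC4⟩ =>
      ⟨inferInstance, hB2.trans le_sup_left, sup_le hB3 hC3, hB4.sup hB1 hB2 hC4⟩
  exact ⟨V, h1, h2, h3, h4, fun R r1 r2 r3 r4 => h5 R ⟨r1, r2, r3, r4⟩⟩

theorem exists_greatest_not_dvd [Finite G] (p : ℕ) [hp : Fact p.Prime] {O N : Subgroup G}
    (hO : O.Normal) (hON : O ≤ N) : ∃ V, V.Normal ∧ O ≤ V ∧ V ≤ N ∧ ¬ p ∣ O.relIndex V ∧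
      ∀ R : Subgroup G, R.Normal → O ≤ R → R ≤ N → ¬ p ∣ O.relIndex R → R ≤ V := by
  obtain ⟨V, ⟨h1, h2, h3, h4⟩, h5⟩ := exists_greatest
    (Φ := fun R : Subgroup G => R.Normal ∧ O ≤ R ∧ R ≤ N ∧ ¬ p ∣ O.relIndex R) (A := O)
    ⟨hO, le_rfl, hON, by rw [relIndex_self]; exact hp.out.one_lt.ne' ∘ Nat.dvd_one.mp⟩
    fun B C ⟨hB1, hB2, hB3, hB4⟩ ⟨hC1, hC2, hC3, hC4⟩ =>
      ⟨inferInstance, hB2.trans le_sup_left, sup_le hB3 hC3, not_dvd_relIndex_sup hB1 hB2 hB4 hC4⟩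
  exact ⟨V, h1, h2, h3, h4, fun R r1 r2 r3 r4 => h5 R ⟨r1, r2, r3, r4⟩⟩

/-- The elements of `G` that centralise `V` modulo `O`. -/
def centralizerMod (O V : Subgroup G) [O.Normal] : Subgroup G :=
  (centralizer ((V.map (QuotientGroup.mk' O) : Subgroup (G ⧸ O)) : Set (G ⧸ O))).comap
    (QuotientGroup.mk' O)

theorem mem_centralizerMod {O V : Subgroup G} [O.Normal] {x : G} :
    x ∈ centralizerMod O V ↔ ∀ v ∈ V, ⁅v, x⁆ ∈ O := by
  rw [centralizerMod, mem_comap, mem_centralizer_iff]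
  have key : ∀ v : G, ⁅v, x⁆ ∈ O ↔ (v : G ⧸ O) * x = x * v := fun v => by
    rw [← QuotientGroup.eq_one_iff, ← commutatorElement_eq_one_iff_mul_comm]
    rfl
  constructor
  · intro h v hv
    exact (key v).mpr (h _ ⟨v, hv, rfl⟩)
  · rintro h _ ⟨v, hv, rfl⟩
    exact (key v).mp (h v hv)

instance centralizerMod_normal (O V : Subgroup G) [O.Normal] [hV : V.Normal] :
    (centralizerMod O V).Normal := by
  have : (V.map (QuotientGroup.mk' O)).Normal :=
    hV.map _ (QuotientGroup.mk'_surjective O)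
  rw [centralizerMod]
  infer_instance

/-- A normal nilpotent section is covered by any normal subgroup that contains its `p`- and
`p'`-parts. -/
theorem le_of_isNilpotent_map [Finite G] {p : ℕ} [hp : Fact p.Prime] {O V N M : Subgroup G}
    [hO : O.Normal] (hOV : O ≤ V)
    (hVp : ∀ R : Subgroup G, R.Normal → O ≤ R → R ≤ N → PSection p O R → R ≤ V)
    (hVp' : ∀ R : Subgroup G, R.Normal → O ≤ R → R ≤ N → ¬ p ∣ O.relIndex R → R ≤ V)
    (hON : O ≤ N) (hM : M.Normal) (hMN : M ≤ N)
    (hnil : Group.IsNilpotent (M.map (QuotientGroup.mk' O))) : M ≤ V := by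
  set M' := M.map (QuotientGroup.mk' O) with hM'
  set V' := V.map (QuotientGroup.mk' O) with hV'
  have hM'n : M'.Normal := hM.map _ (QuotientGroup.mk'_surjective O)
  have hcomapM : M'.comap (QuotientGroup.mk' O) ≤ N := by
    rw [hM', comap_map_eq, QuotientGroup.ker_mk']
    exact sup_le hMN hON
  -- Sylow subgroups of the nilpotent normal section are characteristic, so their preimages are
  -- normal in `G`; they fall under `hVp` or `hVp'` according to whether `q = p`.
  have hsyl : ∀ (q : ℕ) (_ : Fact q.Prime) (T : Sylow q M'),
      (T : Subgroup M').map M'.subtype ≤ V' := by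
    intro q hq T
    have hTn : (T : Subgroup M').Normal := inferInstance
    have hTc := T.characteristic_of_normal hTn
    set R := ((T : Subgroup M').map M'.subtype).comap (QuotientGroup.mk' O) with hR
    have hRn : R.Normal := by
      rw [hR]
      infer_instance
    have hOR : O ≤ R := by
      intro x hx
      rw [hR, mem_comap, QuotientGroup.mk'_apply, (QuotientGroup.eq_one_iff x).mpr hx]
      exact one_mem _
    have hRN : R ≤ N := (comap_mono (map_subtype_le _)).trans hcomapM
    have hps : PSection q O R := by
      rintro x ⟨t, ht, htx⟩
      obtain ⟨n, hn⟩ := pSection_of_isPGroup (K := ⊥) T.isPGroup' t ht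
      refine ⟨n, (QuotientGroup.eq_one_iff _).mp ?_⟩
      have h1 : ((x ^ q ^ n : G) : G ⧸ O) = M'.subtype (t ^ q ^ n) := by
        rw [map_pow, htx]; rfl
      rw [h1, mem_bot.mp hn, map_one]
    have hRV : R ≤ V := by
      by_cases hqp : q = p
      · subst hqp
        exact hVp R hRn hOR hRN hps
      · refine hVp' R hRn hOR hRN fun hdvd => ?_
        obtain ⟨n, hn⟩ := hps.exists_relIndex hO
        rw [hn] at hdvd
        exact hqp ((Nat.prime_dvd_prime_iff_eq hp.out hq.out).mp
          (hp.out.dvd_of_dvd_pow hdvd)).symm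
    have := map_mono (f := QuotientGroup.mk' O) hRV
    rwa [hR, map_comap_eq_self_of_surjective (QuotientGroup.mk'_surjective O)] at this
  have hle : M' ≤ V' := by
    rw [← relIndex_eq_one]
    by_contra hne
    obtain ⟨q, hq, hqd⟩ := Nat.exists_prime_and_dvd hne
    have hq' : Fact q.Prime := ⟨hq⟩
    obtain ⟨T⟩ : Nonempty (Sylow q M') := inferInstance
    exact T.not_dvd_index (hqd.trans (index_dvd_of_le fun t ht => hsyl q hq' T ⟨t, ht, rfl⟩))
  have := comap_mono (f := QuotientGroup.mk' O) hle
  rw [hM', hV', comap_map_eq, comap_map_eq, QuotientGroup.ker_mk', sup_eq_left.mpr hOV] at this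
  exact le_sup_left.trans this

theorem isNilpotent_map_of_commutator_le {O V M : Subgroup G} [hO : O.Normal]
    (h1 : ⁅M, M⁆ ≤ V) (h2 : ∀ v ∈ V, ∀ m ∈ M, ⁅v, m⁆ ∈ O) :
    Group.IsNilpotent (M.map (QuotientGroup.mk' O)) := by
  set M' := M.map (QuotientGroup.mk' O) with hM'
  have h3 : ⁅⁅M', M'⁆, M'⁆ = ⊥ := by
    rw [hM', ← map_commutator, ← map_commutator, Subgroup.map_eq_bot_iff, QuotientGroup.ker_mk',
      Subgroup.commutator_le]
    exact fun v hv m hm => h2 v (h1 hv) m hm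
  rw [Subgroup.nilpotent_iff_lowerCentralSeries]
  refine ⟨2, ?_⟩
  rw [← map_eq_bot_iff_of_injective _ M'.subtype_injective, ← h3]
  change map M'.subtype ⁅⁅(⊤ : Subgroup M'), ⊤⁆, ⊤⁆ = _
  rw [map_commutator, map_commutator, ← MonoidHom.range_eq_map, range_subtype]

/-- If the centraliser of `V / O` is not contained in `V`, then it contains a minimal perfect
normal subgroup not contained in `V`. -/
theorem exists_perfect_le_centralizer [Finite G] {p : ℕ} [hp : Fact p.Prime] {O V N : Subgroup G}
    (hO : O.Normal) (hV : V.Normal) (hN : N.Normal) (hOV : O ≤ V) (hON : O ≤ N)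
    (hVp : ∀ R : Subgroup G, R.Normal → O ≤ R → R ≤ N → PSection p O R → R ≤ V)
    (hVp' : ∀ R : Subgroup G, R.Normal → O ≤ R → R ≤ N → ¬ p ∣ O.relIndex R → R ≤ V)
    (hC : ∃ x ∈ N, x ∉ V ∧ ∀ v ∈ V, ⁅v, x⁆ ∈ O) :
    ∃ M : Subgroup G, M.Normal ∧ M ≤ N ∧ (∀ v ∈ V, ∀ m ∈ M, ⁅v, m⁆ ∈ O) ∧ ⁅M, M⁆ = M ∧
      ¬ M ≤ V ∧ ∀ R : Subgroup G, R.Normal → R < M → R ≤ V := by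
  obtain ⟨x, hxN, hxV, hx⟩ := hC
  obtain ⟨M, hM⟩ := (Set.toFinite {M : Subgroup G | M.Normal ∧ M ≤ N ⊓ centralizerMod O V ∧
    ¬ M ≤ V}).exists_minimal ⟨N ⊓ centralizerMod O V, inferInstance, le_rfl,
      fun h => hxV (h ⟨hxN, mem_centralizerMod.mpr hx⟩)⟩
  obtain ⟨⟨h1, h2, h3⟩, hmin⟩ := hM
  have hMC : ∀ v ∈ V, ∀ m ∈ M, ⁅v, m⁆ ∈ O := fun v hv m hm =>
    mem_centralizerMod.mp (h2 hm).2 v hv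
  have hprop : ∀ R : Subgroup G, R.Normal → R < M → R ≤ V := by
    intro R hR hlt
    by_contra hRV
    exact hlt.not_ge (hmin ⟨hR, hlt.le.trans h2, hRV⟩ hlt.le)
  refine ⟨M, h1, h2.trans inf_le_left, hMC, ?_, h3, hprop⟩
  -- If `M' < M`, then `M' ≤ V` by minimality; as `M` centralises `V / O`, it is nilpotent of class
  -- at most two modulo `O`.
  by_contra hne
  exact h3 (le_of_isNilpotent_map (hO := hO) hOV hVp hVp' hON h1 (h2.trans inf_le_left)
    (isNilpotent_map_of_commutator_le
      (hprop _ inferInstance (lt_of_le_of_ne (commutator_le_self M) hne)) hMC))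

/-- A `p`-subgroup with the `IC`-`Π`-property meets a perfect normal subgroup `M` with unique
maximal normal subgroup `Y` in `Y`. -/
theorem ICPiProperty.inf_le_of_perfect [Finite G] {p : ℕ} [hp : Fact p.Prime] {H M Y : Subgroup G}
    (h : ICPiProperty H) (hH : IsPGroup p H) (hM : M.Normal) (hY : Y.Normal) (hYM : Y < M)
    (hperf : ⁅M, M⁆ = M) (hmax : ∀ R : Subgroup G, R.Normal → R < M → R ≤ Y) : H ⊓ M ≤ Y := by
  have hc : IsChiefFactor Y M := by
    refine ⟨hY, hM, hYM, fun R hR h1 h2 => ?_⟩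
    rcases eq_or_lt_of_le h2 with h3 | h3
    · exact Or.inr h3
    · exact Or.inl (le_antisymm (hmax R hR h3) h1)
  have hps : ¬ PSection p Y M := fun hps => hYM.not_ge (by
    rw [← hperf]; exact hc.commutator_le hps)
  rintro x ⟨hxH, hxM⟩
  by_contra hxY
  set D := ⁅zpowers x, (⊤ : Subgroup G)⁆ with hD
  have hDn : D.Normal := commutator_top_normal _
  have hDM : D ≤ M := (commutator_mono (zpowers_le.mpr hxM) le_rfl).trans (commutator_le_left M ⊤)
  have hZM : zpowers x ⊔ D ≤ M := sup_le (zpowers_le.mpr hxM) hDM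
  have hZn : (zpowers x ⊔ D).Normal := by
    rw [← commutator_top_left_le_iff, Subgroup.commutator_le]
    intro g _ y hy
    obtain ⟨z, hz, d, hd, rfl⟩ := mem_sup_of_normal_right.mp hy
    have h1 : ⁅g, z * d⁆ = ⁅g, z⁆ * (z * ⁅g, d⁆ * z⁻¹) := by
      simp only [commutatorElement_def]; group
    rw [h1]
    refine mem_sup_right (mul_mem ?_ (hDn.conj_mem _ ?_ z))
    · rw [hD, commutator_comm]; exact commutator_mem_commutator (mem_top g) hz
    · exact (commutator_le_right ⊤ D) (commutator_mem_commutator (mem_top g) hd)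
  have hZ : zpowers x ⊔ D = M := by
    by_contra hne
    exact hxY (hmax _ hZn (lt_of_le_of_ne hZM hne) (mem_sup_left (mem_zpowers x)))
  -- Since `M = ⟨x⟩D`, the quotient `M / D` is cyclic, and a perfect group has no nontrivial cyclic
  -- quotient. Hence `[H, G]` covers `M`.
  have hMD : M ≤ D := by
    rw [← hperf]
    exact CyclicSection.commutator_le hDn ⟨x, hxM, hZ.ge⟩
  exact hxY (h.inf_le hH hc (hMD.trans (commutator_mono (zpowers_le.mpr hxH) le_rfl)) hps
    ⟨hxH, hxM⟩)

/-- The transfer into the centre is `y ↦ y ^ |Q : Z(Q)|`; its target is abelian, so it is trivial on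
a perfect group. -/
theorem pow_index_center_eq_one {Q : Type*} [Group Q] [Finite Q] (h : commutator Q = ⊤) (y : Q) :
    y ^ (center Q).index = 1 := by
  have h1 : commutator Q ≤ (MonoidHom.transferCenterPow Q).ker := by
    rw [commutator_def, Subgroup.commutator_le]
    intro a _ b _
    rw [MonoidHom.mem_ker, map_commutatorElement, commutatorElement_eq_one_iff_mul_comm]
    exact Subtype.ext (mem_center_iff.mp (MonoidHom.transferCenterPow Q b).2 _)
  rw [h] at h1
  rw [← MonoidHom.transferCenterPow_apply, MonoidHom.mem_ker.mp (h1 (mem_top y)),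
    OneMemClass.coe_one]

/-- A perfect normal subgroup all of whose chief factors of order divisible by `p` are cyclic has
order prime to `p`. -/
theorem not_dvd_card_of_perfect [Finite G] {p : ℕ} [hp : Fact p.Prime] {L : Subgroup G}
    (hL : L.Normal) (hperf : ⁅L, L⁆ = L) (h : CyclicBetween p ⊥ L) : ¬ p ∣ Nat.card L := by
  obtain ⟨Y, hY⟩ := (Set.toFinite {Y : Subgroup G | Y.Normal ∧ Y ≤ L ∧
    ¬ p ∣ Y.relIndex L}).exists_minimal ⟨L, hL, le_rfl, by
      rw [relIndex_self]; exact hp.out.one_lt.ne' ∘ Nat.dvd_one.mp⟩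
  obtain ⟨⟨h1, h2, h3⟩, hmin⟩ := hY
  rcases eq_or_ne Y ⊥ with rfl | hne
  · rwa [relIndex_bot_left] at h3
  obtain ⟨Z, -, hc⟩ := exists_chiefFactor_le Subgroup.normal_bot h1 (bot_lt_iff_ne_bot.mpr hne)
  have hZn := hc.normal_bot
  by_cases hdvd : p ∣ Z.relIndex Y
  swap
  · refine absurd (hmin ⟨hZn, hc.lt.le.trans h2, ?_⟩ hc.lt.le) hc.lt.not_ge
    rw [← relIndex_mul_relIndex Z Y L hc.lt.le h2, hp.out.dvd_mul]
    tauto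
  have hcyc := h Z Y bot_le hc h2 hdvd
  obtain ⟨y, hy, hyZ, hyp⟩ := exists_mem_pow_mem_of_dvd_relIndex hZn hdvd
  set Q := quot Z L with hQ
  have hQperf : commutator Q = ⊤ := by
    rw [← map_subtype_inj, map_subtype_commutator, ← MonoidHom.range_eq_map, range_subtype, hQ,
      quot, ← map_commutator, hperf]
  let yQ : Q := ⟨(y : G ⧸ Z), ⟨y, h2 hy, rfl⟩⟩
  -- The perfect group `L` lies in `G'`, which centralises the cyclic factor `Y / Z`. So the index
  -- of the centre of `L / Z` divides `|L : Y|`, which is prime to `p`, and transfer excludes the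
  -- element `y` of order `p` modulo `Z`.
  have hcent : (quot Z Y).subgroupOf Q ≤ center Q := by
    rintro ⟨_, l, hl, rfl⟩ ⟨v, hv, hvl⟩
    rw [mem_center_iff]
    rintro ⟨_, m, hm, rfl⟩
    have hm' : m ∈ commutator G := by
      rw [← hperf] at hm
      exact commutator_mono le_top le_top hm
    have h4 := commutator_mem_of_cyclicSection hZn h1 hcyc hm' hv
    rw [← QuotientGroup.eq_one_iff] at h4
    have h5 : (v : G ⧸ Z) * (m : G ⧸ Z) = m * v :=
      commutatorElement_eq_one_iff_mul_comm.mp h4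
    apply Subtype.ext
    change (m : G ⧸ Z) * QuotientGroup.mk' Z l = QuotientGroup.mk' Z l * m
    have hvl' : QuotientGroup.mk' Z v = QuotientGroup.mk' Z l := hvl
    rw [← hvl']
    exact h5.symm
  have hidx : ¬ p ∣ (center Q).index := by
    intro hd
    refine h3 (hd.trans ((index_dvd_of_le hcent).trans ?_))
    change (quot Z Y).relIndex (quot Z L) ∣ _
    rw [quot, quot, relIndex_map_map, QuotientGroup.ker_mk', sup_eq_left.mpr hc.lt.le,
      sup_eq_left.mpr (hc.lt.le.trans h2)]
  have hpow : yQ ^ (center Q).index = 1 := pow_index_center_eq_one hQperf yQ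
  refine absurd ?_ hyZ
  refine mem_of_pow_mem_of_coprime (a := (center Q).index) (b := p) ?_ hyp
    ((Nat.Prime.coprime_iff_not_dvd hp.out).mpr hidx).symm
  have h6 := congrArg Subtype.val hpow
  exact (QuotientGroup.eq_one_iff _).mp h6

end Perfect

end ICPi

/-! ### From self-centralising sections to `N`; coprime complements -/

namespace ICPi

open Subgroup
open scoped commutatorElement Pointwise

section Coprime

variable {G : Type*} [Group G]

theorem exists_conj_mem_of_not_dvd [Finite G] {p : ℕ} [hp : Fact p.Prime] {P X D : Subgroup G}
    (hP : IsPGroup p P) (hX : ¬ p ∣ P.relIndex X) (hD : IsPGroup p D) (hDX : D ≤ X) :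
    ∃ g ∈ X, ∀ x ∈ D, g * x * g⁻¹ ∈ P := by
  let T : Sylow p X := (hP.comap_subtype (K := X)).toSylow hX
  obtain ⟨Q, hQ⟩ := (hD.comap_subtype (K := X)).exists_le_sylow
  obtain ⟨g, hg⟩ := MulAction.exists_smul_eq X Q T
  refine ⟨g, g.2, fun x hx => ?_⟩
  have h1 : (⟨x, hDX hx⟩ : X) ∈ (Q : Subgroup X) := hQ hx
  have h2 : MulAut.conj g • (⟨x, hDX hx⟩ : X) ∈ ((g • Q : Sylow p X) : Subgroup X) :=
    smul_mem_pointwise_smul _ _ _ h1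
  rw [hg] at h2
  exact h2

theorem le_of_normal_of_not_dvd [Finite G] {p : ℕ} [hp : Fact p.Prime] {P X D : Subgroup G}
    (hP : IsPGroup p P) (hX : ¬ p ∣ P.relIndex X) (hD : IsPGroup p D) (hDX : D ≤ X)
    (hDn : D.Normal) : D ≤ P := by
  obtain ⟨g, -, hg⟩ := exists_conj_mem_of_not_dvd hP hX hD hDX
  intro x hx
  have := hg _ (hDn.conj_mem x hx g⁻¹)
  simpa [mul_assoc] using this

/-- A perfect normal subgroup `M` whose elements of exponent `p` (or `4`) in `P` are central has
order prime to `p`. -/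
theorem not_dvd_card_of_central [Finite G] {p : ℕ} [hp : Fact p.Prime] {M P : Subgroup G}
    (hM : M.Normal) (hperf : ⁅M, M⁆ = M)
    (hSyl : ∀ D ≤ M, IsPGroup p D → ∃ g : G, ∀ x ∈ D, g * x * g⁻¹ ∈ P)
    (hcent : ∀ x ∈ P, x ∈ M →
      (x ^ p = 1 ∨ p = 2 ∧ x ^ 4 = 1 ∧ ¬ ∀ a ∈ P, ∀ b ∈ P, a * b = b * a) →
      ∀ m ∈ M, Commute x m) : ¬ p ∣ Nat.card M := by
  refine not_dvd_card_of_isPerfect (isPerfect_iff.mpr hperf) fun D hD a ha hap => ?_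
  obtain ⟨g, hg⟩ := hSyl (D.map M.subtype) (map_subtype_le D) (hD.map M.subtype)
  have hgood : ∃ n, GoodExponent p n D ∧ ∀ x ∈ P, x ^ n = 1 →
      (x ^ p = 1 ∨ p = 2 ∧ x ^ 4 = 1 ∧ ¬ ∀ a ∈ P, ∀ b ∈ P, a * b = b * a) := by
    by_cases h : p ≠ 2 ∨ ∀ a ∈ P, ∀ b ∈ P, a * b = b * a
    · refine ⟨p, Or.inl ⟨rfl, h.imp_right fun hab x hx y hy => ?_⟩, fun x _ hx => Or.inl hx⟩
      have h1 := hab _ (hg x ⟨x, hx, rfl⟩) _ (hg y ⟨y, hy, rfl⟩)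
      have h2 : g * ((x : G) * y) * g⁻¹ = g * ((y : G) * x) * g⁻¹ := by
        calc _ = g * x * g⁻¹ * (g * y * g⁻¹) := by group
          _ = g * y * g⁻¹ * (g * x * g⁻¹) := h1
          _ = _ := by group
      exact Subtype.ext (mul_left_cancel (mul_right_cancel h2))
    · push Not at h
      refine ⟨4, Or.inr ⟨h.1, rfl⟩, fun x _ hx => Or.inr ⟨h.1, hx, ?_⟩⟩
      push Not
      exact h.2
  obtain ⟨n, hn, hnP⟩ := hgood
  refine mem_centralizer_iff.mpr fun t ht => ?_
  refine commute_of_coprime_of_pow hap D hD hn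
    (fun t ht => (mem_normalizer_iff.mp ha t).mp ht) (fun t ht htn => ?_) t ht
  have h1 : g * (t : G) * g⁻¹ ∈ P := hg t ⟨t, ht, rfl⟩
  have h2 : (g * (t : G) * g⁻¹) ^ n = 1 := by
    rw [conj_pow, ← SubgroupClass.coe_pow, htn]
    simp
  have h3 := hcent _ h1 (hM.conj_mem t t.2 g) (hnP _ h1 h2) _ (hM.conj_mem a a.2 g)
  have h4 : g * ((t : G) * a) * g⁻¹ = g * ((a : G) * t) * g⁻¹ := by
    calc _ = g * t * g⁻¹ * (g * a * g⁻¹) := by group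
      _ = g * a * g⁻¹ * (g * t * g⁻¹) := h3
      _ = _ := by group
  exact Subtype.ext (mul_left_cancel (mul_right_cancel h4))

/-- If `O` is a `p'`-group, `V / O` a `p`-group containing its centraliser in `N`, and all chief
factors between `O` and `V` are cyclic, then so are all chief factors below `N` of order divisible
by `p`. -/
theorem cyclicBetween_of_centralizer_le [Finite G] {p : ℕ} [hp : Fact p.Prime]
    {O V N : Subgroup G} (hO : O.Normal) (hV : V.Normal) (hOV : O ≤ V)
    (hVN : V ≤ N) (hOp : ¬ p ∣ Nat.card O) (hps : PSection p O V) (hcyc : CyclicBetween p O V)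
    (hC : ∀ x ∈ N, (∀ v ∈ V, ⁅v, x⁆ ∈ O) → x ∈ V) : CyclicBetween p ⊥ N := by
  have hres := hcyc.commutator_primeResidual_le hO hV hOV hps
  -- The residual centralises `V / O`, which contains its centraliser in `N`; hence it meets `N`
  -- inside `V`.
  have hresV : ∀ x ∈ N, x ∈ primeResidual p G → x ∈ V := fun x hx hxr =>
    hC x hx fun v hv => hres (commutator_mem_commutator hv hxr)
  refine cyclicBetween_trans hO bot_le (cyclicBetween_of_not_dvd (by rwa [relIndex_bot_left]))
    (cyclicBetween_trans hV hOV hcyc ?_ hVN) (hOV.trans hVN)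
  intro A B hVA hc hBN hd
  have hAn := hc.normal_bot
  have hBn := hc.normal_top
  -- An abelian factor of order divisible by `p` has exponent `p`. Otherwise `B = B'A`, and the
  -- `p'`-parts of elements of `B'` lie in the residual, hence in `V ≤ A`.
  have hpsB : PSection p A B := by
    rcases hc.eq_or_eq (⁅B, B⁆ ⊔ A) inferInstance le_sup_right
      (sup_le (commutator_le_self B) hc.lt.le) with h | h
    · have h1 := hc.pow_mem_of_exists (n := p) (sup_eq_right.mp h)
        (exists_mem_pow_mem_of_dvd_relIndex hAn hd)
      exact fun x hx => ⟨1, by simpa using h1 x hx⟩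
    · intro x hx
      have hx' := hx
      rw [← h] at hx'
      obtain ⟨c, hcB, a, ha, rfl⟩ := mem_sup_of_normal_right.mp hx'
      obtain ⟨n, hn⟩ := exists_pow_coprime (p := p) c
      refine ⟨n, ?_⟩
      have h1 : c ^ p ^ n ∈ A := by
        refine hVA (hresV _ (hBN (pow_mem (commutator_le_self B hcB) _)) (subset_closure ⟨?_, hn⟩))
        exact pow_mem (mem_sup_left (commutator_mono le_top le_top hcB)) _
      rw [← QuotientGroup.eq_one_iff] at h1 ha ⊢
      rw [QuotientGroup.mk_pow, QuotientGroup.mk_mul, ha, mul_one, ← QuotientGroup.mk_pow, h1]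
  refine hc.cyclicSection_of_commutator_le hpsB fun x hx => hVA (hresV x ?_ ?_)
  · exact hBN (commutator_le_left _ _ hx)
  · exact commutator_le_right _ _ hx

section Averaging

variable [Finite G] {A : Subgroup G} [hA : A.Normal]

/-- The correction `δ t` carrying `t` into `T'` is a cocycle with values in `A`. Its product over
`T`, after extracting a `|T|`-th root in `A`, exhibits it as a coboundary. -/
theorem exists_conj_mem_of_complement (hAc : ∀ a b : A, a * b = b * a) {T T' : Subgroup G}
    (hcop : (Nat.card A).Coprime (Nat.card T)) (hTT' : ∀ t ∈ T, ∃ a ∈ A, a * t ∈ T')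
    (hT' : T' ⊓ A = ⊥) : ∃ a ∈ A, ∀ t ∈ T, a * t * a⁻¹ ∈ T' := by
  let _ : CommGroup A := { (inferInstance : Group A) with mul_comm := hAc }
  have := Fintype.ofFinite T
  have hch : ∀ t : T, ∃ a : A, (a : G) * t ∈ T' := fun t => by
    obtain ⟨a, ha, h⟩ := hTT' t t.2
    exact ⟨⟨a, ha⟩, h⟩
  choose δ hδ using hch
  let c : G →* MulAut A := MulAut.conjNormal
  have hc : ∀ (g : G) (a : A), ((c g a : A) : G) = g * a * g⁻¹ := fun g a =>
    MulAut.conjNormal_apply g a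
  have hcoc : ∀ s t : T, δ (s * t) = δ s * c s (δ t) := by
    intro s t
    have h1 : ((δ s : G) * s) * ((δ t : G) * t) * ((δ (s * t) : G) * (s * t : T))⁻¹ ∈ T' :=
      mul_mem (mul_mem (hδ s) (hδ t)) (inv_mem (hδ (s * t)))
    have h2 : ((δ s : G) * s) * ((δ t : G) * t) * ((δ (s * t) : G) * (s * t : T))⁻¹ =
        ((δ s * c s (δ t) * (δ (s * t))⁻¹ : A) : G) := by
      push_cast
      rw [hc]
      group
    rw [h2] at h1
    have h3 : ((δ s * c s (δ t) * (δ (s * t))⁻¹ : A) : G) ∈ T' ⊓ A := ⟨h1, SetLike.coe_mem _⟩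
    rw [hT', mem_bot] at h3
    exact (mul_inv_eq_one.mp (Subtype.ext h3)).symm
  set b := ∏ t : T, δ t with hb
  have hbs : ∀ s : T, b = δ s ^ Nat.card T * c s b := by
    intro s
    calc b = ∏ t : T, δ (s * t) := (Fintype.prod_equiv (Equiv.mulLeft s) _ _ fun _ => rfl).symm
      _ = ∏ t : T, δ s * c s (δ t) := by simp only [hcoc]
      _ = _ := by
        rw [Finset.prod_mul_distrib, Finset.prod_const, map_prod, Finset.card_univ,
          Nat.card_eq_fintype_card]
  obtain ⟨a, ha⟩ := (powCoprime hcop).surjective b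
  have ha' : a ^ Nat.card T = b := ha
  refine ⟨a, a.2, fun t ht => ?_⟩
  have h1 : a = δ ⟨t, ht⟩ * c t a := by
    apply (powCoprime hcop).injective
    change a ^ Nat.card T = (δ ⟨t, ht⟩ * c t a) ^ Nat.card T
    rw [mul_pow, ← map_pow, ha']
    exact hbs ⟨t, ht⟩
  have h2 : (a : G) * t * (a : G)⁻¹ = δ ⟨t, ht⟩ * t := by
    have h3 : (a : G) = δ ⟨t, ht⟩ * (t * a * t⁻¹) := by
      rw [← hc]
      exact congrArg Subtype.val h1
    calc (a : G) * t * (a : G)⁻¹ = (δ ⟨t, ht⟩ * (t * a * t⁻¹)) * t * (a : G)⁻¹ := by rw [← h3]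
      _ = _ := by group
  rw [h2]
  exact hδ ⟨t, ht⟩

/-- Averaging: the product of the `T`-conjugates of `a` is fixed by `T` and agrees with `a ^ |T|`
modulo `[A, T]`, and `|T|` is prime to `|A|`. -/
theorem le_commutator_sup_centralizer (hAc : ∀ a b : A, a * b = b * a) {T : Subgroup G}
    (hcop : (Nat.card A).Coprime (Nat.card T)) :
    A ≤ ⁅A, T⁆ ⊔ (centralizer (T : Set G) ⊓ A) := by
  let _ : CommGroup A := { (inferInstance : Group A) with mul_comm := hAc }
  have := Fintype.ofFinite T
  let c : G →* MulAut A := MulAut.conjNormal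
  have hc : ∀ (g : G) (a : A), ((c g a : A) : G) = g * a * g⁻¹ := fun g a =>
    MulAut.conjNormal_apply g a
  intro x hx
  set a : A := ⟨x, hx⟩ with ha
  set b := ∏ t : T, c t a with hb
  have hbC : (b : G) ∈ centralizer (T : Set G) ⊓ A := by
    refine ⟨mem_centralizer_iff.mpr fun s hs => ?_, b.2⟩
    have h1 : c s b = b := by
      rw [hb, map_prod]
      refine Fintype.prod_equiv (Equiv.mulLeft (⟨s, hs⟩ : T)) _ _ fun t => ?_
      change c s (c t a) = c (s * t) a
      rw [map_mul]
      rfl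
    have h2 := hc s b
    rw [h1] at h2
    exact (mul_inv_eq_iff_eq_mul.mp h2.symm)
  have hquot : ((a ^ Nat.card T * b⁻¹ : A) : G) ∈ ⁅A, T⁆ := by
    have h1 : a ^ Nat.card T * b⁻¹ = ∏ t : T, a * (c t a)⁻¹ := by
      rw [Finset.prod_mul_distrib, Finset.prod_const, Finset.prod_inv_distrib, Finset.card_univ,
        Nat.card_eq_fintype_card]
    rw [h1]
    have h2 : ∏ t : T, a * (c t a)⁻¹ ∈ (⁅A, T⁆ : Subgroup G).subgroupOf A := by
      refine prod_mem fun t _ => ?_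
      rw [mem_subgroupOf]
      push_cast
      rw [hc]
      have : (a : G) * ((t : G) * a * (t : G)⁻¹)⁻¹ = ⁅(a : G), (t : G)⁆ := by
        rw [commutatorElement_def]; group
      rw [this]
      exact commutator_mem_commutator a.2 t.2
    exact h2
  refine mem_of_pow_mem_of_coprime (a := Nat.card T) (b := Nat.card A) ?_ ?_ hcop.symm
  · have : x ^ Nat.card T = ((a ^ Nat.card T * b⁻¹ : A) : G) * b := by
      push_cast
      rw [inv_mul_cancel_right]
    rw [this]
    exact mul_mem (mem_sup_left hquot) (mem_sup_right hbC)
  · have : x ^ Nat.card A = 1 := congrArg Subtype.val (pow_card_eq_one' (x := a))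
    rw [this]
    exact one_mem _

/-- A normal abelian subgroup `A` that is a normal Hall subgroup of a normal subgroup `K` has a
supplement meeting `A` in the centraliser of `K`. -/
theorem exists_supplement_of_coprime (hAc : ∀ a b : A, a * b = b * a) {K : Subgroup G}
    (hK : K.Normal) (hAK : A ≤ K) (hcop : (Nat.card A).Coprime (A.relIndex K)) :
    A ≤ ⁅A, K⁆ ⊔ (centralizer (K : Set G) ⊓ A) ∧
      ∃ C : Subgroup G, C ⊔ A = ⊤ ∧ C ⊓ A = centralizer (K : Set G) ⊓ A := by
  obtain ⟨T₀, hT₀⟩ := exists_right_complement'_of_coprime (N := A.subgroupOf K)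
    (by rwa [card_subgroupOf_of_le hAK])
  set T := T₀.map K.subtype with hT
  have hTK : T ≤ K := map_subtype_le T₀
  have hTcard : Nat.card T = A.relIndex K := by
    rw [hT, card_map_subtype, relIndex, hT₀.symm.index_eq_card]
  have hmul : ∀ k ∈ K, ∃ a ∈ A, ∃ t ∈ T, a * t = k := by
    intro k hk
    obtain ⟨⟨a, t⟩, hat⟩ := hT₀.2 ⟨k, hk⟩
    exact ⟨(a : K), a.2, (t : K), ⟨t, t.2, rfl⟩, congrArg Subtype.val hat⟩
  have hTA : T ⊓ A = ⊥ := by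
    rw [eq_bot_iff]
    rintro _ ⟨⟨t, ht, rfl⟩, htA⟩
    have h1 : t ∈ A.subgroupOf K ⊓ T₀ := ⟨htA, ht⟩
    rw [hT₀.disjoint.eq_bot, mem_bot] at h1
    rw [h1]
    exact one_mem _
  have hcopT : (Nat.card A).Coprime (Nat.card T) := by rwa [hTcard]
  have hcent : ∀ x ∈ A, (∀ t ∈ T, Commute t x) → x ∈ centralizer (K : Set G) := by
    intro x hx h
    refine mem_centralizer_iff.mpr fun k hk => ?_
    obtain ⟨a, ha, t, ht, rfl⟩ := hmul k hk
    have h1 : Commute a x := congrArg Subtype.val (hAc ⟨a, ha⟩ ⟨x, hx⟩)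
    exact (h1.mul_left (h t ht))
  refine ⟨(le_commutator_sup_centralizer hAc hcopT).trans (sup_le_sup (commutator_mono le_rfl hTK)
    fun x hx => ⟨hcent x hx.2 fun t ht => mem_centralizer_iff.mp hx.1 t ht, hx.2⟩),
    normalizer (T : Set G), ?_, ?_⟩
  · rw [eq_top_iff]
    intro g _
    set T' := T.map (MulAut.conj g).toMonoidHom with hT'
    have hT'A : T' ⊓ A = ⊥ := by
      rw [eq_bot_iff]
      rintro _ ⟨⟨t, ht, rfl⟩, htA⟩
      have h1 : t ∈ T ⊓ A := by
        refine ⟨ht, ?_⟩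
        have := hA.conj_mem _ htA g⁻¹
        simpa [mul_assoc] using this
      rw [hTA, mem_bot] at h1
      rw [h1, map_one]
      exact one_mem _
    have hTT' : ∀ t ∈ T, ∃ a ∈ A, a * t ∈ T' := by
      intro t ht
      obtain ⟨a, ha, s, hs, hst⟩ := hmul (g⁻¹ * t * g) (by
        have := hK.conj_mem t (hTK ht) g⁻¹
        simpa using this)
      refine ⟨g * a⁻¹ * g⁻¹, hA.conj_mem _ (inv_mem ha) g, s, hs, ?_⟩
      have h1 : s = a⁻¹ * (g⁻¹ * t * g) := by rw [← hst]; group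
      change g * s * g⁻¹ = _
      rw [h1]
      group
    -- Frattini argument: `T` and its conjugate by `g` both complement `A` in `K`, so they are
    -- conjugate under `A`, whence `g ∈ A N_G(T)`.
    obtain ⟨a, ha, h⟩ := exists_conj_mem_of_complement hAc hcopT hTT' hT'A
    have hn : g⁻¹ * a ∈ normalizer (T : Set G) := by
      refine mem_normalizer_fintype (S := (T : Set G)) fun t ht => ?_
      obtain ⟨s, hs, hst⟩ := h t ht
      have h1 : g * s * g⁻¹ = a * t * a⁻¹ := hst
      have h2 : g⁻¹ * a * t * (g⁻¹ * a)⁻¹ = s := by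
        calc _ = g⁻¹ * (a * t * a⁻¹) * g := by group
          _ = s := by rw [← h1]; group
      rw [h2]
      exact hs
    have h3 : g = a * (g⁻¹ * a)⁻¹ := by group
    rw [h3]
    exact mul_mem (mem_sup_right ha) (mem_sup_left (inv_mem hn))
  · apply le_antisymm
    · rintro x ⟨hx, hxA⟩
      refine ⟨hcent x hxA fun t ht => ?_, hxA⟩
      -- An element of `A` normalising `T` has its commutators with `T` in `T ∩ A = 1`; as `A` is
      -- abelian and `K = AT`, it centralises `K`.
      have h1 : ⁅x, t⁆ ∈ T ⊓ A := by
        refine ⟨?_, ?_⟩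
        · rw [commutatorElement_def]
          exact mul_mem (S := Subgroup G) ((mem_normalizer_iff.mp hx t).mp ht)
            (inv_mem (S := Subgroup G) ht)
        · have : ⁅x, t⁆ = x * (t * x⁻¹ * t⁻¹) := by rw [commutatorElement_def]; group
          rw [this]
          exact mul_mem (S := Subgroup G) hxA (hA.conj_mem _ (inv_mem (S := Subgroup G) hxA) t)
      rw [hTA, mem_bot] at h1
      exact (commutatorElement_eq_one_iff_commute.mp h1).symm
    · rintro x ⟨hx, hxA⟩
      exact ⟨centralizer_le_normalizer _ (centralizer_le hTK hx), hxA⟩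

end Averaging

theorem IsChiefFactor.commutator_mem_of_pSection [Finite G] {p : ℕ} [hp : Fact p.Prime]
    {K L V : Subgroup G} (hc : IsChiefFactor K L) (hps : PSection p K V) (hV : V.Normal)
    (hLV : L ≤ V) : ∀ x ∈ L, ∀ y ∈ V, ⁅x, y⁆ ∈ K := by
  have hK := hc.normal_bot
  have hf := QuotientGroup.mk'_surjective K
  have h1 := hc.map hf (QuotientGroup.ker_mk' K).le
  rw [(Subgroup.map_eq_bot_iff K).mpr (QuotientGroup.ker_mk' K).ge] at h1
  intro x hx y hy
  have h2 := h1.le_centralizer_of_isPGroup (P := V.map (QuotientGroup.mk' K)) hps.isPGroup_quot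
    (hV.map _ hf) (map_mono hLV) _ ⟨x, hx, rfl⟩ _ ⟨y, hy, rfl⟩
  rw [← QuotientGroup.eq_one_iff]
  exact commutatorElement_eq_one_iff_commute.mpr h2

theorem frat_map {G' : Type*} [Group G'] (f : G →* G') (p : ℕ) (V : Subgroup G) :
    frat p V ≤ (frat p (V.map f)).comap f := by
  refine sup_le (Subgroup.commutator_le.mpr fun x hx y hy => ?_) ((closure_le _).mpr ?_)
  · rw [mem_comap, map_commutatorElement]
    exact commutator_le_frat p _ (commutator_mem_commutator ⟨x, hx, rfl⟩ ⟨y, hy, rfl⟩)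
  · rintro _ ⟨x, hx, rfl⟩
    rw [SetLike.mem_coe, mem_comap, map_pow]
    exact pow_mem_frat ⟨x, hx, rfl⟩

/-- A `p'`-element acting trivially on the Frattini quotient of a normal `p`-subgroup centralises
it. -/
theorem commutator_eq_one_of_frat [Finite G] {p : ℕ} [hp : Fact p.Prime] {V : Subgroup G}
    (hV : V.Normal) (hVp : IsPGroup p V) {a : G} (ha : (orderOf a).Coprime p)
    (haf : ∀ x ∈ V, ⁅x, a⁆ ∈ frat p V) : ∀ x ∈ V, ⁅x, a⁆ = 1 := by
  obtain ⟨L, hL⟩ := (Set.toFinite {L : Subgroup G | L.Normal ∧ L ≤ V ∧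
    ∀ x ∈ V, ⁅x, a⁆ ∈ L}).exists_minimal
    ⟨frat p V, frat_normal p hV, frat_le p V, haf⟩
  obtain ⟨⟨h1, h2, h3⟩, hmin⟩ := hL
  rcases eq_or_ne L ⊥ with rfl | hne
  · exact fun x hx => mem_bot.mp (h3 x hx)
  exfalso
  obtain ⟨K, -, hc⟩ := exists_chiefFactor_le Subgroup.normal_bot h1 (bot_lt_iff_ne_bot.mpr hne)
  have hK := hc.normal_bot
  -- The quotient by `K` makes `L / K` central of exponent dividing `p`, so `commute_of_le_frat`
  -- pushes all `[x, a]` down into `K`, against minimality of `L`.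
  refine hc.lt.not_ge (hmin ⟨hK, hc.lt.le.trans h2, fun x hx => ?_⟩ hc.lt.le)
  let f := QuotientGroup.mk' K
  have hcent := hc.commutator_mem_of_pSection (pSection_of_isPGroup hVp) hV h2
  have hkey := commute_of_le_frat (p := p) (P := V.map f) (L := L.map f) (a := f a) (map_mono h2)
    (by
      rintro _ ⟨y, hy, rfl⟩ _ ⟨z, hz, rfl⟩
      rw [← commutatorElement_eq_one_iff_commute, ← map_commutatorElement]
      exact (QuotientGroup.eq_one_iff _).mpr (hcent y hy z hz))
    (by
      rintro _ ⟨y, hy, rfl⟩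
      rw [← map_pow]
      exact (QuotientGroup.eq_one_iff _).mpr
        (hc.pow_prime_mem (pSection_of_isPGroup (hVp.to_le h2)) y hy))
    (Nat.Coprime.coprime_dvd_left (orderOf_map_dvd f a) ha)
    (by
      rintro _ ⟨y, hy, rfl⟩
      exact ⟨⁅y, a⁆, h3 y hy, map_commutatorElement f y a⟩)
    (by
      rintro _ ⟨y, hy, rfl⟩
      rw [← map_commutatorElement]
      exact frat_map f p V (haf y hy))
  have := hkey (f x) ⟨x, hx, rfl⟩
  rw [← map_commutatorElement] at this
  exact (QuotientGroup.eq_one_iff _).mp this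

/-- If the normal `p`-subgroup `V` is a noncentral Hall subgroup of `K` modulo `Φ`, then some chief factor `V / W` is complemented and not centralised by `K`. -/
theorem exists_complemented_chiefFactor [Finite G] {p : ℕ} [hp : Fact p.Prime] {V K Φ : Subgroup G}
    (hV : V.Normal) (hVp : IsPGroup p V) (hK : K.Normal) (hVK : V ≤ K)
    (hidx : ¬ p ∣ V.relIndex K) (hΦ : Φ.Normal) (hΦV : Φ ≤ V)
    (hVV : ⁅V, V⁆ ≤ Φ) (hact : ¬ ⁅V, K⁆ ≤ Φ) :
    ∃ W C : Subgroup G, IsChiefFactor W V ∧ ¬ ⁅V, K⁆ ≤ W ∧ C ⊔ V = ⊤ ∧ C ⊓ V = W := by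
  let f := QuotientGroup.mk' (Φ)
  have hf : Function.Surjective f := QuotientGroup.mk'_surjective _
  have hker : f.ker = Φ := QuotientGroup.ker_mk' _
  have hkV : f.ker ≤ V := hker.le.trans hΦV
  set A := V.map f with hA
  have hAn : A.Normal := hV.map f hf
  have hKn : (K.map f).Normal := hK.map f hf
  have hAc : ∀ a b : A, a * b = b * a := by
    rintro ⟨_, a, ha, rfl⟩ ⟨_, b, hb, rfl⟩
    exact Subtype.ext (comm_mod hVV ha hb).eq
  have hcop : (Nat.card A).Coprime (A.relIndex (K.map f)) := by
    obtain ⟨n, hn⟩ := IsPGroup.iff_card.mp (hVp.map f)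
    rw [hA, hn, relIndex_map_map, sup_eq_left.mpr hkV, sup_eq_left.mpr (hkV.trans hVK)]
    exact Nat.Coprime.pow_left _ ((Nat.Prime.coprime_iff_not_dvd hp.out).mpr hidx)
  obtain ⟨h1, C, h2, h3⟩ := exists_supplement_of_coprime hAc hKn (map_mono hVK) hcop
  set E := centralizer ((K.map f : Subgroup _) : Set (G ⧸ Φ)) ⊓ A with hE
  have hEA : E < A := by
    refine lt_of_le_of_ne inf_le_right fun h => hact ?_
    have h4 : A ≤ centralizer ((K.map f : Subgroup _) : Set (G ⧸ Φ)) := inf_eq_right.mp h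
    rw [← hker, ← Subgroup.map_eq_bot_iff, map_commutator, commutator_eq_bot_iff_le_centralizer]
    exact h4
  have hEn : E.Normal := by
    rw [hE]
    infer_instance
  obtain ⟨W, hEW, hc⟩ := exists_chiefFactor_le hEn hAn hEA
  have hWn := hc.normal_bot
  have hVc : A.comap f = V := comap_map_eq_self hkV
  refine ⟨W.comap f, (W ⊔ C).comap f, hVc ▸ hc.comap hf, fun h => hc.lt.not_ge ?_, ?_, ?_⟩
  · refine h1.trans (sup_le ?_ hEW)
    rw [hA, ← map_commutator, map_le_iff_le_comap]
    exact h
  · rw [← hVc, comap_sup_eq f _ _ hf, sup_assoc, h2, sup_top_eq, comap_top]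
  · rw [← hVc, ← comap_inf, sup_inf_of_le' hWn hc.lt.le, h3, sup_eq_left.mpr hEW]

end Coprime

end ICPi

/-! ### From a Sylow subgroup of `X` to `X` -/

namespace ICPi

open Subgroup
open scoped commutatorElement

universe u

section Transfer

variable {G : Type*} [Group G]

theorem card_map_of_inf_ker_eq_bot {G' : Type*} [Group G'] {f : G →* G'} {H : Subgroup G}
    (h : H ⊓ f.ker = ⊥) : Nat.card (H.map f) = Nat.card H := by
  rw [← relIndex_ker, ← inf_relIndex_right, inf_comm, h, relIndex_bot_left]

theorem inf_eq_bot_of_not_dvd [Finite G] {p : ℕ} [hp : Fact p.Prime] {P R : Subgroup G}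
    (hP : IsPGroup p P) (hR : ¬ p ∣ Nat.card R) : P ⊓ R = ⊥ := by
  obtain ⟨n, hn⟩ := IsPGroup.iff_card.mp hP
  refine (disjoint_of_coprime_natCard ?_).eq_bot
  rw [hn]
  exact Nat.Coprime.pow_left _ ((Nat.Prime.coprime_iff_not_dvd hp.out).mpr hR)

/-- The map is injective on the `p`-group `P`, so subgroups of the image lift to subgroups of `P` of
the same order. -/
theorem OrderHypothesis.map_of_coprime [Finite G] {p d : ℕ} [hp : Fact p.Prime] {P : Subgroup G}
    {G' : Type*} [Group G'] {f : G →* G'} (hf : Function.Surjective f)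
    (h : OrderHypothesis p d P) (hker : ¬ p ∣ Nat.card f.ker) : OrderHypothesis p d (P.map f) := by
  have hbot : ∀ H ≤ P, H ⊓ f.ker = ⊥ := fun H hH =>
    inf_eq_bot_of_not_dvd (h.isPGroup.to_le hH) hker
  have hpull : ∀ H ≤ P.map f, (H.comap f ⊓ P).map f = H := by
    intro H hH
    apply le_antisymm
    · rintro _ ⟨x, hx, rfl⟩
      exact hx.1
    · intro y hy
      obtain ⟨x, hx, rfl⟩ := hH hy
      exact ⟨x, ⟨hy, hx⟩, rfl⟩
  have hcard : ∀ H ≤ P.map f, Nat.card (H.comap f ⊓ P : Subgroup G) = Nat.card H := by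
    intro H hH
    rw [← card_map_of_inf_ker_eq_bot (f := f) (hbot _ inf_le_right), hpull H hH]
  have hmap : ∀ H ≤ P.map f, ICPiProperty (H.comap f ⊓ P) → ICPiProperty H := by
    intro H hH hIC
    rw [← hpull H hH]
    exact hIC.map_of_coprime hf h.isPGroup.to_inf_right hker
  refine ⟨h.isPGroup.map f, h.exists_pow, h.one_lt, ?_, fun H hH hd => ?_,
    fun h2 hd2 hab H hH hcyc hH4 => ?_⟩
  · rw [card_map_of_inf_ker_eq_bot (hbot P le_rfl)]
    exact h.lt_card
  · exact hmap H hH (h.ic _ inf_le_right ((hcard H hH).trans hd))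
  · refine hmap H hH (h.ic_four h2 hd2 (fun hc => hab ?_) _ inf_le_right ?_
      ((hcard H hH).trans hH4))
    · rintro _ ⟨a, ha, rfl⟩ _ ⟨b, hb, rfl⟩
      rw [← map_mul, ← map_mul, hc a ha b hb]
    · let φ : (H.comap f ⊓ P : Subgroup G) →* H :=
        (f.comp (H.comap f ⊓ P).subtype).codRestrict H fun x => x.2.1
      refine isCyclic_of_injective φ fun x y hxy => ?_
      have h1 : f x = f y := congrArg Subtype.val hxy
      have hk : (x : G) * (y : G)⁻¹ ∈ f.ker := by
        rw [MonoidHom.mem_ker, map_mul, map_inv, h1, mul_inv_cancel]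
      have h3 : (x : G) * (y : G)⁻¹ ∈ P ⊓ f.ker :=
        ⟨mul_mem (S := Subgroup G) x.2.2 (inv_mem (S := Subgroup G) y.2.2), hk⟩
      rw [hbot P le_rfl, mem_bot] at h3
      exact Subtype.ext (mul_inv_eq_one.mp h3)

theorem mem_of_pow_mem_of_not_dvd [Finite G] {p n : ℕ} [hp : Fact p.Prime] {V K : Subgroup G}
    (hV : V.Normal) (h : ¬ p ∣ V.relIndex K) {x : G} (hx : x ∈ K) (hxn : x ^ p ^ n ∈ V) :
    x ∈ V := by
  refine mem_of_pow_mem_of_coprime (a := V.relIndex K) ?_ hxn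
    (Nat.Coprime.pow_right _ ((Nat.Prime.coprime_iff_not_dvd hp.out).mpr h).symm)
  exact pow_index_mem (V.subgroupOf K) ⟨x, hx⟩

theorem PSection.isPGroup {p : ℕ} {V : Subgroup G} (h : PSection p ⊥ V) : IsPGroup p V := by
  rintro ⟨x, hx⟩
  obtain ⟨n, hn⟩ := h x hx
  exact ⟨n, Subtype.ext (mem_bot.mp hn)⟩

theorem PSection.trans {p : ℕ} {K L M : Subgroup G} (h1 : PSection p K L) (h2 : PSection p L M) :
    PSection p K M := by
  intro x hx
  obtain ⟨n, hn⟩ := h2 x hx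
  obtain ⟨m, hm⟩ := h1 _ hn
  exact ⟨n + m, by rwa [pow_add, pow_mul]⟩

theorem cyclicSection_bot_of_isCyclic {V : Subgroup G} [hV : IsCyclic V] : CyclicSection ⊥ V := by
  obtain ⟨⟨y, hy⟩, hgen⟩ := hV.exists_generator
  refine ⟨y, hy, fun x hx => mem_sup_left ?_⟩
  obtain ⟨n, hn⟩ := hgen ⟨x, hx⟩
  exact ⟨n, congrArg Subtype.val hn⟩

/-- If `X` has no nontrivial normal `p'`-subgroups, then it contains the centraliser of its largest
normal `p`-subgroup. -/
theorem OrderHypothesis.centralizer_le [Finite G] {p d : ℕ} [hp : Fact p.Prime]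
    {P X V : Subgroup G} (h : OrderHypothesis p d P) (hX : X.Normal) (hPi : ¬ p ∣ P.relIndex X)
    (hR : ∀ R : Subgroup G, R.Normal → R ≤ X → ¬ p ∣ Nat.card R → R = ⊥) (hV : V.Normal)
    (hmax : ∀ R : Subgroup G, R.Normal → ⊥ ≤ R → R ≤ X → PSection p ⊥ R → R ≤ V) :
    ∀ x ∈ X, (∀ v ∈ V, ⁅v, x⁆ ∈ (⊥ : Subgroup G)) → x ∈ V := by
  by_contra! hcon
  obtain ⟨x, hxX, hx, hxV⟩ := hcon
  obtain ⟨M, hM, hMX, hMC, hperf, hMV, hprop⟩ := exists_perfect_le_centralizer (p := p)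
    Subgroup.normal_bot hV hX bot_le bot_le hmax
    (fun R r1 _ r3 r4 => by
      rw [relIndex_bot_left] at r4
      rw [hR R r1 r3 r4]
      exact bot_le) ⟨x, hxX, hxV, hx⟩
  suffices hMp : ¬ p ∣ Nat.card M from hMV (by rw [hR M hM hMX hMp]; exact bot_le)
  refine not_dvd_card_of_central (P := P) hM hperf (fun D hD hDp => ?_) fun y hy hyM hexp m hm => ?_
  · obtain ⟨g, -, hg⟩ := exists_conj_mem_of_not_dvd h.isPGroup hPi hDp (hD.trans hMX)
    exact ⟨g, hg⟩
  · obtain ⟨H, hyH, hHP, hIC⟩ := exists_ic_of_mem h le_rfl h.lt_card.le hy hexp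
    have hYM : M ⊓ V < M := lt_of_le_of_ne inf_le_left fun h' => hMV (inf_eq_left.mp h')
    have h1 := hIC.inf_le_of_perfect (h.isPGroup.to_le hHP) hM inferInstance hYM hperf
      (fun R hRn hlt => le_inf hlt.le (hprop R hRn hlt)) ⟨hyH, hyM⟩
    exact commutatorElement_eq_one_iff_commute.mp (mem_bot.mp (hMC y h1.2 m hm))

/-- If the largest normal `p`-subgroup `V` of `X` has order at most `d`, then `K / V`, the largest
normal `p'`-subgroup of `X / V`, contains its centraliser. -/
theorem OrderHypothesis.centralizer_le_of_card_le [Finite G] {p d : ℕ} [hp : Fact p.Prime]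
    {P X V K : Subgroup G} (h : OrderHypothesis p d P) (hX : X.Normal)
    (hPi : ¬ p ∣ P.relIndex X) (hV : V.Normal) (hVp : IsPGroup p V) (hVX : V ≤ X)
    (hmax : ∀ R : Subgroup G, R.Normal → ⊥ ≤ R → R ≤ X → PSection p ⊥ R → R ≤ V)
    (hCV : ∀ x ∈ X, (∀ v ∈ V, ⁅v, x⁆ ∈ (⊥ : Subgroup G)) → x ∈ V) (hVd : Nat.card V ≤ d)
    (hK : K.Normal) (hVK : V ≤ K) (hKp : ¬ p ∣ V.relIndex K)
    (hKmax : ∀ R : Subgroup G, R.Normal → V ≤ R → R ≤ X → ¬ p ∣ V.relIndex R → R ≤ K) :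
    ∀ x ∈ X, (∀ k ∈ K, ⁅k, x⁆ ∈ V) → x ∈ K := by
  by_contra! hcon
  obtain ⟨x, hxX, hx, hxK⟩ := hcon
  obtain ⟨M, hM, hMX, hMC, hperf, hMK, hprop⟩ := exists_perfect_le_centralizer (p := p)
    hV hK hX hVK hVX (fun R r1 _ r3 r4 => (hmax R r1 bot_le r3
      ((pSection_of_isPGroup hVp).trans r4)).trans hVK) hKmax ⟨x, hxX, hxK, hx⟩
  have hYM : M ⊓ K < M := lt_of_le_of_ne inf_le_left fun h' => hMK (inf_eq_left.mp h')
  have hVpow : ∀ y ∈ K, ∀ n, y ^ p ^ n ∈ V → y ∈ V := fun y hy n hn =>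
    mem_of_pow_mem_of_not_dvd hV hKp hy hn
  have hHM : ∀ H ≤ P, Nat.card H = d → H ⊓ M ≤ V := by
    intro H hHP hHd y hy
    have h1 := (h.ic H hHP hHd).inf_le_of_perfect (h.isPGroup.to_le hHP) hM inferInstance hYM hperf
      (fun R hRn hlt => le_inf hlt.le (hprop R hRn hlt)) hy
    obtain ⟨n, hn⟩ := pSection_of_isPGroup (K := V) h.isPGroup y (hHP hy.1)
    exact hVpow y h1.2 n hn
  obtain ⟨k, rfl⟩ := h.exists_pow
  -- If `P ∩ M ≤ V`, Sylow conjugacy puts every `p`-element of `M` in `V`. Then `VM / V` is a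
  -- `p'`-group and `M ≤ K`.
  obtain ⟨y, ⟨hyP, hyM⟩, hyV⟩ : ∃ y ∈ P ⊓ M, y ∉ V := by
    by_contra! hle
    have hdvd : p ∣ V.relIndex (V ⊔ M) := by
      by_contra hnd
      exact hMK (le_sup_right.trans (hKmax (V ⊔ M) inferInstance le_sup_left (sup_le hVX hMX) hnd))
    rw [relIndex_sup_left] at hdvd
    obtain ⟨z, hzM, hzV, hzp⟩ := exists_mem_pow_mem_of_dvd_relIndex hV hdvd
    have hz : IsPGroup p (zpowers z) := by
      obtain ⟨n, hn⟩ := pSection_of_isPGroup (K := ⊥) hVp _ hzp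
      rw [mem_bot, ← pow_mul, ← pow_succ'] at hn
      rw [IsPGroup.iff_card, Nat.card_zpowers]
      obtain ⟨j, -, hj⟩ := (Nat.dvd_prime_pow hp.out).mp (orderOf_dvd_of_pow_eq_one hn)
      exact ⟨j, hj⟩
    obtain ⟨g, -, hg⟩ := exists_conj_mem_of_not_dvd h.isPGroup hPi hz
      ((zpowers_le.mpr hzM).trans hMX)
    have h1 := hle _ ⟨hg z (mem_zpowers z), hM.conj_mem z hzM g⟩
    have h2 := hV.conj_mem _ h1 g⁻¹
    exact hzV (by simpa [mul_assoc] using h2)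
  have hlt : p ^ k < orderOf y := by
    by_contra hle
    obtain ⟨H, h1, h2, h3⟩ := exists_card_eq h.isPGroup (zpowers_le.mpr hyP) (k := k)
      (by rw [Nat.card_zpowers]; lia) h.lt_card.le
    exact hyV (hHM H h2 h3 ⟨h1 (mem_zpowers y), hyM⟩)
  obtain ⟨H, -, h2, h3⟩ := exists_card_eq (Q := zpowers y) (A := ⊥)
    (h.isPGroup.to_le (zpowers_le.mpr hyP)) bot_le (k := k)
    (by rw [card_bot]; exact Nat.one_le_pow _ _ hp.out.pos) (by rw [Nat.card_zpowers]; exact hlt.le)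
  have hHV : H ≤ V := fun z hz =>
    hHM H (h2.trans (zpowers_le.mpr hyP)) h3 ⟨hz, zpowers_le.mpr hyM (h2 hz)⟩
  -- The subgroup `H` of order `d` in `⟨y⟩` lies in `V`, and `|V| ≤ d`. So `V` is cyclic, and the
  -- perfect group `M` must centralise it.
  have hHV' : H = V := eq_of_le_of_card_ge hHV (by rw [h3]; exact hVd)
  have hcyc : IsCyclic V := by
    rw [← hHV']
    exact isCyclic_of_le h2
  refine hMK fun m hm => hVK (hCV m (hMX hm) fun v hv => ?_)
  refine commutator_mem_of_cyclicSection Subgroup.normal_bot hV cyclicSection_bot_of_isCyclic ?_ hv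
  rw [← hperf] at hm
  exact commutator_mono le_top le_top hm

/-- The largest normal `p`-subgroup of `X` has order greater than `d`. -/
theorem OrderHypothesis.lt_card_of_greatest [Finite G] {p d : ℕ} [hp : Fact p.Prime]
    {P X V : Subgroup G} (h : OrderHypothesis p d P) (hX : X.Normal) (hPX : P ≤ X)
    (hPi : ¬ p ∣ P.relIndex X) (hV : V.Normal) (hVp : IsPGroup p V) (hVX : V ≤ X)
    (hmax : ∀ R : Subgroup G, R.Normal → ⊥ ≤ R → R ≤ X → PSection p ⊥ R → R ≤ V)
    (hCV : ∀ x ∈ X, (∀ v ∈ V, ⁅v, x⁆ ∈ (⊥ : Subgroup G)) → x ∈ V) : d < Nat.card V := by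
  by_contra! hVd
  have hVP : V ≤ P := le_of_normal_of_not_dvd h.isPGroup hPi hVp hVX hV
  obtain ⟨K, hK, hVK, hKX, hKp, hKmax⟩ := exists_greatest_not_dvd p hV hVX
  have hCK := h.centralizer_le_of_card_le hX hPi hV hVp hVX hmax hCV hVd hK hVK hKp hKmax
  have hVpow : ∀ y ∈ K, ∀ n, y ^ p ^ n ∈ V → y ∈ V := fun y hy n hn =>
    mem_of_pow_mem_of_not_dvd hV hKp hy hn
  have hKn := commutator_top_normal K
  set K₁ := ⁅K, (⊤ : Subgroup G)⁆ ⊔ V with hK₁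
  have hK₁K : K₁ ≤ K := sup_le (commutator_le_left K ⊤) hVK
  have hK₁p : ¬ p ∣ V.relIndex K₁ := fun hd => hKp (hd.trans
    (Dvd.intro _ (relIndex_mul_relIndex V K₁ K le_sup_right hK₁K)))
  -- Trivial action on `V / Φ(V)` makes the `p'`-elements of `K₁` centralise `V`, so `K₁ = V`. Then
  -- `X` centralises `K / V`, so `X ≤ K` and `P = V`, against `|V| ≤ d < |P|`.
  have hact : ¬ ⁅V, K₁⁆ ≤ frat p V := by
    intro hle
    have hK₁V : K₁ ≤ V := by
      intro x hx
      obtain ⟨n, hn⟩ := exists_pow_coprime (p := p) x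
      refine hVpow x (hK₁K hx) n (hCV _ (hKX (hK₁K (pow_mem hx _))) fun v hv => mem_bot.mpr ?_)
      exact commutator_eq_one_of_frat hV hVp hn
        (fun w hw => hle (commutator_mem_commutator hw (pow_mem hx _))) v hv
    have hXK : X ≤ K := fun x hx => hCK x hx fun k hk =>
      hK₁V (mem_sup_left (commutator_mem_commutator hk (mem_top x)))
    have hPV : P ≤ V := by
      intro x hx
      obtain ⟨n, hn⟩ := pSection_of_isPGroup (K := V) h.isPGroup x hx
      exact hVpow x (hXK (hPX hx)) n hn
    have h1 := h.lt_card
    rw [le_antisymm hPV hVP] at h1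
    exact h1.not_ge hVd
  obtain ⟨W, C, hc, hWact, hCV', hCW⟩ := exists_complemented_chiefFactor hV hVp inferInstance
    le_sup_right hK₁p (frat_normal p hV) (frat_le p V) (commutator_le_frat p V) hact
  have hWn := hc.normal_bot
  -- A cyclic `V / W` is centralised by `G' ≥ [K, G]` and by `V`, hence by `K₁`; this is why `K₁` is
  -- used in place of `K`.
  have hcyc : ¬ CyclicSection W V := by
    intro hcyc
    have hle : K₁ ≤ centralizerMod W V := by
      refine sup_le (fun x hx => ?_) (fun x hx => ?_) <;> refine mem_centralizerMod.mpr fun v hv => ?_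
      · exact commutator_mem_of_cyclicSection hWn hV hcyc (commutator_mono le_top le_rfl hx) hv
      · exact hcyc.commutator_le hWn (commutator_mem_commutator hv hx)
    exact hWact (Subgroup.commutator_le.mpr fun v hv k hk => mem_centralizerMod.mp (hle hk) v hv)
  obtain ⟨S, hPS⟩ := h.isPGroup.exists_le_sylow
  obtain ⟨k, rfl⟩ := h.exists_pow
  refine false_of_supplement h.isPGroup hc hVP hcyc hVd h.lt_card h.ic S fun L₀ hW hL hS => ?_
  refine ⟨(C ⊓ P) ⊔ L₀, le_sup_right, sup_le inf_le_right (hL.trans hVP), ?_, ?_⟩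
  · refine le_antisymm (sup_le hVP (sup_le inf_le_right (hL.trans hVP))) fun x hx => ?_
    have hxC : x ∈ C ⊔ V := by
      rw [hCV']
      exact mem_top x
    obtain ⟨c, hc', v, hv, rfl⟩ := mem_sup_of_normal_right.mp hxC
    have hcP : c ∈ P := by simpa using mul_mem hx (inv_mem (hVP hv))
    exact mul_mem (mem_sup_right (mem_sup_left ⟨hc', hcP⟩)) (mem_sup_left hv)
  · refine le_antisymm ?_ (le_inf le_sup_right hL)
    rintro x ⟨hx, hxV⟩
    obtain ⟨c, hc', l, hl, rfl⟩ := exists_mul_of_mem_sup ((inf_le_right.trans hPS).trans hS) hx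
    have hxV' : c * l ∈ V := hxV
    have hcV : c ∈ C ⊓ V :=
      ⟨hc'.1, by simpa using mul_mem (S := Subgroup G) hxV' (inv_mem (S := Subgroup G) (hL hl))⟩
    rw [hCW] at hcV
    exact mul_mem (hW hcV) hl

end Transfer

theorem cyclicBetween_of_sylow_aux {p : ℕ} [hp : Fact p.Prime] (n : ℕ) :
    ∀ {G : Type u} [Group G] [Finite G] {d : ℕ} {P X : Subgroup G}, Nat.card X = n → X.Normal →
      P ≤ X → ¬ p ∣ P.relIndex X → OrderHypothesis p d P → CyclicBetween p ⊥ X := by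
  induction n using Nat.strong_induction_on with
  | _ n ih =>
  intro G _ _ d P X hn hX hPX hPi h
  by_cases hR : ∀ R : Subgroup G, R.Normal → R ≤ X → ¬ p ∣ Nat.card R → R = ⊥
  · obtain ⟨V, hV, -, hVX, hVps, hmax⟩ := exists_greatest_pSection p Subgroup.normal_bot
      (bot_le : ⊥ ≤ X)
    have hVp := hVps.isPGroup
    have hCV := h.centralizer_le hX hPi hR hV hmax
    have hVd := h.lt_card_of_greatest hX hPX hPi hV hVp hVX hmax hCV
    have hVP := le_of_normal_of_not_dvd h.isPGroup hPi hVp hVX hV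
    refine cyclicBetween_of_centralizer_le Subgroup.normal_bot hV bot_le hVX ?_ hVps
      ((h.mono hVP hVd).cyclicBetween hV) hCV
    rw [card_bot]
    exact hp.out.one_lt.ne' ∘ Nat.dvd_one.mp
  · push Not at hR
    obtain ⟨R, hRn, hRX, hRp, hR1⟩ := hR
    let f := QuotientGroup.mk' R
    have hf : Function.Surjective f := QuotientGroup.mk'_surjective R
    have hker : f.ker = R := QuotientGroup.ker_mk' R
    have h1 : CyclicBetween p ⊥ (X.map f) := by
      refine ih _ ?_ rfl (hX.map f hf) (map_mono hPX) ?_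
        (h.map_of_coprime hf (by rwa [hker]))
      · rw [← hn, card_eq_mul_card_map f (hker.le.trans hRX), hker]
        exact lt_mul_of_one_lt_left Nat.card_pos ((one_lt_card_iff_ne_bot R).mpr hR1)
      · rw [relIndex_map_map, sup_eq_left.mpr (hker.le.trans hRX)]
        exact fun hd => hPi (hd.trans (relIndex_dvd_of_le_left X le_sup_left))
    have h2 := cyclicBetween_of_map hf h1
    rw [hker] at h2
    exact cyclicBetween_trans hRn bot_le
      (cyclicBetween_of_not_dvd (by rwa [relIndex_bot_left])) h2 hRX

/-- A normal subgroup whose Sylow `p`-subgroup satisfies the order hypothesis has only cyclic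
chief factors of order divisible by `p`. -/
theorem OrderHypothesis.cyclicBetween_of_sylow {p : ℕ} [Fact p.Prime] {G : Type*} [Group G]
    [Finite G] {d : ℕ} {P X : Subgroup G} (h : OrderHypothesis p d P) (hX : X.Normal)
    (hPX : P ≤ X) (hPi : ¬ p ∣ P.relIndex X) : CyclicBetween p ⊥ X :=
  cyclicBetween_of_sylow_aux _ rfl hX hPX hPi h

end ICPi

/-! ### The generalized `p`-Fitting subgroup and the passage to `N` -/

namespace ICPi

open Subgroup
open scoped commutatorElement

section GeneralizedPFitting

variable {G : Type*} [Group G]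

theorem inducesInner_of_commutator_mem {K L : Subgroup G} [K.Normal] {x : G}
    (h : ∀ y ∈ L, ⁅y, x⁆ ∈ K) : InducesInner K L x := by
  refine ⟨1, one_mem _, ?_⟩
  rintro _ ⟨y, hy, rfl⟩
  have h1 : ((⁅y, x⁆ : G) : G ⧸ K) = 1 := (QuotientGroup.eq_one_iff _).mpr (h y hy)
  have h2 : ⁅(y : G ⧸ K), (x : G ⧸ K)⁆ = 1 := h1
  rw [commutatorElement_eq_one_iff_mul_comm] at h2
  rw [QuotientGroup.mk'_apply, ← h2]
  simp

theorem inducesInner_of_mem {K L : Subgroup G} [K.Normal] {x : G} (h : x ∈ L) :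
    InducesInner K L x :=
  ⟨x, mem_map_of_mem (QuotientGroup.mk' K) h, fun _ _ => rfl⟩

theorem mem_generalizedPFitting {p : ℕ} {x : G}
    (h : ∀ K L : Subgroup G, IsChiefFactor K L → p ∣ K.relIndex L →
      x ∈ L ∨ ∀ y ∈ L, ⁅y, x⁆ ∈ K) : x ∈ generalizedPFitting p G := by
  intro K L _ hc hp
  rw [card_quot] at hp
  exact (h K L hc hp).elim inducesInner_of_mem inducesInner_of_commutator_mem

/-- Otherwise `L = K(L ∩ O)` and `|L / K|` would divide `|O|`. -/
theorem IsChiefFactor.inf_le_of_not_dvd_card [Finite G] {p : ℕ} {K L O : Subgroup G}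
    (hc : IsChiefFactor K L) (hp : p ∣ K.relIndex L) (hO : O.Normal)
    (hOp : ¬ p ∣ Nat.card O) : L ⊓ O ≤ K := by
  have := hc.normal_bot
  have := hc.normal_top
  rcases hc.eq_or_eq (K ⊔ (L ⊓ O)) inferInstance le_sup_left (sup_le hc.lt.le inf_le_left)
    with h | h
  · rw [← h]
    exact le_sup_right
  · refine absurd ?_ hOp
    rw [← h, relIndex_sup_left] at hp
    exact (hp.trans (relIndex_dvd_card _ _)).trans (card_dvd_of_le inf_le_right)

/-- If `L ∩ V ≤ K`, then `[L, V] ≤ K`. Otherwise `L ≤ KV`, and `LO / KO` is a chief factor inside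
the normal `p`-section `KV / KO`, hence centralised by `V`; intersecting with `L` removes `O`. -/
theorem le_generalizedPFitting_of_pSection [Finite G] {p : ℕ} [hp : Fact p.Prime]
    {O V : Subgroup G} (hO : O.Normal) (hV : V.Normal) (hOV : O ≤ V) (hOp : ¬ p ∣ Nat.card O)
    (hps : PSection p O V) : V ≤ generalizedPFitting p G := by
  refine fun x hx => mem_generalizedPFitting fun K L hc hd => Or.inr fun y hy => ?_
  have hK := hc.normal_bot
  have hL := hc.normal_top
  have hLO := hc.inf_le_of_not_dvd_card hd hO hOp
  have hyxL : ⁅y, x⁆ ∈ L := commutator_le_left L V (commutator_mem_commutator hy hx)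
  have hyxV : ⁅y, x⁆ ∈ V := commutator_le_right L V (commutator_mem_commutator hy hx)
  rcases hc.eq_or_eq (K ⊔ (L ⊓ V)) inferInstance le_sup_left (sup_le hc.lt.le inf_le_left)
    with h | h
  · rw [← h]
    exact mem_sup_right ⟨hyxL, hyxV⟩
  · have hLV : L ⊔ O ≤ K ⊔ V := by
      refine sup_le ?_ (hOV.trans le_sup_right)
      rw [← h]
      exact sup_le_sup_left inf_le_right K
    have hps' : PSection p (K ⊔ O) (K ⊔ V) := by
      have h1 : PSection p (K ⊔ O) ((K ⊔ O) ⊔ V) :=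
        PSection.sup inferInstance le_rfl (fun z hz => ⟨0, by simpa using hz⟩)
          (hps.mono le_sup_right le_rfl)
      exact h1.mono le_rfl (sup_le_sup_right le_sup_left V)
    have h1 := (hc.sup_chiefFactor hO hLO).commutator_mem_of_pSection hps' inferInstance hLV y
      (mem_sup_left hy) x (mem_sup_right hx)
    have h2 : ⁅y, x⁆ ∈ (K ⊔ O) ⊓ L := ⟨h1, hyxL⟩
    rwa [sup_inf_of_le hO hc.lt.le, inf_comm, sup_eq_left.mpr hLO] at h2

theorem commutator_commutator_le_of_rotate {K H₁ H₂ H₃ : Subgroup G} (hK : K.Normal)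
    (h1 : ⁅⁅H₂, H₃⁆, H₁⁆ ≤ K) (h2 : ⁅⁅H₃, H₁⁆, H₂⁆ ≤ K) : ⁅⁅H₁, H₂⁆, H₃⁆ ≤ K := by
  have hker : ∀ H : Subgroup G, H ≤ K ↔ H.map (QuotientGroup.mk' K) = ⊥ := fun H => by
    rw [Subgroup.map_eq_bot_iff, QuotientGroup.ker_mk']
  rw [hker, map_commutator, map_commutator] at h1 h2 ⊢
  exact commutator_commutator_eq_bot_of_rotate h1 h2

/-- Either `M ≤ L`, and the action on `L / K` is inner, or `M ∩ L < M` lies in `V`. Then `[L, M, M]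
≤ L ∩ O ≤ K`, and the three subgroups lemma with `M = M'` gives `[L, M] ≤ K`. -/
theorem le_generalizedPFitting_of_minimal [Finite G] {p : ℕ} {O V M : Subgroup G} (hO : O.Normal)
    (hOp : ¬ p ∣ Nat.card O) (hM : M.Normal) (hMC : ∀ v ∈ V, ∀ m ∈ M, ⁅v, m⁆ ∈ O)
    (hperf : ⁅M, M⁆ = M) (hmin : ∀ R : Subgroup G, R.Normal → R < M → R ≤ V) :
    M ≤ generalizedPFitting p G := by
  refine fun x hx => mem_generalizedPFitting fun K L hc hd => ?_
  have hK := hc.normal_bot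
  have hL := hc.normal_top
  have hLO := hc.inf_le_of_not_dvd_card hd hO hOp
  rcases (inf_le_left : M ⊓ L ≤ M).lt_or_eq with h | h
  · right
    have hMLV := hmin _ inferInstance h
    have h1 : ⁅⁅L, M⁆, M⁆ ≤ K := by
      refine Subgroup.commutator_le.mpr fun z hz m hm => hLO ⟨?_, ?_⟩
      · exact commutator_le_left L M (commutator_mono (commutator_le_left L M) le_rfl
          (commutator_mem_commutator hz hm))
      · exact hMC z (hMLV ⟨commutator_le_right L M hz, commutator_le_left L M hz⟩) m hm
    have h2 : ⁅⁅M, M⁆, L⁆ ≤ K :=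
      commutator_commutator_le_of_rotate hK (by rwa [commutator_comm M L]) h1
    rw [hperf, commutator_comm] at h2
    exact fun y hy => h2 (commutator_mem_commutator hy hx)
  · left
    exact inf_eq_left.mp h hx

theorem characteristic_of_greatest_not_dvd {p : ℕ} {O : Subgroup G} (hO : O.Normal)
    (hOp : ¬ p ∣ Nat.card O) (hmax : ∀ R : Subgroup G, R.Normal → ¬ p ∣ Nat.card R → R ≤ O) :
    O.Characteristic :=
  characteristic_iff_map_le.mpr fun φ => hmax _ (hO.map _ φ.surjective) (by
    rwa [card_map_of_injective φ.injective])

theorem characteristic_of_greatest_pSection {p : ℕ} {O V : Subgroup G} (hO : O.Characteristic)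
    (hV : V.Normal) (hOV : O ≤ V) (hps : PSection p O V)
    (hmax : ∀ R : Subgroup G, R.Normal → O ≤ R → PSection p O R → R ≤ V) : V.Characteristic := by
  refine characteristic_iff_map_le.mpr fun φ => hmax _ (hV.map _ φ.surjective) ?_ ?_
  · rw [← characteristic_iff_map_eq.mp hO φ]
    exact map_mono hOV
  · rintro _ ⟨x, hx, rfl⟩
    obtain ⟨n, hn⟩ := hps x hx
    refine ⟨n, ?_⟩
    rw [← characteristic_iff_map_eq.mp hO φ, ← map_pow]
    exact mem_map_of_mem _ hn

theorem commutator_normalClosure_self {M : Subgroup G} (h : ⁅M, M⁆ = M) :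
    ⁅normalClosure (M : Set G), normalClosure (M : Set G)⁆ = normalClosure (M : Set G) := by
  refine le_antisymm (commutator_le_self _) (normalClosure_le_normal ?_)
  intro x hx
  rw [SetLike.mem_coe, ← h] at hx
  exact commutator_mono subset_normalClosure subset_normalClosure hx

/-- If the chief factors of order divisible by `p` below a normal subgroup containing the
generalized `p`-Fitting subgroup of `N` are cyclic, then so are those below `N`. -/
theorem cyclicBetween_of_generalizedPFitting_le [Finite G] {p : ℕ} [hp : Fact p.Prime]
    {N X : Subgroup G} (hN : N.Normal) (hX : X.Normal)
    (hFX : (generalizedPFitting p N).map N.subtype ≤ X) (h : CyclicBetween p ⊥ X) :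
    CyclicBetween p ⊥ N := by
  obtain ⟨O, hO, -, -, hOp, hOmax⟩ := exists_greatest_not_dvd p (G := N) Subgroup.normal_bot
    (le_top : ⊥ ≤ ⊤)
  simp only [relIndex_bot_left, bot_le, le_top, true_implies] at hOp hOmax
  obtain ⟨V, hV, hOV, -, hps, hVmax⟩ := exists_greatest_pSection p hO (le_top : O ≤ ⊤)
  simp only [le_top, true_implies] at hVmax
  have hOc := characteristic_of_greatest_not_dvd hO hOp hOmax
  have hVc := characteristic_of_greatest_pSection hOc hV hOV hps hVmax
  have hVX : V.map N.subtype ≤ X :=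
    (map_mono (le_generalizedPFitting_of_pSection hO hV hOV hOp hps)).trans hFX
  have hC : ∀ x, (∀ v ∈ V, ⁅v, x⁆ ∈ O) → x ∈ V := by
    by_contra! hcon
    obtain ⟨x, hx, hxV⟩ := hcon
    have hR : ∀ R : Subgroup N, O ≤ R → ¬ p ∣ O.relIndex R → ¬ p ∣ Nat.card R := by
      intro R hOR hnd hd
      rw [← relIndex_bot_left, ← relIndex_mul_relIndex ⊥ O R bot_le hOR, relIndex_bot_left] at hd
      exact (hp.out.dvd_mul.mp hd).elim hOp hnd
    obtain ⟨M, hM, -, hMC, hperf, hMV, hmin⟩ := exists_perfect_le_centralizer (p := p) (N := ⊤)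
      hO hV inferInstance hOV le_top (fun R h1 h2 _ h3 => hVmax R h1 h2 h3)
      (fun R h1 h2 _ h3 => (hOmax R h1 (hR R h2 h3)).trans hOV) ⟨x, mem_top x, hxV, hx⟩
    have hMX := (map_mono (le_generalizedPFitting_of_minimal hO hOp hM hMC hperf hmin)).trans hFX
    -- The subgroup `M` is normal only in `N`; its normal closure in `G` is still perfect and inside
    -- `X`, hence a `p'`-group, and it meets `N` inside `O`.
    have hL := not_dvd_card_of_perfect (p := p)
      (normalClosure_normal (s := ((M.map N.subtype : Subgroup G) : Set G)))
      (commutator_normalClosure_self (by rw [← map_commutator, hperf]))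
      (cyclicBetween_mono h le_rfl (normalClosure_le_normal hMX))
    refine hMV (le_trans ?_ ((hOmax ((normalClosure
      ((M.map N.subtype : Subgroup G) : Set G)).subgroupOf N) inferInstance fun hd => hL ?_).trans
        hOV))
    · exact fun m hm => subset_normalClosure (mem_map_of_mem N.subtype hm)
    · exact hd.trans (card_comap_dvd_of_injective _ _ N.subtype_injective)
  refine cyclicBetween_of_centralizer_le (O := O.map N.subtype) (V := V.map N.subtype)
    inferInstance inferInstance (map_mono hOV) (map_subtype_le V) ?_ ?_
    (cyclicBetween_mono h bot_le hVX) ?_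
  · rwa [card_map_of_injective N.subtype_injective]
  · rintro _ ⟨x, hx, rfl⟩
    obtain ⟨n, hn⟩ := hps x hx
    exact ⟨n, by rw [← map_pow]; exact mem_map_of_mem _ hn⟩
  · intro x hx hxV
    refine mem_map_of_mem N.subtype (hC ⟨x, hx⟩ fun v hv => ?_)
    obtain ⟨w, hw, hwv⟩ := hxV v (mem_map_of_mem N.subtype hv)
    rwa [N.subtype_injective (hwv.trans rfl : N.subtype w = N.subtype ⁅v, ⟨x, hx⟩⁆)] at hw

end GeneralizedPFitting

end ICPi

theorem theoremA {G : Type*} [Group G] [Finite G] (p : ℕ) (hp : p.Prime)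
    (N X : Subgroup G) (hN : N.Normal) (hX : X.Normal) (hpN : p ∣ Nat.card N)
    (hFX : (ICPi.generalizedPFitting p N).map N.subtype ≤ X) (hXN : X ≤ N)
    (P : Sylow p X) (d : ℕ) (hd : ∃ k : ℕ, d = p ^ k) (hd1 : 1 < d)
    (hdP : d < Nat.card P)
    (h1 : ∀ H : Subgroup G, H ≤ (P : Subgroup X).map X.subtype → Nat.card H = d →
      ICPi.ICPiProperty H)
    (h2 : p = 2 → d = 2 → ¬ (∀ a b : P, a * b = b * a) →
      ∀ H : Subgroup G, H ≤ (P : Subgroup X).map X.subtype → IsCyclic H → Nat.card H = 4 →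
        ICPi.ICPiProperty H) :
    N ≤ ICPi.pUHypercenter p G := by
  have : Fact p.Prime := ⟨hp⟩
  have h : ICPi.OrderHypothesis p d ((P : Subgroup X).map X.subtype) := by
    refine ⟨P.isPGroup'.map _, hd, hd1, ?_, h1, fun hp2 hd2 hab => h2 hp2 hd2 fun hab' => hab ?_⟩
    · rwa [Subgroup.card_map_of_injective X.subtype_injective]
    · rintro _ ⟨a, ha, rfl⟩ _ ⟨b, hb, rfl⟩
      exact congrArg (fun x : P => ((x : X) : G)) (hab' ⟨a, ha⟩ ⟨b, hb⟩)
  have hPi : ¬ p ∣ ((P : Subgroup X).map X.subtype).relIndex X := by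
    rw [Subgroup.relIndex, Subgroup.subgroupOf,
      Subgroup.comap_map_eq_self_of_injective X.subtype_injective]
    exact P.not_dvd_index
  have hcyc := h.cyclicBetween_of_sylow hX (Subgroup.map_subtype_le _) hPi
  exact le_sSup ⟨hN, ICPi.pChiefFactorsCyclicBelow_iff.mpr
    (ICPi.cyclicBetween_of_generalizedPFitting_le hN hX hFX hcyc)⟩
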